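/- Let $G=(V,E)$ be a finite graph (loops and parallel edges allowed). Identify each edge $e$ with $[0,1]$. A metric on $G$ is a vector $g=(g_e)_{e\in E}$ of positive numbers, $\ell_e=\sqrt{g_e}$ being the length of $e$. A density $\rho$ consists of positive functions $\rho_e\in C^\infty([0,1])$, $e\in E$ (with no condition relating different edges). Let $\mathcal A_+$ be the set of all pairs $(g,\rho)$. Let $W^{1,2}(G)$ be the space of continuous functions $f$ on the metric graph whose restrictions $f_e$ to the edges are in $W^{1,2}(0,1)$, and for $k\ge 0$ let $$\lambda_k(g,\rho)=\min_{\substack{S\subset W^{1,2}(G)\\ \dim S=k+1}}\ \max_{f\in S\setminus\{0\}}\ \frac{\sum_{e}\int_0^1 (f_e')^2\,g_e^{-1/2}\,dx}{\sum_{e}\int_0^1 f_e^2\,\rho_e\,g_e^{1/2}\,dx},$$ which is the $k$-th eigenvalue (counted from $k=0$, with multiplicity) of the problem $-g_e^{-1}f_e''=\lambda\rho_e f_e$ on the edges, with $f$ continuous and the outward arc-length derivatives summing to zero at every vertex (an edge $e$ leaving $v$ contributes the derivative $g_e^{-1/2}f_e'$ at $v$ in the direction pointing from $v$ into $e$). Put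 $$\overline{\lambda_k}(g,\rho)=\lambda_k(g,\rho)\Big(\sum_{e}\sqrt{g_e}\Big)\Big(\sum_e \sqrt{g_e}\int_0^1\rho_e\,dx\Big),\qquad \overline{\lambda_k}^{(\alpha)}(g,\rho)=\lambda_k(g,\rho)\Big(\sum_{e}g_e^{1-\alpha}\Big)\Big(\sum_e g_e^{\alpha}\int_0^1\rho_e\,dx\Big)\quad(\alpha\in\mathbb R).$$ A pair $(g_*,\rho_*)\in\mathcal A_+$ is extremal for $\Phi:\mathcal A_+\to\mathbb R$ if for every smooth one-parameter family $(g(t),\rho(t))$ in $\mathcal A_+$, $|t|<\varepsilon$, (each $g_e(t)$ smooth in $t$ and each $\rho_e(t)(x)$ smooth in $(t,x)\in(-\varepsilon,\varepsilon)\times[0,1]$) with $(g(0),\rho(0))=(g_*,\rho_*)$, one has $\Phi(g(t),\rho(t))\le \Phi(g_*,\rho_*)+o(t)$ or $\Phi(g(t),\rho(t))\ge \Phi(g_*,\rho_*)+o(t)$ as $t\to0$. A necklace graph is a graph whose vertices can be listed as $v_1,\dots,v_n$ such that $|E|=2(n-1)$ and exactly two edges join $v_j$ and $v_{j+1}$ for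 each $1\le j<n$. A metric is symmetric if parallel edges have equal length. **Corollary (necklace graphs).** Let $G$ be a necklace graph with $|V|\ge 3$. Then: 1. The functional $\overline{\lambda_1}(g,\rho)$ has no minimiser in $\mathcal A_+$. 2. If $\alpha\in\mathbb R\setminus\{1/2,1\}$, then there is no extremal pair in $\mathcal A_+$ for $\overline{\lambda_1}^{(\alpha)}$; consequently $\overline{\lambda_1}^{(\alpha)}$ has neither a maximiser nor a minimiser in $\mathcal A_+$. 3. If $g$ is a symmetric metric on $G$, then for no $m$ and no $R>0$ is there an isometric minimal immersion of $(G,g)$ into the sphere of radius $R$ centred at the origin of $\mathbb R^m$, all of whose coordinate functions lie in the $\lambda_1(g,1)$-eigenspace (of the problem above with $\rho\equiv1$). Here an isometric minimal immersion is a continuous map that sends every edge, parametrised by arc length, to a unit-speed geodesic of the sphere, such that at every vertex the outward unit tangent vectors of the edges sum to zero. -/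

import Mathlib

open scoped ContDiff Topology

noncomputable section

/-- A (multi)graph with vertex set `V` and edge set `E`; loops and parallel edges are allowed.
The choice of the endpoints `src e`, `tgt e` fixes a reference parametrisation of `e` by `[0, 1]`,
with `0` at `src e` and `1` at `tgt e`. -/
structure MultiGraph (V E : Type*) where
  src : E → V
  tgt : E → V

/-- The points of the metric graph in which every edge is a copy of `[0, 1]`:
vertices and edge points, before gluing the ends of the edges to the vertices. -/
inductive MultiGraph.Glue {V E : Type*} (G : MultiGraph V E) :
    V ⊕ (E × unitInterval) → V ⊕ (E × unitInterval) → Prop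
  | src (e : E) : G.Glue (Sum.inr (e, 0)) (Sum.inl (G.src e))
  | tgt (e : E) : G.Glue (Sum.inr (e, 1)) (Sum.inl (G.tgt e))

namespace MultiGraph

variable {V E : Type*}

/-- The metric graph `G₀` all of whose edges have length one, as a set of points. -/
def Point (G : MultiGraph V E) : Type _ := Quot G.Glue

/-- The vertex `v`, as a point of `G₀`. -/
def vertex (G : MultiGraph V E) (v : V) : G.Point := Quot.mk _ (Sum.inl v)

/-- The point of the edge `e` with parameter `x ∈ [0, 1]`. -/
def edgePoint (G : MultiGraph V E) (e : E) (x : unitInterval) : G.Point :=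
  Quot.mk _ (Sum.inr (e, x))

/-- The restriction `f_e` of a function `f` on `G₀` to the edge `e`, as a function of `x ∈ [0, 1]`
(and extended by constants outside `[0, 1]`). -/
def onEdge (G : MultiGraph V E) {X : Type*} (f : G.Point → X) (e : E) : ℝ → X :=
  Set.IccExtend zero_le_one fun x => f (G.edgePoint e x)

/-- The edge `e` has endpoints `a` and `b` (in either order). -/
def Joins (G : MultiGraph V E) (e : E) (a b : V) : Prop :=
  (G.src e = a ∧ G.tgt e = b) ∨ (G.src e = b ∧ G.tgt e = a)

/-- Necklace graphs: the vertices can be listed as `v₀, …, vₙ`, there are `2 n` edges, and exactly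
two edges join `vⱼ` and `vⱼ₊₁` for every `j < n`. -/
def IsNecklace (G : MultiGraph V E) : Prop :=
  ∃ (n : ℕ) (v : Fin (n + 1) ≃ V), Nat.card E = 2 * n ∧
    ∀ j : Fin n, {e : E | G.Joins e (v j.castSucc) (v j.succ)}.ncard = 2

/-- A metric is symmetric if parallel edges have the same length. -/
def IsSymmetricMetric (G : MultiGraph V E) (g : E → ℝ) : Prop :=
  ∀ (a b : V) (e e' : E), G.Joins e a b → G.Joins e' a b → g e = g e'

end MultiGraph

/-- The space of pairs of a metric and a density. The metric is a positive vector
`g = (g_e)`, where `ℓ_e = √(g_e)` is the length of the edge `e`. The density is positive and smooth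
on each closed edge, parametrised by `[0, 1]` (no condition relates its values on different edges;
its values outside `[0, 1]` are irrelevant). -/
structure MetricDensityPair (E : Type*) where
  g : E → ℝ
  ρ : E → ℝ → ℝ
  g_pos : ∀ e, 0 < g e
  ρ_smooth : ∀ e, ContDiffOn ℝ ∞ (ρ e) (Set.Icc 0 1)
  ρ_pos : ∀ e, ∀ x ∈ Set.Icc (0 : ℝ) 1, 0 < ρ e x

namespace MetricDensityPair

variable {E : Type*}

/-- The pair `(g, 1)`. -/
def ofMetric (g : E → ℝ) (hg : ∀ e, 0 < g e) : MetricDensityPair E where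
  g := g
  ρ := fun _ _ => 1
  g_pos := hg
  ρ_smooth := fun _ => contDiffOn_const
  ρ_pos := fun _ _ _ => one_pos

/-- The one-parameter family `γ t = (g(t), ρ(t))` is smooth for `|t| < ε`: each `g_e(t)` is smooth
in `t`, and each `ρ_e(t)(x)` is jointly smooth in `(t, x)` up to the ends of the edge. -/
def IsSmoothFamily (ε : ℝ) (γ : ℝ → MetricDensityPair E) : Prop :=
  ∀ e, ContDiffOn ℝ ∞ (fun t => (γ t).g e) (Set.Ioo (-ε) ε) ∧
    ContDiffOn ℝ ∞ (fun q : ℝ × ℝ => (γ q.1).ρ e q.2) (Set.Ioo (-ε) ε ×ˢ Set.Icc 0 1)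

/-- `p` is extremal for the functional `Φ`: along every smooth one-parameter family through `p`
one has `Φ(γ t) ≤ Φ(p) + o(t)` or `Φ(γ t) ≥ Φ(p) + o(t)` as `t → 0`. -/
def IsExtremal (Φ : MetricDensityPair E → ℝ) (p : MetricDensityPair E) : Prop :=
  ∀ (ε : ℝ) (γ : ℝ → MetricDensityPair E), 0 < ε → IsSmoothFamily ε γ → γ 0 = p →
    (∃ r : ℝ → ℝ, r =o[𝓝 0] (fun t => t) ∧ ∀ᶠ t in 𝓝 0, Φ (γ t) ≤ Φ p + r t) ∨
    (∃ r : ℝ → ℝ, r =o[𝓝 0] (fun t => t) ∧ ∀ᶠ t in 𝓝 0, Φ p + r t ≤ Φ (γ t))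

/-- `p` is a global minimiser of `Φ`. -/
def IsMinimiser (Φ : MetricDensityPair E → ℝ) (p : MetricDensityPair E) : Prop :=
  ∀ q, Φ p ≤ Φ q

/-- `p` is a global maximiser of `Φ`. -/
def IsMaximiser (Φ : MetricDensityPair E → ℝ) (p : MetricDensityPair E) : Prop :=
  ∀ q, Φ q ≤ Φ p

end MetricDensityPair

namespace MultiGraph

variable {V E : Type*}

/-- The Sobolev space `W^{1,2}(G)`: continuous functions on the metric graph whose restriction to
every edge is in `W^{1,2}(0, 1)`, i.e. absolutely continuous with square integrable derivative.
(A function on `G₀` with continuous restrictions to the closed edges is continuous, because the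
values at the vertices agree by construction of `G₀`.) -/
def MemW12 (G : MultiGraph V E) (f : G.Point → ℝ) : Prop :=
  ∀ e, AbsolutelyContinuousOnInterval (G.onEdge f e) 0 1 ∧
    MeasureTheory.MemLp (deriv (G.onEdge f e)) 2
      (MeasureTheory.volume.restrict (Set.Ioo (0 : ℝ) 1))

/-- The Rayleigh quotient `∫ (f')² / √g dx / ∫ f² ρ √g dx` on `G₀`. -/
def rayleigh (G : MultiGraph V E) [Fintype E] (p : MetricDensityPair E) (f : G.Point → ℝ) : ℝ :=
  (∑ e, ∫ x in (0 : ℝ)..1, (deriv (G.onEdge f e) x) ^ 2 / √(p.g e)) /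
    (∑ e, ∫ x in (0 : ℝ)..1, (G.onEdge f e x) ^ 2 * p.ρ e x * √(p.g e))

/-- The eigenvalue `λ_k(g, ρ)`, `k = 0, 1, 2, …`, by the min-max principle: the least `c` such that
some `(k+1)`-dimensional `S ⊆ W^{1,2}(G)` has all its Rayleigh quotients bounded by `c`. -/
def eigenvalue (G : MultiGraph V E) [Fintype E] (k : ℕ) (p : MetricDensityPair E) : ℝ :=
  sInf {c : ℝ | ∃ S : Submodule ℝ (G.Point → ℝ), (∀ f ∈ S, G.MemW12 f) ∧
    Module.finrank ℝ S = k + 1 ∧ ∀ f ∈ S, f ≠ 0 → G.rayleigh p f ≤ c}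

/-- The natural normalisation `λ_k(g, ρ) · L(g) · ∫_{(G, g)} ρ`. -/
def normalisedEigenvalue (G : MultiGraph V E) [Fintype E] (k : ℕ) (p : MetricDensityPair E) : ℝ :=
  G.eigenvalue k p * (∑ e, √(p.g e)) * (∑ e, √(p.g e) * ∫ x in (0 : ℝ)..1, p.ρ e x)

/-- The `α`-normalisation `λ_k(g, ρ) · (∑ g_e^{1-α}) · (∑ g_e^α ∫ ρ_e)`. -/
def alphaNormalisedEigenvalue (G : MultiGraph V E) [Fintype E] (α : ℝ) (k : ℕ)
    (p : MetricDensityPair E) : ℝ :=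
  G.eigenvalue k p * (∑ e, p.g e ^ (1 - α)) * (∑ e, p.g e ^ α * ∫ x in (0 : ℝ)..1, p.ρ e x)

open Classical in
/-- The sum over the edge ends at `v` of the arc-length derivatives of `f` pointing out of `v` into
the edge (a loop at `v` contributes both of its ends). -/
def outwardSum (G : MultiGraph V E) [Fintype E] {X : Type*} [NormedAddCommGroup X]
    [NormedSpace ℝ X] (g : E → ℝ) (f : G.Point → X) (v : V) : X :=
  (∑ e with G.src e = v, (√(g e))⁻¹ • derivWithin (G.onEdge f e) (Set.Icc 0 1) 0) -
    ∑ e with G.tgt e = v, (√(g e))⁻¹ • derivWithin (G.onEdge f e) (Set.Icc 0 1) 1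

/-- `f` belongs to the eigenspace of `μ`: `-f'' / g_e = μ ρ f` on every edge, with continuity and
the condition that the outward derivatives sum to zero at every vertex. -/
def MemEigenspace (G : MultiGraph V E) [Fintype E] (p : MetricDensityPair E) (μ : ℝ)
    (f : G.Point → ℝ) : Prop :=
  (∀ e, ContDiffOn ℝ 2 (G.onEdge f e) (Set.Icc 0 1) ∧
    ∀ x ∈ Set.Icc (0 : ℝ) 1, -(iteratedDerivWithin 2 (G.onEdge f e) (Set.Icc 0 1) x) / p.g e =
      μ * p.ρ e x * G.onEdge f e x) ∧
  ∀ v, G.outwardSum p.g f v = 0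

/-- `F` is an isometric minimal immersion of `(G, g)` into the sphere of radius `R` about the origin
of `ℝᵐ`, i.e. its image is a geodesic net parametrised by arc length: every edge has unit speed and
is mapped to a geodesic (an arc of a great circle, `γ'' = -R⁻² γ` in arc length), and at every
vertex the outward unit tangent vectors sum to zero. -/
structure IsIsometricMinimalImmersion (G : MultiGraph V E) [Fintype E] {m : ℕ} (g : E → ℝ)
    (R : ℝ) (F : G.Point → EuclideanSpace ℝ (Fin m)) : Prop where
  mem_sphere : ∀ q, F q ∈ Metric.sphere (0 : EuclideanSpace ℝ (Fin m)) R
  contDiffOn : ∀ e, ContDiffOn ℝ 2 (G.onEdge F e) (Set.Icc 0 1)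
  isometric : ∀ e, ∀ x ∈ Set.Icc (0 : ℝ) 1,
    ‖derivWithin (G.onEdge F e) (Set.Icc 0 1) x‖ = √(g e)
  geodesic : ∀ e, ∀ x ∈ Set.Icc (0 : ℝ) 1,
    (g e)⁻¹ • iteratedDerivWithin 2 (G.onEdge F e) (Set.Icc 0 1) x =
      -((R ^ 2)⁻¹ • G.onEdge F e x)
  balanced : ∀ v, G.outwardSum g F v = 0

end MultiGraph

end

/-! Calculus of variations reduces the first two claims to Euler–Lagrange equations. For the natural
normalisation these are contradictory on any connected graph. For the others, and for the third
claim, they describe a balanced net of oscillations, which the two end beads of a necklace forbid.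

The first eigenvalue is the best constant in the Poincaré inequality for functions of mean zero
(`eigenvalue_one_mul_mass_le`, `le_eigenvalue_one`), and compactness provides a finite-dimensional
space of minimisers. Let h and σ be the logarithmic velocities of the metric and of the weight √g·ρ.
The first-order change of the normalised eigenvalue is governed by a quadratic form `variation` on
the eigenspace, linear in (h, σ). Using an eigenfunction as trial function gives a differentiable
upper bound touching the functional at t = 0 (`exists_upper_bound`), so at a minimiser the form
vanishes on every eigenfunction. At an extremal pair no such form is positive definite
(`not_eventually_le_of_variation_pos` and the upper bound), and separation of convex sets
(`exists_pos_or_exists_sum_eq_zero`) turns this into a finite family of eigenfunctions with zero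
total variation (`exists_family_of_isExtremal`).

Varying the density makes ∑ fᵢ² constant on every edge (`sum_val_sq_eq`). For one function f this
gives f f′ = 0, although f² and f′² are both positive: there is no minimiser of the natural
normalisation. For α ≠ 1/2, continuity at the vertices makes all lengths equal; the weights are
constant on edges (`weight_eq_const`), and varying the metric with α ≠ 1 makes them equal on all
edges (`exists_const_of_isExtremal`). The map (fᵢ) then solves F″ = −θ²F with nowhere vanishing
velocity and Kirchhoff balance. An isometric minimal immersion by first eigenfunctions for a
symmetric metric provides the same data, with θ possibly depending on the edge but equal on parallel
edges.

Such data cannot exist (`false_of_balanced_net`). At the outer vertex of an end bead two parallel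
edges have the same end values; if sin θ ≠ 0 they leave with equal velocity, and balance makes it
zero. Hence θ ≥ π there, so θ² > 3. But 3 is the squared frequency corresponding to the Rayleigh
quotient of a hat function, and a mean-zero combination of the hats at the two outer vertices
violates the Poincaré inequality. -/

noncomputable section

set_option linter.unusedSectionVars false

open MeasureTheory Set Filter

/-! ### The Sobolev space of a metric graph, with its Dirichlet and mass forms -/

namespace MultiGraph

/-- Square integrable functions on an edge. -/
abbrev EdgeL2 : Type := Lp ℝ 2 (volume.restrict (Ioc (0 : ℝ) 1))

/-- The indicator function of `(0, x)`, representing `u ↦ ∫₀ˣ u`. -/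
def primVec (x : ℝ) : EdgeL2 :=
  indicatorConstLp 2 (measurableSet_Ioc : MeasurableSet (Ioc 0 x)) (measure_ne_top _ _) 1

lemma inner_primVec (u : EdgeL2) {x : ℝ} (hx : x ∈ Icc (0 : ℝ) 1) :
    inner ℝ (primVec x) u = ∫ y in (0 : ℝ)..x, u y := by
  rw [primVec, L2.inner_indicatorConstLp_one, intervalIntegral.integral_of_le hx.1,
    Measure.restrict_restrict measurableSet_Ioc, inter_eq_left.2 (Ioc_subset_Ioc_right hx.2)]

lemma inner_primVec_primVec (x y : ℝ) :
    inner ℝ (primVec x) (primVec y) = max (min (min x y) 1) 0 := by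
  rw [primVec, primVec, L2.inner_indicatorConstLp_indicatorConstLp]
  simp only [Ioc_inter_Ioc, measureReal_def, measurableSet_Ioc,
    Measure.restrict_apply, Real.volume_Ioc, sub_zero, max_self, RCLike.inner_apply, map_one,
    mul_one, smul_eq_mul, ENNReal.toReal_ofReal']

/-- The indicators differ on the interval between the clamped endpoints, whose length is the squared
L² distance. This is the source of the 1/2-Hölder continuity of Sobolev functions. -/
lemma norm_primVec_sub_sq (x y : ℝ) :
    ‖primVec x - primVec y‖ ^ 2 = |max (min x 1) 0 - max (min y 1) 0| := by
  rw [@norm_sub_sq ℝ, ← real_inner_self_eq_norm_sq, ← real_inner_self_eq_norm_sq]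
  simp only [inner_primVec_primVec, RCLike.re_to_real, min_self]
  rcases le_total x y with h | h
  · rw [min_eq_left h, abs_of_nonpos (sub_nonpos.2 (by gcongr))]; ring
  · rw [min_eq_right h, abs_of_nonneg (sub_nonneg.2 (by gcongr))]; ring

lemma norm_primVec_sub_le (x y : ℝ) : ‖primVec x - primVec y‖ ≤ √|x - y| := by
  apply Real.le_sqrt_of_sq_le
  rw [norm_primVec_sub_sq]
  exact (abs_max_sub_max_le_abs _ _ _).trans (abs_min_sub_min_le_max _ _ _ _ |>.trans (by simp))

/-- Makes `val` constant beyond the ends of the edge, in agreement with the extension used by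
`onEdge`. -/
lemma primVec_eq_of_clamp {x y : ℝ} (h : max (min x 1) 0 = max (min y 1) 0) :
    primVec x = primVec y := by
  have := norm_primVec_sub_sq x y
  rw [h, sub_self, abs_zero] at this
  exact sub_eq_zero.1 (norm_eq_zero.1 (pow_eq_zero_iff two_ne_zero |>.1 this))

lemma primVec_zero : primVec 0 = 0 := by
  have := inner_primVec_primVec 0 0
  simpa using this

lemma norm_primVec_le (x : ℝ) : ‖primVec x‖ ≤ 1 := by
  have := inner_primVec_primVec x x
  rw [real_inner_self_eq_norm_sq] at this
  nlinarith [norm_nonneg (primVec x), max_le (min_le_right (min x x) 1) zero_le_one]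

lemma continuous_primVec : Continuous primVec := by
  rw [continuous_iff_continuousAt]
  intro x
  rw [ContinuousAt, tendsto_iff_norm_sub_tendsto_zero]
  refine squeeze_zero (fun _ => norm_nonneg _) (fun y => norm_primVec_sub_le y x) ?_
  have : Continuous fun y : ℝ => √|y - x| := by fun_prop
  simpa using this.tendsto x

variable {V E : Type*} [Fintype V] [Fintype E]

/-- The Sobolev space of a graph: a function is given by its vertex values and its derivatives. -/
def sobSubmodule (G : MultiGraph V E) : Submodule ℝ ((V → ℝ) × (E → EdgeL2)) where
  carrier := {z | ∀ e, z.1 (G.tgt e) - z.1 (G.src e) = inner ℝ (primVec 1) (z.2 e)}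
  zero_mem' := by simp
  add_mem' := by
    intro z z' h h' e
    simp only [Prod.fst_add, Pi.add_apply, Prod.snd_add, inner_add_right, ← h e, ← h' e]
    ring
  smul_mem' := by
    intro a z h e
    simp only [Prod.smul_fst, Pi.smul_apply, smul_eq_mul, Prod.smul_snd, inner_smul_right, ← h e]
    ring

variable (G : MultiGraph V E)

lemma isClosed_sobSubmodule : IsClosed (G.sobSubmodule : Set ((V → ℝ) × (E → EdgeL2))) := by
  have : (G.sobSubmodule : Set ((V → ℝ) × (E → EdgeL2))) =
      ⋂ e, {z | z.1 (G.tgt e) - z.1 (G.src e) = inner ℝ (primVec 1) (z.2 e)} := by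
    ext z; simp [sobSubmodule]
  rw [this]
  refine isClosed_iInter fun e => isClosed_eq (by fun_prop) (by fun_prop)

/-- The Sobolev space `W^{1,2}(G)` as a complete normed space. -/
def Sob : Type _ := G.sobSubmodule

instance : NormedAddCommGroup G.Sob := inferInstanceAs (NormedAddCommGroup G.sobSubmodule)

instance : NormedSpace ℝ G.Sob := inferInstanceAs (NormedSpace ℝ G.sobSubmodule)

instance : CompleteSpace G.Sob := G.isClosed_sobSubmodule.completeSpace_coe

variable {G}

/-- The value at the point of parameter `x` of the edge `e`. -/
def Sob.val (z : G.Sob) (e : E) (x : ℝ) : ℝ := z.1.1 (G.src e) + inner ℝ (primVec x) (z.1.2 e)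

namespace Sob

@[simp] lemma coe_zero : (0 : G.Sob).1 = 0 := rfl
@[simp] lemma coe_add (z z' : G.Sob) : (z + z').1 = z.1 + z'.1 := rfl
@[simp] lemma coe_sub (z z' : G.Sob) : (z - z').1 = z.1 - z'.1 := rfl
@[simp] lemma coe_smul (a : ℝ) (z : G.Sob) : (a • z).1 = a • z.1 := rfl

lemma val_zero (z : G.Sob) (e : E) : val z e 0 = z.1.1 (G.src e) := by
  simp [val, primVec_zero]

lemma val_one (z : G.Sob) (e : E) : val z e 1 = z.1.1 (G.tgt e) := by
  rw [val, ← z.2 e]; ring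

lemma val_add (z z' : G.Sob) (e : E) (x : ℝ) : val (z + z') e x = val z e x + val z' e x := by
  simp [val, inner_add_right]; ring

lemma val_smul (a : ℝ) (z : G.Sob) (e : E) (x : ℝ) : val (a • z) e x = a * val z e x := by
  simp [val, inner_smul_right]; ring

lemma val_sub (z z' : G.Sob) (e : E) (x : ℝ) : val (z - z') e x = val z e x - val z' e x := by
  simp [val, inner_sub_right]; ring

@[fun_prop]
lemma continuous_val (z : G.Sob) (e : E) : Continuous (val z e) :=
  continuous_const.add (continuous_primVec.inner continuous_const)

lemma val_eq_integral (z : G.Sob) (e : E) {x : ℝ} (hx : x ∈ Icc (0 : ℝ) 1) :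
    val z e x = z.1.1 (G.src e) + ∫ y in (0 : ℝ)..x, z.1.2 e y := by
  rw [val, inner_primVec _ hx]

lemma abs_val_le (z : G.Sob) (e : E) (x : ℝ) : |val z e x| ≤ 2 * ‖z‖ := by
  have h1 : |z.1.1 (G.src e)| ≤ ‖z‖ :=
    (norm_le_pi_norm z.1.1 (G.src e)).trans (norm_fst_le z.1)
  have h2 : ‖z.1.2 e‖ ≤ ‖z‖ := (norm_le_pi_norm z.1.2 e).trans (norm_snd_le z.1)
  have h3 := abs_real_inner_le_norm (primVec x) (z.1.2 e)
  have h4 := norm_primVec_le x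
  calc |val z e x| ≤ |z.1.1 (G.src e)| + |inner ℝ (primVec x) (z.1.2 e)| := abs_add_le _ _
    _ ≤ ‖z‖ + 1 * ‖z‖ := by gcongr; exact h3.trans (by gcongr)
    _ = _ := by ring

/-- Cauchy–Schwarz. The modulus of continuity depends on z only through its norm, so bounded sets
are equicontinuous. -/
lemma abs_val_sub_val_le (z : G.Sob) (e : E) (x y : ℝ) :
    |val z e x - val z e y| ≤ √|x - y| * ‖z‖ := by
  have h2 : ‖z.1.2 e‖ ≤ ‖z‖ := (norm_le_pi_norm z.1.2 e).trans (norm_snd_le z.1)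
  have : val z e x - val z e y = inner ℝ (primVec x - primVec y) (z.1.2 e) := by
    rw [inner_sub_left]; simp [val]
  rw [this]
  exact (abs_real_inner_le_norm _ _).trans
    (mul_le_mul (norm_primVec_sub_le x y) h2 (norm_nonneg _) (by positivity))

/-- The constant function one. -/
instance : One G.Sob := ⟨⟨(fun _ => 1, 0), fun e => by simp⟩⟩

lemma val_one_eq (e : E) (x : ℝ) : val (1 : G.Sob) e x = 1 := by
  change (1 : ℝ) + inner ℝ (primVec x) ((0 : E → EdgeL2) e) = 1
  simp

lemma snd_one : (1 : G.Sob).1.2 = 0 := rfl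
lemma fst_one : (1 : G.Sob).1.1 = fun _ => 1 := rfl

variable (G) in
/-- The Dirichlet form with conductances `c`. -/
def energy (c : E → ℝ) : LinearMap.BilinForm ℝ G.Sob :=
  LinearMap.mk₂ ℝ (fun z z' => ∑ e, c e * inner ℝ (z.1.2 e) (z'.1.2 e))
    (fun a b d => by simp [inner_add_left, mul_add, Finset.sum_add_distrib])
    (fun a b d => by simp [inner_smul_left, Finset.mul_sum]; congr! 1; ring)
    (fun a b d => by simp [inner_add_right, mul_add, Finset.sum_add_distrib])
    (fun a b d => by simp [inner_smul_right, Finset.mul_sum]; congr! 1; ring)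

lemma energy_apply (c : E → ℝ) (z z' : G.Sob) :
    energy G c z z' = ∑ e, c e * inner ℝ (z.1.2 e) (z'.1.2 e) := rfl

lemma intervalIntegrable_mul_val_mul_val (w : C(ℝ, ℝ)) (z z' : G.Sob) (e : E) (a b : ℝ) :
    IntervalIntegrable (fun x => w x * val z e x * val z' e x) volume a b :=
  Continuous.intervalIntegrable (by fun_prop) _ _

variable (G) in
/-- The `L²` form with weight `w`. -/
def mass (w : E → C(ℝ, ℝ)) : LinearMap.BilinForm ℝ G.Sob :=
  LinearMap.mk₂ ℝ (fun z z' => ∑ e, ∫ x in (0 : ℝ)..1, w e x * val z e x * val z' e x)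
    (fun a b d => by
      rw [← Finset.sum_add_distrib]
      refine Finset.sum_congr rfl fun e _ => ?_
      rw [← intervalIntegral.integral_add (intervalIntegrable_mul_val_mul_val ..)
        (intervalIntegrable_mul_val_mul_val ..)]
      congr! 2 with x
      rw [val_add]; ring)
    (fun r a b => by
      rw [smul_eq_mul, Finset.mul_sum]
      refine Finset.sum_congr rfl fun e _ => ?_
      rw [← intervalIntegral.integral_const_mul]
      congr! 2 with x
      rw [val_smul]; ring)
    (fun a b d => by
      rw [← Finset.sum_add_distrib]
      refine Finset.sum_congr rfl fun e _ => ?_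
      rw [← intervalIntegral.integral_add (intervalIntegrable_mul_val_mul_val ..)
        (intervalIntegrable_mul_val_mul_val ..)]
      congr! 2 with x
      rw [val_add]; ring)
    (fun r a b => by
      rw [smul_eq_mul, Finset.mul_sum]
      refine Finset.sum_congr rfl fun e _ => ?_
      rw [← intervalIntegral.integral_const_mul]
      congr! 2 with x
      rw [val_smul]; ring)

lemma mass_apply (w : E → C(ℝ, ℝ)) (z z' : G.Sob) :
    mass G w z z' = ∑ e, ∫ x in (0 : ℝ)..1, w e x * val z e x * val z' e x := rfl

lemma energy_comm (c : E → ℝ) (z z' : G.Sob) : energy G c z z' = energy G c z' z := by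
  simp only [energy_apply, real_inner_comm]

lemma mass_comm (w : E → C(ℝ, ℝ)) (z z' : G.Sob) : mass G w z z' = mass G w z' z := by
  simp only [mass_apply]
  congr! 3
  ring

lemma energy_one (c : E → ℝ) (z : G.Sob) : energy G c z 1 = 0 := by
  simp [energy_apply, snd_one]

lemma energy_nonneg {c : E → ℝ} (hc : ∀ e, 0 ≤ c e) (z : G.Sob) : 0 ≤ energy G c z z :=
  Finset.sum_nonneg fun e _ => mul_nonneg (hc e) real_inner_self_nonneg

lemma mass_nonneg {w : E → C(ℝ, ℝ)} (hw : ∀ e, ∀ x ∈ Icc (0 : ℝ) 1, 0 ≤ w e x) (z : G.Sob) :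
    0 ≤ mass G w z z :=
  Finset.sum_nonneg fun e _ => intervalIntegral.integral_nonneg zero_le_one fun x hx => by
    rw [mul_assoc]; exact mul_nonneg (hw e x hx) (mul_self_nonneg _)

lemma mass_mono {w w' : E → C(ℝ, ℝ)} (h : ∀ e, ∀ x ∈ Icc (0 : ℝ) 1, w e x ≤ w' e x) (z : G.Sob) :
    mass G w z z ≤ mass G w' z z :=
  Finset.sum_le_sum fun e _ => intervalIntegral.integral_mono_on zero_le_one
    (intervalIntegrable_mul_val_mul_val ..) (intervalIntegrable_mul_val_mul_val ..) fun x hx => by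
    rw [mul_assoc, mul_assoc]
    exact mul_le_mul_of_nonneg_right (h e x hx) (mul_self_nonneg _)

lemma mass_congr {w w' : E → C(ℝ, ℝ)} (h : ∀ e, ∀ x ∈ Icc (0 : ℝ) 1, w e x = w' e x) :
    mass G w = mass G w' := by
  refine LinearMap.ext₂ fun z z' => Finset.sum_congr rfl fun e _ =>
    intervalIntegral.integral_congr fun x hx => ?_
  rw [uIcc_of_le zero_le_one] at hx
  simp only [h e x hx]

lemma exists_abs_le (w : E → C(ℝ, ℝ)) : ∃ C : ℝ, 0 < C ∧ ∀ e, ∀ x ∈ Icc (0 : ℝ) 1, |w e x| ≤ C := by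
  have (e : E) : ∃ C, ∀ x ∈ Icc (0 : ℝ) 1, ‖w e x‖ ≤ C :=
    isCompact_Icc.exists_bound_of_continuousOn (w e).continuous.continuousOn
  choose C hC using this
  refine ⟨∑ e, |C e| + 1, by positivity, fun e x hx => (hC e x hx).trans ((le_abs_self _).trans ?_)⟩
  exact (Finset.single_le_sum (fun e _ => abs_nonneg (C e)) (Finset.mem_univ e)).trans (by simp)

lemma exists_pos_le {w : E → C(ℝ, ℝ)} (hw : ∀ e, ∀ x ∈ Icc (0 : ℝ) 1, 0 < w e x) :
    ∃ b : ℝ, 0 < b ∧ ∀ e, ∀ x ∈ Icc (0 : ℝ) 1, b ≤ w e x := by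
  have (e : E) : ∃ y ∈ Icc (0 : ℝ) 1, IsMinOn (w e) (Icc 0 1) y :=
    isCompact_Icc.exists_isMinOn (nonempty_Icc.2 zero_le_one) (w e).continuous.continuousOn
  choose y hy hmin using this
  rcases isEmpty_or_nonempty E with h | h
  · exact ⟨1, one_pos, fun e => (IsEmpty.false e).elim⟩
  · obtain ⟨e₀, he₀⟩ := Finite.exists_min fun e => w e (y e)
    exact ⟨_, hw e₀ _ (hy e₀), fun e x hx => (he₀ e).trans (hmin e hx)⟩

lemma abs_mass_le (w : E → C(ℝ, ℝ)) : ∃ C : ℝ, ∀ z z' : G.Sob,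
    |mass G w z z'| ≤ C * ‖z‖ * ‖z'‖ := by
  obtain ⟨C, hC0, hC⟩ := exists_abs_le w
  refine ⟨∑ _e : E, C * 4, fun z z' => ?_⟩
  rw [mass_apply]
  refine (Finset.abs_sum_le_sum_abs _ _).trans ?_
  rw [Finset.sum_mul, Finset.sum_mul]
  refine Finset.sum_le_sum fun e _ => ?_
  have := intervalIntegral.norm_integral_le_of_norm_le_const (a := 0) (b := 1)
    (C := C * 4 * ‖z‖ * ‖z'‖) (f := fun x => w e x * val z e x * val z' e x) (fun x hx => ?_)
  · simpa using this
  · rw [uIoc_of_le zero_le_one] at hx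
    rw [norm_mul, norm_mul]
    have h1 := hC e x ⟨hx.1.le, hx.2⟩
    have h2 := abs_val_le z e x
    have h3 := abs_val_le z' e x
    simp only [Real.norm_eq_abs]
    calc |w e x| * |val z e x| * |val z' e x| ≤ C * (2 * ‖z‖) * (2 * ‖z'‖) := by gcongr
      _ = _ := by ring

lemma abs_energy_le (c : E → ℝ) : ∃ C : ℝ, ∀ z z' : G.Sob,
    |energy G c z z'| ≤ C * ‖z‖ * ‖z'‖ := by
  refine ⟨∑ e : E, |c e|, fun z z' => ?_⟩
  rw [energy_apply]
  refine (Finset.abs_sum_le_sum_abs _ _).trans ?_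
  rw [Finset.sum_mul, Finset.sum_mul]
  refine Finset.sum_le_sum fun e _ => ?_
  rw [abs_mul, mul_assoc]
  gcongr
  refine (abs_real_inner_le_norm _ _).trans ?_
  have h (z : G.Sob) : ‖z.1.2 e‖ ≤ ‖z‖ := (norm_le_pi_norm z.1.2 e).trans (norm_snd_le z.1)
  gcongr <;> apply h

lemma continuous_of_bound (B : LinearMap.BilinForm ℝ G.Sob)
    (hB : ∃ C : ℝ, ∀ z z' : G.Sob, |B z z'| ≤ C * ‖z‖ * ‖z'‖) :
    Continuous fun q : G.Sob × G.Sob => B q.1 q.2 := by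
  obtain ⟨C, hC⟩ := hB
  have : (fun q : G.Sob × G.Sob => B q.1 q.2) = fun q => (B.mkContinuous₂ C hC) q.1 q.2 := by
    ext; simp
  rw [this]
  fun_prop

lemma continuous_mass (w : E → C(ℝ, ℝ)) :
    Continuous fun q : G.Sob × G.Sob => mass G w q.1 q.2 := continuous_of_bound _ (abs_mass_le w)

lemma continuous_energy (c : E → ℝ) :
    Continuous fun q : G.Sob × G.Sob => energy G c q.1 q.2 := continuous_of_bound _ (abs_energy_le c)

end Sob

end MultiGraph

/-! ### Compactness and coercivity -/

namespace MultiGraph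

variable {V E : Type*} [Fintype V] [Fintype E] {G : MultiGraph V E}

namespace Sob

/-- A bounded sequence has a subsequence which is uniformly Cauchy on the graph. -/
lemma exists_subseq_uniform_cauchy (z : ℕ → G.Sob) (C : ℝ) (hz : ∀ n, ‖z n‖ ≤ C) :
    ∃ φ : ℕ → ℕ, StrictMono φ ∧ ∀ ε > 0, ∃ N, ∀ n ≥ N, ∀ m ≥ N, ∀ e, ∀ x ∈ Icc (0 : ℝ) 1,
      |val (z (φ n)) e x - val (z (φ m)) e x| ≤ ε := by
  -- All edges are bundled into one vector-valued function on the unit interval, so that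
  -- Arzelà–Ascoli is applied only once.
  let F : ℕ → BoundedContinuousFunction unitInterval (E → ℝ) := fun n =>
    BoundedContinuousFunction.mkOfCompact
      ⟨fun x e => val (z n) e x, continuous_pi fun e => by fun_prop⟩
  have hF (n : ℕ) (x : unitInterval) (e : E) : F n x e = val (z n) e x := rfl
  have hC : 0 ≤ C := (norm_nonneg _).trans (hz 0)
  have hcomp : IsCompact (closure (range F)) := by
    refine BoundedContinuousFunction.arzela_ascoli (Metric.closedBall 0 (2 * C))
      (isCompact_closedBall _ _) _ ?_ ?_
    · rintro _ x ⟨n, rfl⟩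
      rw [mem_closedBall_zero_iff, pi_norm_le_iff_of_nonneg (by positivity)]
      intro e
      exact (abs_val_le _ _ _).trans (by gcongr; exact hz n)
    · intro x₀
      rw [Metric.equicontinuousAt_iff]
      intro ε hε
      have hlim : Tendsto (fun x : unitInterval => √|(x : ℝ) - x₀| * C) (𝓝 x₀) (𝓝 0) := by
        have : Continuous fun x : unitInterval => √|(x : ℝ) - x₀| * C := by fun_prop
        simpa using this.tendsto x₀
      obtain ⟨δ, hδ, h⟩ := Metric.eventually_nhds_iff.1 (hlim.eventually_lt_const hε)
      refine ⟨δ, hδ, fun x hx i => ?_⟩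
      obtain ⟨f, n, rfl⟩ := i
      refine lt_of_le_of_lt ?_ (h hx)
      refine (dist_pi_le_iff (by positivity)).2 fun e => ?_
      rw [dist_comm]
      exact (abs_val_sub_val_le (z n) e x x₀).trans
        (mul_le_mul_of_nonneg_left (hz n) (Real.sqrt_nonneg _))
  obtain ⟨f, -, φ, hφ, hlim⟩ := hcomp.tendsto_subseq fun n => subset_closure (mem_range_self n)
  refine ⟨φ, hφ, fun ε hε => ?_⟩
  obtain ⟨N, hN⟩ := Metric.cauchySeq_iff.1 hlim.cauchySeq ε hε
  refine ⟨N, fun n hn m hm e x hx => ?_⟩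
  have h1 := BoundedContinuousFunction.dist_coe_le_dist (f := F (φ n)) (g := F (φ m)) ⟨x, hx⟩
  have h2 := dist_le_pi_dist (F (φ n) ⟨x, hx⟩) (F (φ m) ⟨x, hx⟩) e
  exact (h2.trans h1).trans (hN n hn m hm).le

lemma abs_mass_self_le {w : E → C(ℝ, ℝ)} {C ε : ℝ} (hC : ∀ e, ∀ x ∈ Icc (0 : ℝ) 1, |w e x| ≤ C)
    (z : G.Sob) (hz : ∀ e, ∀ x ∈ Icc (0 : ℝ) 1, |val z e x| ≤ ε) :
    |mass G w z z| ≤ Fintype.card E * (C * ε ^ 2) := by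
  rw [mass_apply]
  refine (Finset.abs_sum_le_sum_abs _ _).trans ?_
  refine (Finset.sum_le_card_nsmul _ _ (C * ε ^ 2) fun e _ => ?_).trans (by simp)
  have := intervalIntegral.norm_integral_le_of_norm_le_const (a := 0) (b := 1)
    (C := C * ε ^ 2) (f := fun x => w e x * val z e x * val z e x) (fun x hx => ?_)
  · simpa using this
  · rw [uIoc_of_le zero_le_one] at hx
    have hx' : x ∈ Icc (0 : ℝ) 1 := ⟨hx.1.le, hx.2⟩
    rw [mul_assoc, norm_mul, norm_mul]
    have h1 := hC e x hx'
    have h2 := hz e x hx'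
    simp only [Real.norm_eq_abs]
    have h3 := abs_nonneg (val z e x)
    have h4 : 0 ≤ C := (abs_nonneg _).trans h1
    have h5 : 0 ≤ ε := h3.trans h2
    calc |w e x| * (|val z e x| * |val z e x|) ≤ C * (ε * ε) := by gcongr
      _ = _ := by ring

lemma norm_le_of_energy {c : E → ℝ} (hc : ∀ e, 0 < c e) :
    ∃ K : ℝ, 0 < K ∧ ∀ z : G.Sob, ∀ e, ‖z.1.2 e‖ ^ 2 ≤ K * energy G c z z := by
  refine ⟨∑ e, (c e)⁻¹ + 1, ?_, fun z e => ?_⟩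
  · have := Finset.sum_nonneg fun e (_ : e ∈ Finset.univ) => (inv_pos.2 (hc e)).le
    linarith
  have h1 : c e * ‖z.1.2 e‖ ^ 2 ≤ energy G c z z := by
    rw [energy_apply, ← real_inner_self_eq_norm_sq]
    exact Finset.single_le_sum (f := fun e => c e * inner ℝ (z.1.2 e) (z.1.2 e))
      (fun e _ => mul_nonneg (hc e).le real_inner_self_nonneg) (Finset.mem_univ e)
  have h2 : (c e)⁻¹ ≤ ∑ e, (c e)⁻¹ + 1 :=
    (Finset.single_le_sum (f := fun e => (c e)⁻¹) (fun e _ => (inv_pos.2 (hc e)).le)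
      (Finset.mem_univ e)).trans (by simp)
  have h3 : 0 ≤ energy G c z z := energy_nonneg (fun e => (hc e).le) z
  calc ‖z.1.2 e‖ ^ 2 = (c e)⁻¹ * (c e * ‖z.1.2 e‖ ^ 2) := by
        rw [inv_mul_cancel_left₀ (hc e).ne']
    _ ≤ (c e)⁻¹ * energy G c z z := by gcongr; exact (inv_pos.2 (hc e)).le
    _ ≤ _ := by gcongr

lemma norm_le_of_forall {z : G.Sob} {ε : ℝ} (hε : 0 ≤ ε)
    (hV : ∀ v, ∃ e, G.src e = v ∨ G.tgt e = v)
    (h1 : ∀ e, ∀ x ∈ Icc (0 : ℝ) 1, |val z e x| ≤ ε) (h2 : ∀ e, ‖z.1.2 e‖ ≤ ε) : ‖z‖ ≤ ε := by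
  change ‖z.1‖ ≤ ε
  rw [Prod.norm_def, max_le_iff, pi_norm_le_iff_of_nonneg hε, pi_norm_le_iff_of_nonneg hε]
  refine ⟨fun v => ?_, h2⟩
  obtain ⟨e, rfl | rfl⟩ := hV v
  · rw [← val_zero]; exact h1 e 0 (by simp)
  · rw [← val_one]; exact h1 e 1 (by simp)

/-- A bounded sequence that is asymptotically minimising for the Rayleigh quotient has a
convergent subsequence. -/
lemma exists_subseq_tendsto {c : E → ℝ} {w : E → C(ℝ, ℝ)} {μ : ℝ} (hc : ∀ e, 0 < c e)
    (hV : ∀ v, ∃ e, G.src e = v ∨ G.tgt e = v)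
    (hμ : ∀ z, mass G w z 1 = 0 → μ * mass G w z z ≤ energy G c z z)
    (z : ℕ → G.Sob) (C : ℝ) (hz : ∀ n, ‖z n‖ ≤ C) (h1 : ∀ n, mass G w (z n) 1 = 0)
    (hD : Tendsto (fun n => energy G c (z n) (z n) - μ * mass G w (z n) (z n)) atTop (𝓝 0)) :
    ∃ φ : ℕ → ℕ, StrictMono φ ∧ ∃ y : G.Sob, Tendsto (z ∘ φ) atTop (𝓝 y) := by
  obtain ⟨φ, hφ, hcauchy⟩ := exists_subseq_uniform_cauchy z C hz
  obtain ⟨K, hK, hKe⟩ := norm_le_of_energy (G := G) hc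
  obtain ⟨B, hB0, hB⟩ := exists_abs_le w
  refine ⟨φ, hφ, cauchySeq_tendsto_of_complete ?_⟩
  rw [Metric.cauchySeq_iff]
  intro ε hε
  -- If the difference is uniformly at most δ, then |μ| times its mass is at most |μ|·|E|·B·δ²; the
  -- parallelogram identity below contributes one more δ².
  set M : ℝ := |μ| * (Fintype.card E * B) + 1 with hM
  have hM0 : 0 < M := by positivity
  obtain ⟨δ, hδ0, hδ⟩ : ∃ δ > 0, δ ≤ ε / 2 ∧ K * (M * δ ^ 2) ≤ (ε / 2) ^ 2 := by
    refine ⟨min (ε / 2) (ε / 2 / √(K * M)), by positivity, min_le_left _ _, ?_⟩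
    have h : min (ε / 2) (ε / 2 / √(K * M)) ≤ ε / 2 / √(K * M) := min_le_right _ _
    calc K * (M * (min (ε / 2) (ε / 2 / √(K * M))) ^ 2)
        ≤ K * (M * (ε / 2 / √(K * M)) ^ 2) := by gcongr
      _ = (ε / 2) ^ 2 := by
        rw [div_pow _ (√(K * M)), Real.sq_sqrt (by positivity)]
        field_simp
  obtain ⟨N₁, hN₁⟩ := hcauchy δ hδ0
  have hD' := hD.comp hφ.tendsto_atTop
  obtain ⟨N₂, hN₂⟩ := eventually_atTop.1
    (hD'.eventually_lt_const (show (0 : ℝ) < δ ^ 2 / 4 by positivity))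
  refine ⟨max N₁ N₂, fun n hn m hm => ?_⟩
  rw [dist_eq_norm]
  have hn1 : N₁ ≤ n := (le_max_left _ _).trans hn
  have hm1 : N₁ ≤ m := (le_max_left _ _).trans hm
  have hn2 := hN₂ n ((le_max_right _ _).trans hn)
  have hm2 := hN₂ m ((le_max_right _ _).trans hm)
  simp only [Function.comp_apply] at hn2 hm2 ⊢
  have hval : ∀ e, ∀ x ∈ Icc (0 : ℝ) 1, |val (z (φ n) - z (φ m)) e x| ≤ δ := fun e x hx => by
    rw [val_sub]; exact hN₁ n hn1 m hm1 e x hx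
  have hmass := abs_mass_self_le hB _ hval
  -- Let D = energy − μ · mass. As D is non-negative on the sum, the parallelogram identity bounds D
  -- of the difference by 2D(zₙ) + 2D(zₘ) < δ².
  have hsum := hμ (z (φ n) + z (φ m)) (by simp [h1])
  have henergy : energy G c (z (φ n) - z (φ m)) (z (φ n) - z (φ m)) ≤ M * δ ^ 2 := by
    have h3 : μ * mass G w (z (φ n) - z (φ m)) (z (φ n) - z (φ m)) ≤
        |μ| * (Fintype.card E * (B * δ ^ 2)) := by
      refine (le_abs_self _).trans ?_
      rw [abs_mul]
      gcongr
    simp only [map_add, map_sub, LinearMap.add_apply, LinearMap.sub_apply] at h3 hsum ⊢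
    rw [energy_comm c (z (φ m)) (z (φ n))] at *
    rw [mass_comm w (z (φ m)) (z (φ n))] at *
    nlinarith
  refine lt_of_le_of_lt (norm_le_of_forall (half_pos hε).le hV
    (fun e x hx => (hval e x hx).trans hδ.1) fun e => ?_) (half_lt_self hε)
  refine abs_le_of_sq_le_sq' ?_ (half_pos hε).le |>.2
  exact (hKe _ e).trans ((mul_le_mul_of_nonneg_left henergy hK.le).trans hδ.2)

/-- Energy and mass control the norm. -/
lemma exists_norm_sq_le {c : E → ℝ} {w : E → C(ℝ, ℝ)} (hc : ∀ e, 0 < c e)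
    (hw : ∀ e, ∀ x ∈ Icc (0 : ℝ) 1, 0 < w e x) (hV : ∀ v, ∃ e, G.src e = v ∨ G.tgt e = v) :
    ∃ K : ℝ, 0 < K ∧ ∀ z : G.Sob, ‖z‖ ^ 2 ≤ K * (energy G c z z + mass G w z z) := by
  obtain ⟨K, hK, hKe⟩ := norm_le_of_energy (G := G) hc
  obtain ⟨b, hb, hwb⟩ := exists_pos_le hw
  refine ⟨8 * (K + b⁻¹), by positivity, fun z => ?_⟩
  set A := energy G c z z with hA
  have hA0 : 0 ≤ A := energy_nonneg (fun e => (hc e).le) z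
  have hN0 : 0 ≤ mass G w z z := mass_nonneg (fun e x hx => (hw e x hx).le) z
  have hosc (e : E) (x y : ℝ) : |val z e x - val z e y| ≤ 2 * ‖z.1.2 e‖ := by
    have : val z e x - val z e y = inner ℝ (primVec x - primVec y) (z.1.2 e) := by
      rw [inner_sub_left]; simp [val]
    rw [this]
    refine (abs_real_inner_le_norm _ _).trans ?_
    gcongr
    refine (norm_sub_le _ _).trans ?_
    linarith [norm_primVec_le x, norm_primVec_le y]
  have hmass (e : E) : ∫ x in (0 : ℝ)..1, w e x * val z e x * val z e x ≤ mass G w z z :=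
    Finset.single_le_sum (f := fun e => ∫ x in (0 : ℝ)..1, w e x * val z e x * val z e x)
      (fun e _ => intervalIntegral.integral_nonneg zero_le_one fun x hx => by
        rw [mul_assoc]; exact mul_nonneg (hw e x hx).le (mul_self_nonneg _)) (Finset.mem_univ e)
  have hval (e : E) (x : ℝ) : val z e x ^ 2 ≤ 8 * (K + b⁻¹) * (A + mass G w z z) := by
    -- The inequality s²/2 ≤ (s − t)² + t², with s the value at x and t the value at y, integrated
    -- over y.
    have h1 : b * (val z e x ^ 2 / 2 - 4 * ‖z.1.2 e‖ ^ 2) ≤ mass G w z z := by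
      refine le_trans ?_ (hmass e)
      have : ∫ _y in (0 : ℝ)..1, b * (val z e x ^ 2 / 2 - 4 * ‖z.1.2 e‖ ^ 2) =
          b * (val z e x ^ 2 / 2 - 4 * ‖z.1.2 e‖ ^ 2) := by simp
      rw [← this]
      refine intervalIntegral.integral_mono_on zero_le_one (by simp)
        (intervalIntegrable_mul_val_mul_val ..) fun y hy => ?_
      have h2 : (val z e x - val z e y) ^ 2 ≤ (2 * ‖z.1.2 e‖) ^ 2 :=
        sq_le_sq' (abs_le.1 (hosc e x y)).1 (abs_le.1 (hosc e x y)).2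
      have h3 : val z e x ^ 2 / 2 - 4 * ‖z.1.2 e‖ ^ 2 ≤ val z e y * val z e y := by
        nlinarith [sq_nonneg (val z e x - 2 * val z e y)]
      rw [mul_assoc]
      exact (mul_le_mul_of_nonneg_left h3 hb.le).trans
        (mul_le_mul_of_nonneg_right (hwb e y hy) (mul_self_nonneg _))
    have h4 := hKe z e
    have h5 : val z e x ^ 2 / 2 - 4 * ‖z.1.2 e‖ ^ 2 ≤ b⁻¹ * mass G w z z := by
      rw [← div_eq_inv_mul, le_div_iff₀ hb]; linarith
    have h6 : 0 ≤ b⁻¹ * A := by positivity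
    have h7 : 0 ≤ K * mass G w z z := by positivity
    have h8 : 0 ≤ b⁻¹ * mass G w z z := by positivity
    nlinarith
  have hR : 0 ≤ 8 * (K + b⁻¹) * (A + mass G w z z) := by positivity
  rw [← Real.sq_sqrt hR]
  gcongr
  refine norm_le_of_forall (Real.sqrt_nonneg _) hV (fun e x _ => Real.abs_le_sqrt (hval e x))
    fun e => Real.le_sqrt_of_sq_le ((hKe z e).trans ?_)
  have h6 : 0 ≤ b⁻¹ * A := by positivity
  have h7 : 0 ≤ K * mass G w z z := by positivity
  have h8 : 0 ≤ b⁻¹ * mass G w z z := by positivity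
  have h9 : 0 ≤ K * A := by positivity
  nlinarith

/-- Zero mass kills the values on the edges by continuity, the vertex values because every vertex
lies on an edge, and the derivatives by Lebesgue differentiation of a vanishing primitive. -/
lemma mass_pos {w : E → C(ℝ, ℝ)} (hw : ∀ e, ∀ x ∈ Icc (0 : ℝ) 1, 0 < w e x)
    (hV : ∀ v, ∃ e, G.src e = v ∨ G.tgt e = v) {z : G.Sob} (hz : z ≠ 0) : 0 < mass G w z z := by
  refine lt_of_le_of_ne (mass_nonneg (fun e x hx => (hw e x hx).le) z) fun h0 => hz ?_
  rw [mass_apply, eq_comm, Finset.sum_eq_zero_iff_of_nonneg fun e _ =>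
    intervalIntegral.integral_nonneg zero_le_one fun x hx => by
      rw [mul_assoc]; exact mul_nonneg (hw e x hx).le (mul_self_nonneg _)] at h0
  have hval (e : E) (x : ℝ) (hx : x ∈ Icc (0 : ℝ) 1) : val z e x = 0 := by
    by_contra hne
    have : 0 < ∫ x in (0 : ℝ)..1, w e x * val z e x * val z e x := by
      refine intervalIntegral.integral_pos zero_lt_one
        (Continuous.continuousOn (by fun_prop)) (fun y hy => ?_) ⟨x, hx, ?_⟩
      · rw [mul_assoc]; exact mul_nonneg (hw e y ⟨hy.1.le, hy.2⟩).le (mul_self_nonneg _)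
      · rw [mul_assoc]; exact mul_pos (hw e x hx) (mul_self_pos.2 hne)
    exact this.ne' (h0 e (Finset.mem_univ e))
  have hφ (v : V) : z.1.1 v = 0 := by
    obtain ⟨e, rfl | rfl⟩ := hV v
    · rw [← val_zero]; exact hval e 0 (by simp)
    · rw [← val_one]; exact hval e 1 (by simp)
  have hu (e : E) : z.1.2 e = 0 := by
    have hint (x : ℝ) (hx : x ∈ Icc (0 : ℝ) 1) : ∫ y in (0 : ℝ)..x, z.1.2 e y = 0 := by
      have := val_eq_integral z e hx
      rw [hval e x hx, hφ, zero_add] at this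
      exact this.symm
    have hii : IntervalIntegrable (z.1.2 e) volume 0 1 := by
      rw [intervalIntegrable_iff_integrableOn_Ioc_of_le zero_le_one]
      exact (Lp.memLp (z.1.2 e)).integrable one_le_two
    have hae := hii.ae_hasDerivAt_integral
    refine Lp.ext ?_
    filter_upwards [ae_restrict_of_ae hae, ae_restrict_mem measurableSet_Ioc,
      Lp.coeFn_zero ℝ 2 (volume.restrict (Ioc (0 : ℝ) 1)),
      ae_restrict_of_ae (Measure.ae_ne volume (1 : ℝ))] with x hx hx' h0 h1
    rw [h0]
    have hd := hx (by rw [uIcc_of_le zero_le_one]; exact ⟨hx'.1.le, hx'.2⟩) 0 (by simp)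
    have hd0 : HasDerivAt (fun x => ∫ y in (0 : ℝ)..x, z.1.2 e y) 0 x := by
      refine (hasDerivAt_const x (0 : ℝ)).congr_of_eventuallyEq ?_
      filter_upwards [Ioo_mem_nhds hx'.1 (lt_of_le_of_ne hx'.2 h1)] with y hy
      exact hint y ⟨hy.1.le, hy.2.le⟩
    exact hd.unique hd0
  exact Subtype.ext (Prod.ext (funext hφ) (funext hu))

end Sob

end MultiGraph

/-! ### Identification with `MemW12`, and the min-max principle for the first eigenvalue -/

lemma AbsolutelyContinuousOnInterval.congr_on {f g : ℝ → ℝ} {a b : ℝ}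
    (hf : AbsolutelyContinuousOnInterval f a b) (h : EqOn f g (uIcc a b)) :
    AbsolutelyContinuousOnInterval g a b := by
  rw [absolutelyContinuousOnInterval_iff] at hf ⊢
  intro ε hε
  obtain ⟨δ, hδ, H⟩ := hf ε hε
  refine ⟨δ, hδ, fun I hI hlt => ?_⟩
  have := H I hI hlt
  have heq : ∑ i ∈ Finset.range I.1, dist (f (I.2 i).1) (f (I.2 i).2) =
      ∑ i ∈ Finset.range I.1, dist (g (I.2 i).1) (g (I.2 i).2) := by
    refine Finset.sum_congr rfl fun i hi => ?_
    have hi' := hI.1 i hi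
    rw [h hi'.1, h hi'.2]
  rwa [← heq]

namespace MetricDensityPair

variable {E : Type*}

/-- The conductances of the edges. -/
def cond (p : MetricDensityPair E) (e : E) : ℝ := (√(p.g e))⁻¹

/-- The mass density in the parameter of the edge. -/
def weight (p : MetricDensityPair E) (e : E) : C(ℝ, ℝ) where
  toFun := IccExtend zero_le_one fun x : Icc (0 : ℝ) 1 => √(p.g e) * p.ρ e x
  continuous_toFun := by
    refine Continuous.Icc_extend' (continuous_const.mul ?_)
    exact continuousOn_iff_continuous_domRestrict.1 (p.ρ_smooth e).continuousOn

lemma weight_apply (p : MetricDensityPair E) (e : E) {x : ℝ} (hx : x ∈ Icc (0 : ℝ) 1) :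
    p.weight e x = √(p.g e) * p.ρ e x := by
  change IccExtend zero_le_one (fun x : Icc (0 : ℝ) 1 => √(p.g e) * p.ρ e x) x = _
  rw [IccExtend_of_mem _ _ hx]

lemma cond_pos (p : MetricDensityPair E) (e : E) : 0 < p.cond e :=
  inv_pos.2 (Real.sqrt_pos.2 (p.g_pos e))

lemma weight_pos (p : MetricDensityPair E) (e : E) (x : ℝ) (hx : x ∈ Icc (0 : ℝ) 1) :
    0 < p.weight e x := by
  rw [weight_apply p e hx]
  exact mul_pos (Real.sqrt_pos.2 (p.g_pos e)) (p.ρ_pos e x hx)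

end MetricDensityPair

namespace MultiGraph

variable {V E : Type*} [Fintype V] [Fintype E] {G : MultiGraph V E}

namespace Sob

/-- The function on the metric graph given by an element of the Sobolev space. -/
def toFun : G.Sob →ₗ[ℝ] (G.Point → ℝ) where
  toFun z := Quot.lift (Sum.elim z.1.1 fun q => val z q.1 q.2) (by
    rintro _ _ (e | e)
    · simp [val_zero]
    · simp [val_one])
  map_add' z z' := by
    funext q
    induction q using Quot.ind with
    | mk q => rcases q with v | q
              · rfl
              · exact val_add z z' q.1 q.2
  map_smul' a z := by
    funext q
    induction q using Quot.ind with
    | mk q => rcases q with v | q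
              · rfl
              · exact val_smul a z q.1 q.2

lemma onEdge_toFun (z : G.Sob) (e : E) : G.onEdge (toFun z) e = val z e := by
  funext x
  change val z e (projIcc 0 1 zero_le_one x) = val z e x
  rw [val, val, primVec_eq_of_clamp]
  rw [coe_projIcc]
  rcases le_total x 0 with h | h <;> rcases le_total x 1 with h' | h' <;>
    simp [*]

lemma intervalIntegrable_edgeL2 (u : EdgeL2) : IntervalIntegrable u volume 0 1 := by
  rw [intervalIntegrable_iff_integrableOn_Ioc_of_le zero_le_one]
  exact (Lp.memLp u).integrable one_le_two

lemma hasDerivAt_val (z : G.Sob) (e : E) :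
    ∀ᵐ x ∂volume.restrict (Ioc (0 : ℝ) 1), HasDerivAt (val z e) (z.1.2 e x) x := by
  filter_upwards [ae_restrict_of_ae (intervalIntegrable_edgeL2 (z.1.2 e)).ae_hasDerivAt_integral,
    ae_restrict_mem measurableSet_Ioc,
    ae_restrict_of_ae (Measure.ae_ne volume (1 : ℝ))] with x hx hx' h1
  have hd := hx (by rw [uIcc_of_le zero_le_one]; exact ⟨hx'.1.le, hx'.2⟩) 0 (by simp)
  refine (hd.const_add (z.1.1 (G.src e))).congr_of_eventuallyEq ?_
  filter_upwards [Ioo_mem_nhds hx'.1 (lt_of_le_of_ne hx'.2 h1)] with y hy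
  exact val_eq_integral z e ⟨hy.1.le, hy.2.le⟩

lemma deriv_val (z : G.Sob) (e : E) :
    deriv (val z e) =ᵐ[volume.restrict (Ioc (0 : ℝ) 1)] z.1.2 e :=
  (hasDerivAt_val z e).mono fun _ h => h.deriv

lemma absolutelyContinuous_val (z : G.Sob) (e : E) :
    AbsolutelyContinuousOnInterval (val z e) 0 1 := by
  have h := (intervalIntegrable_edgeL2
    (z.1.2 e)).absolutelyContinuousOnInterval_intervalIntegral (c := 0) (by simp)
  have h0 : AbsolutelyContinuousOnInterval (fun _ : ℝ => z.1.1 (G.src e)) 0 1 :=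
    (contDiffOn_const (𝕜 := ℝ) (n := 1)).absolutelyContinuousOnInterval
  refine (h0.add h).congr_on fun x hx => ?_
  rw [uIcc_of_le zero_le_one] at hx
  exact (val_eq_integral z e hx).symm

lemma memW12_toFun (z : G.Sob) : G.MemW12 (toFun z) := by
  intro e
  rw [onEdge_toFun]
  refine ⟨absolutelyContinuous_val z e, ?_⟩
  rw [Measure.restrict_congr_set Ioo_ae_eq_Ioc]
  exact (memLp_congr_ae (deriv_val z e)).2 (Lp.memLp _)

/-- An absolutely continuous function is the integral of its derivative, so the vertex values and
the almost everywhere derivatives determine it. -/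
lemma exists_toFun_eq {f : G.Point → ℝ} (hf : G.MemW12 f) : ∃ z : G.Sob, toFun z = f := by
  have hLp (e : E) : MemLp (deriv (G.onEdge f e)) 2 (volume.restrict (Ioc (0 : ℝ) 1)) := by
    rw [← Measure.restrict_congr_set Ioo_ae_eq_Ioc]; exact (hf e).2
  have hsrc (e : E) : G.onEdge f e 0 = f (G.vertex (G.src e)) := by
    rw [onEdge, IccExtend_left]
    exact congrArg f (Quot.sound (Glue.src e))
  have htgt (e : E) : G.onEdge f e 1 = f (G.vertex (G.tgt e)) := by
    rw [onEdge, IccExtend_right]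
    exact congrArg f (Quot.sound (Glue.tgt e))
  have hint (e : E) (x : ℝ) (hx : x ∈ Icc (0 : ℝ) 1) :
      inner ℝ (primVec x) ((hLp e).toLp) = G.onEdge f e x - f (G.vertex (G.src e)) := by
    rw [inner_primVec _ hx, ← hsrc]
    have hac : AbsolutelyContinuousOnInterval (G.onEdge f e) 0 x := (hf e).1.mono (by
      rw [uIcc_of_le hx.1, uIcc_of_le zero_le_one]; exact Icc_subset_Icc_right hx.2)
    rw [← hac.integral_deriv_eq_sub, intervalIntegral.integral_of_le hx.1,
      intervalIntegral.integral_of_le hx.1]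
    exact integral_congr_ae
      (ae_restrict_of_ae_restrict_of_subset (Ioc_subset_Ioc_right hx.2) (hLp e).coeFn_toLp)
  refine ⟨⟨(fun v => f (G.vertex v), fun e => (hLp e).toLp), fun e => ?_⟩, ?_⟩
  · rw [hint e 1 (by simp), htgt]
  · funext q
    induction q using Quot.ind with
    | mk q =>
      rcases q with v | ⟨e, x⟩
      · rfl
      · change f (G.vertex (G.src e)) + inner ℝ (primVec x) ((hLp e).toLp) = _
        rw [hint e x x.2, onEdge, IccExtend_of_mem _ _ x.2]
        simp [edgePoint]

lemma toFun_injective (hV : ∀ v, ∃ e, G.src e = v ∨ G.tgt e = v) :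
    Function.Injective (toFun : G.Sob →ₗ[ℝ] (G.Point → ℝ)) := by
  rw [← LinearMap.ker_eq_bot, LinearMap.ker_eq_bot']
  intro z hz
  by_contra hne
  refine (mass_pos (w := fun _ => 1) (by simp) hV hne).ne' ?_
  refine Finset.sum_eq_zero fun e _ => ?_
  have (x : ℝ) : val z e x = 0 := by
    rw [← onEdge_toFun, hz]; rfl
  simp [this]

lemma energy_self (c : E → ℝ) (z : G.Sob) : energy G c z z =
    ∑ e, c e * ∫ x in (0 : ℝ)..1, z.1.2 e x ^ 2 := by
  rw [energy_apply]
  congr! 2 with e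
  rw [L2.inner_def, intervalIntegral.integral_of_le zero_le_one]
  simp [pow_two]

lemma rayleigh_toFun (p : MetricDensityPair E) (z : G.Sob) :
    G.rayleigh p (toFun z) = energy G p.cond z z / mass G p.weight z z := by
  rw [rayleigh, energy_self, mass_apply]
  congr 1 <;> refine Finset.sum_congr rfl fun e _ => ?_
  · rw [onEdge_toFun, ← intervalIntegral.integral_const_mul]
    rw [intervalIntegral.integral_of_le zero_le_one, intervalIntegral.integral_of_le zero_le_one]
    refine integral_congr_ae ?_
    filter_upwards [deriv_val z e] with x hx
    rw [hx, MetricDensityPair.cond, div_eq_inv_mul]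
  · refine intervalIntegral.integral_congr fun x hx => ?_
    rw [uIcc_of_le zero_le_one] at hx
    simp only [onEdge_toFun, p.weight_apply e hx]
    ring

end Sob

open Sob

lemma one_ne_zero_of_edges (hE : Nonempty E) : (1 : G.Sob) ≠ 0 := by
  intro h
  obtain ⟨e⟩ := hE
  have := val_one_eq (G := G) e 0
  rw [h, val_zero] at this
  exact zero_ne_one this

/-- The set of upper bounds defining the first eigenvalue. -/
lemma exists_bound_of_mass_one_eq_zero (hV : ∀ v, ∃ e, G.src e = v ∨ G.tgt e = v)
    (p : MetricDensityPair E) {z : G.Sob} (hz : z ≠ 0) (h1 : mass G p.weight z 1 = 0) :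
    ∃ S : Submodule ℝ (G.Point → ℝ), (∀ f ∈ S, G.MemW12 f) ∧
      Module.finrank ℝ S = 1 + 1 ∧
      ∀ f ∈ S, f ≠ 0 → G.rayleigh p f ≤ energy G p.cond z z / mass G p.weight z z := by
  have hm := mass_pos p.weight_pos hV hz
  have hE : Nonempty E := by
    by_contra hE
    rw [not_nonempty_iff] at hE
    simp [mass_apply] at hm
  have h10 := one_ne_zero_of_edges (G := G) hE
  have hm1 := mass_pos p.weight_pos hV h10
  have hli : LinearIndependent ℝ ![(1 : G.Sob), z] := by
    rw [LinearIndependent.pair_iff]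
    intro a b hab
    have e1 : mass G p.weight (a • 1 + b • z) 1 = 0 := by rw [hab]; simp
    have e2 : mass G p.weight (a • 1 + b • z) z = 0 := by rw [hab]; simp
    simp only [map_add, map_smul, LinearMap.add_apply, LinearMap.smul_apply, smul_eq_mul, h1,
      mass_comm p.weight 1 z] at e1 e2
    constructor
    · simpa [hm1.ne'] using e1
    · simpa [hm.ne'] using e2
  have hli' := hli.map' toFun (LinearMap.ker_eq_bot.2 (toFun_injective hV))
  refine ⟨Submodule.span ℝ (range (toFun ∘ ![(1 : G.Sob), z])), ?_, ?_, ?_⟩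
  · intro f hf
    rw [range_comp, ← Submodule.map_span] at hf
    obtain ⟨y, -, rfl⟩ := hf
    exact memW12_toFun y
  · rw [finrank_span_eq_card hli']; simp
  · intro f hf hf0
    rw [range_comp, ← Submodule.map_span] at hf
    obtain ⟨y, hy, rfl⟩ := hf
    simp only [Matrix.range_cons, Matrix.range_empty, union_empty, singleton_union,
      SetLike.mem_coe] at hy
    obtain ⟨a, b, rfl⟩ := Submodule.mem_span_pair.1 hy
    have hy0 : a • 1 + b • z ≠ 0 := fun h => hf0 (by rw [h, map_zero])
    have hmy := mass_pos p.weight_pos hV hy0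
    -- Since z has mean zero, a + bz has energy b²E(z) and mass a²m(1) + b²m(z): the constant can
    -- only lower the quotient.
    rw [rayleigh_toFun, div_le_div_iff₀ hmy hm]
    simp only [map_add, map_smul, LinearMap.add_apply, LinearMap.smul_apply, smul_eq_mul, h1,
      mass_comm p.weight 1 z, energy_comm p.cond 1 z, energy_one]
    have hen := energy_nonneg (G := G) (fun e => (p.cond_pos e).le) z
    nlinarith [mul_nonneg (mul_self_nonneg a) (mul_nonneg hen hm1.le)]

lemma bddBelow_eigenvalue_one (p : MetricDensityPair E) :
    BddBelow {c : ℝ | ∃ S : Submodule ℝ (G.Point → ℝ), (∀ f ∈ S, G.MemW12 f) ∧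
      Module.finrank ℝ S = 1 + 1 ∧ ∀ f ∈ S, f ≠ 0 → G.rayleigh p f ≤ c} := by
  refine ⟨0, ?_⟩
  rintro c ⟨S, hS, hdim, hc⟩
  have : S ≠ ⊥ := by rintro rfl; simp at hdim
  obtain ⟨f, hf, hf0⟩ := S.ne_bot_iff.1 this
  obtain ⟨z, rfl⟩ := exists_toFun_eq (hS f hf)
  refine le_trans ?_ (hc _ hf hf0)
  rw [rayleigh_toFun]
  exact div_nonneg (energy_nonneg (fun e => (p.cond_pos e).le) z)
    (mass_nonneg (fun e x hx => (p.weight_pos e x hx).le) z)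

/-- The Poincaré inequality with the first eigenvalue. -/
lemma eigenvalue_one_mul_mass_le (hV : ∀ v, ∃ e, G.src e = v ∨ G.tgt e = v)
    (p : MetricDensityPair E) {z : G.Sob} (h1 : mass G p.weight z 1 = 0) :
    G.eigenvalue 1 p * mass G p.weight z z ≤ energy G p.cond z z := by
  rcases eq_or_ne z 0 with rfl | hz
  · simp
  have hm := mass_pos p.weight_pos hV hz
  rw [← le_div_iff₀ hm]
  exact csInf_le (bddBelow_eigenvalue_one p) (exists_bound_of_mass_one_eq_zero hV p hz h1)

/-- The best constant in the Poincaré inequality is the first eigenvalue. -/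
lemma le_eigenvalue_one (hV : ∀ v, ∃ e, G.src e = v ∨ G.tgt e = v) (p : MetricDensityPair E)
    (hne : ∃ z : G.Sob, z ≠ 0 ∧ mass G p.weight z 1 = 0) {μ : ℝ}
    (hμ : ∀ z : G.Sob, mass G p.weight z 1 = 0 → μ * mass G p.weight z z ≤ energy G p.cond z z) :
    μ ≤ G.eigenvalue 1 p := by
  obtain ⟨z₀, hz₀, h₀⟩ := hne
  refine le_csInf ⟨_, exists_bound_of_mass_one_eq_zero hV p hz₀ h₀⟩ ?_
  rintro c ⟨S, hS, hdim, hc⟩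
  obtain ⟨T, hT⟩ : ∃ T : Submodule ℝ G.Sob, T = S.comap toFun := ⟨_, rfl⟩
  have hdim' : Module.finrank ℝ T = 1 + 1 := by
    rw [← hdim]
    refine LinearEquiv.finrank_eq ((Submodule.equivMapOfInjective _ (toFun_injective hV) T).trans
      (LinearEquiv.ofEq _ _ ?_))
    rw [hT]
    refine Submodule.map_comap_eq_of_le fun f hf => ?_
    obtain ⟨z, rfl⟩ := exists_toFun_eq (hS f hf)
    exact LinearMap.mem_range_self _ z
  have : FiniteDimensional ℝ T := Module.finite_of_finrank_pos (by rw [hdim']; norm_num)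
  -- A two-dimensional space meets the hyperplane of mean-zero functions nontrivially.
  let L : T →ₗ[ℝ] ℝ := ((mass G p.weight).flip 1).comp T.subtype
  have hker : LinearMap.ker L ≠ ⊥ :=
    LinearMap.ker_ne_bot_of_finrank_lt (by rw [hdim', Module.finrank_self]; norm_num)
  obtain ⟨z, hz, hz0⟩ := (Submodule.ne_bot_iff _).1 hker
  have hz1 : mass G p.weight z.1 1 = 0 := hz
  have hz0' : z.1 ≠ 0 := fun h => hz0 (Subtype.ext h)
  have hm := mass_pos p.weight_pos hV hz0'
  have hR := hc _ (hT ▸ z.2 : z.1 ∈ S.comap toFun) fun h => hz0' (toFun_injective hV (by rw [h, map_zero]))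
  rw [rayleigh_toFun] at hR
  exact ((le_div_iff₀ hm).2 (hμ _ hz1)).trans hR

end MultiGraph

/-! ### Weak eigenfunctions: existence, finite multiplicity, positivity of the eigenvalue -/

namespace MultiGraph

variable {V E : Type*} [Fintype V] [Fintype E] {G : MultiGraph V E}

/-- Every vertex is the end of an edge, and the graph is connected and not a single vertex. -/
structure IsConn (G : MultiGraph V E) : Prop where
  incident : ∀ v, ∃ e, G.src e = v ∨ G.tgt e = v
  const : ∀ φ : V → ℝ, (∀ e, φ (G.src e) = φ (G.tgt e)) → ∀ v v', φ v = φ v'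
  nontrivial : ∃ v v' : V, v ≠ v'

namespace Sob

lemma continuous_mass_self (w : E → C(ℝ, ℝ)) : Continuous fun z : G.Sob => mass G w z z :=
  (continuous_mass w).comp (f := fun z => (z, z)) (continuous_id.prodMk continuous_id)

lemma continuous_energy_self (c : E → ℝ) : Continuous fun z : G.Sob => energy G c z z :=
  (continuous_energy c).comp (f := fun z => (z, z)) (continuous_id.prodMk continuous_id)

lemma continuous_mass_left (w : E → C(ℝ, ℝ)) (y : G.Sob) : Continuous fun z => mass G w z y :=
  (continuous_mass w).comp (f := fun z => (z, y)) (continuous_id.prodMk continuous_const)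

/-- The function which is affine on the edges with given vertex values. -/
def lin (φ : V → ℝ) : G.Sob :=
  ⟨(φ, fun e => (φ (G.tgt e) - φ (G.src e)) • primVec 1), fun e => by
    have h : inner ℝ (primVec 1) (primVec 1) = (1 : ℝ) := by rw [inner_primVec_primVec]; simp
    rw [inner_smul_right, h, mul_one]⟩

lemma lin_fst (φ : V → ℝ) : (lin φ : G.Sob).1.1 = φ := rfl

lemma lin_snd (φ : V → ℝ) (e : E) :
    (lin φ : G.Sob).1.2 e = (φ (G.tgt e) - φ (G.src e)) • primVec 1 := rfl

lemma val_lin (φ : V → ℝ) (e : E) {x : ℝ} (hx : x ∈ Icc (0 : ℝ) 1) :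
    val (lin φ : G.Sob) e x = φ (G.src e) + (φ (G.tgt e) - φ (G.src e)) * x := by
  rw [val, lin_fst, lin_snd, inner_smul_right, inner_primVec_primVec, min_eq_left hx.2,
    min_eq_left hx.2, max_eq_left hx.1]

lemma exists_ne_zero_mass_one_eq_zero (hG : G.IsConn) {w : E → C(ℝ, ℝ)}
    (hw : ∀ e, ∀ x ∈ Icc (0 : ℝ) 1, 0 < w e x) : ∃ z : G.Sob, z ≠ 0 ∧ mass G w z 1 = 0 := by
  classical
  obtain ⟨v, v', hv⟩ := hG.nontrivial
  have h1 : (1 : G.Sob) ≠ 0 := one_ne_zero_of_edges ⟨(hG.incident v).choose⟩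
  have hm := mass_pos hw hG.incident h1
  set y : G.Sob := lin (Pi.single v 1)
  refine ⟨y - (mass G w y 1 / mass G w 1 1) • 1, fun h => ?_, ?_⟩
  · have h' : y = (mass G w y 1 / mass G w 1 1) • 1 := sub_eq_zero.1 h
    have hv1 : y.1.1 v = y.1.1 v' := by rw [h']; rfl
    rw [lin_fst] at hv1
    simp [hv.symm] at hv1
  · simp [hm.ne']

variable (G) in
/-- The solutions of the weak eigenvalue equation. -/
def eigenspace (c : E → ℝ) (w : E → C(ℝ, ℝ)) (μ : ℝ) : Submodule ℝ G.Sob :=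
  LinearMap.ker (energy G c - μ • mass G w)

lemma mem_eigenspace {c : E → ℝ} {w : E → C(ℝ, ℝ)} {μ : ℝ} {z : G.Sob} :
    z ∈ eigenspace G c w μ ↔ ∀ y, energy G c z y = μ * mass G w z y := by
  rw [eigenspace, LinearMap.mem_ker, LinearMap.ext_iff]
  simp [sub_eq_zero]

lemma mass_one_eq_zero {c : E → ℝ} {w : E → C(ℝ, ℝ)} {μ : ℝ} (hμ : μ ≠ 0) {z : G.Sob}
    (hz : z ∈ eigenspace G c w μ) : mass G w z 1 = 0 := by
  have := mem_eigenspace.1 hz 1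
  rw [energy_one] at this
  simpa [hμ] using this.symm

/-- The first-order condition at a minimum: for b ≠ 0 the step s = −b / (|d| + 1) makes the linear
term outweigh the quadratic one. -/
lemma eq_zero_of_forall_nonneg {b d : ℝ} (h : ∀ s : ℝ, 0 ≤ 2 * s * b + s ^ 2 * d) : b = 0 := by
  by_contra hb
  have hd : 0 < |d| + 1 := by positivity
  have h1 := h (-b / (|d| + 1))
  have h2 : d ≤ |d| + 1 := (le_abs_self d).trans (by linarith)
  have h3 : (-b / (|d| + 1)) ^ 2 * d ≤ (-b / (|d| + 1)) ^ 2 * (|d| + 1) := by gcongr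
  have h4 : 2 * (-b / (|d| + 1)) * b + (-b / (|d| + 1)) ^ 2 * (|d| + 1) = -(b ^ 2 / (|d| + 1)) := by
    field_simp; ring
  have h5 : 0 < b ^ 2 / (|d| + 1) := by positivity
  linarith

/-- z minimises energy − μ · mass among mean-zero functions, so its first variation vanishes in
mean-zero directions. Constants may be added to the test function for free: they have no energy, and
z is orthogonal to them. -/
lemma mem_eigenspace_of_energy_eq {c : E → ℝ} {w : E → C(ℝ, ℝ)} {μ : ℝ}
    (hm1 : mass G w 1 1 ≠ 0)
    (hμ : ∀ z, mass G w z 1 = 0 → μ * mass G w z z ≤ energy G c z z) {z : G.Sob}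
    (h1 : mass G w z 1 = 0) (hz : energy G c z z = μ * mass G w z z) :
    z ∈ eigenspace G c w μ := by
  have key (y : G.Sob) (hy : mass G w y 1 = 0) : energy G c z y - μ * mass G w z y = 0 := by
    refine eq_zero_of_forall_nonneg (d := energy G c y y - μ * mass G w y y) fun s => ?_
    have := hμ (z + s • y) (by simp [h1, hy])
    simp only [map_add, map_smul, LinearMap.add_apply, LinearMap.smul_apply, smul_eq_mul,
      mass_comm w y z, energy_comm c y z] at this
    linarith
  refine mem_eigenspace.2 fun y => ?_
  have := key (y - (mass G w y 1 / mass G w 1 1) • 1) (by simp [hm1])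
  simp only [map_sub, map_smul, smul_eq_mul, energy_one, h1] at this
  linarith

/-- Minimising sequences converge to eigenfunctions. -/
lemma exists_tendsto_eigenspace (hG : G.IsConn) {c : E → ℝ} {w : E → C(ℝ, ℝ)} {μ : ℝ}
    (hc : ∀ e, 0 < c e) (hw : ∀ e, ∀ x ∈ Icc (0 : ℝ) 1, 0 < w e x)
    (hμ : ∀ z : G.Sob, mass G w z 1 = 0 → μ * mass G w z z ≤ energy G c z z)
    (z : ℕ → G.Sob) (h1 : ∀ n, mass G w (z n) 1 = 0) (hm : ∀ n, mass G w (z n) (z n) = 1)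
    (hD : Tendsto (fun n => energy G c (z n) (z n)) atTop (𝓝 μ)) :
    ∃ φ : ℕ → ℕ, StrictMono φ ∧ ∃ y : G.Sob, Tendsto (z ∘ φ) atTop (𝓝 y) ∧
      y ∈ eigenspace G c w μ ∧ mass G w y y = 1 ∧ mass G w y 1 = 0 := by
  obtain ⟨K, hK, hKz⟩ := exists_norm_sq_le (G := G) hc hw hG.incident
  obtain ⟨B, hB⟩ := hD.bddAbove_range
  have hbd (n : ℕ) : ‖z n‖ ≤ √(K * (B + 1)) := by
    refine Real.le_sqrt_of_sq_le ((hKz (z n)).trans ?_)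
    rw [hm n]
    gcongr
    exact hB (mem_range_self n)
  obtain ⟨φ, hφ, y, hy⟩ := exists_subseq_tendsto hc hG.incident hμ z _ hbd h1 (by
    simp only [hm]; simpa using hD.sub_const (μ * 1))
  have e1 : mass G w y y = 1 := by
    refine tendsto_nhds_unique ((continuous_mass_self w).continuousAt.tendsto.comp hy) ?_
    simp only [Function.comp_def, hm]
    exact tendsto_const_nhds
  have e2 : mass G w y 1 = 0 := by
    refine tendsto_nhds_unique ((continuous_mass_left w 1).continuousAt.tendsto.comp hy) ?_
    simp only [Function.comp_def, h1]
    exact tendsto_const_nhds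
  have e3 : energy G c y y = μ :=
    tendsto_nhds_unique ((continuous_energy_self c).continuousAt.tendsto.comp hy)
      (hD.comp hφ.tendsto_atTop)
  refine ⟨φ, hφ, y, hy, mem_eigenspace_of_energy_eq ?_ hμ e2 (by rw [e1, e3, mul_one]), e1, e2⟩
  obtain ⟨v, -⟩ := hG.nontrivial
  exact (mass_pos hw hG.incident (one_ne_zero_of_edges ⟨(hG.incident v).choose⟩)).ne'

/-- Riesz: in infinite dimension there is a bounded 1-separated sequence of eigenfunctions. On these
energy − μ · mass is identically zero, so the compactness lemma would give a convergent subsequence.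
-/
lemma finiteDimensional_eigenspace (hG : G.IsConn) {c : E → ℝ} {w : E → C(ℝ, ℝ)} {μ : ℝ}
    (hc : ∀ e, 0 < c e) (hμ0 : μ ≠ 0)
    (hμ : ∀ z : G.Sob, mass G w z 1 = 0 → μ * mass G w z z ≤ energy G c z z) :
    FiniteDimensional ℝ (eigenspace G c w μ) := by
  by_contra hfin
  obtain ⟨R, f, -, hfR, hsep⟩ := exists_seq_norm_le_one_le_norm_sub hfin
  obtain ⟨φ, hφ, y, hy⟩ := exists_subseq_tendsto hc hG.incident hμ (fun n => (f n : G.Sob)) R hfR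
    (fun n => mass_one_eq_zero hμ0 (f n).2) (by
      refine tendsto_const_nhds.congr fun n => ?_
      rw [mem_eigenspace.1 (f n).2, sub_self])
  obtain ⟨N, hN⟩ := Metric.cauchySeq_iff.1 hy.cauchySeq 1 one_pos
  have h := hN (N + 1) (by simp) N le_rfl
  rw [dist_eq_norm] at h
  exact absurd h (not_lt.2 (hsep (hφ.injective.ne (by simp))))

end Sob

open Sob

/-- A failure of the Poincaré inequality, normalised. -/
lemma exists_normalised (hG : G.IsConn) {c : E → ℝ} {w w' : E → C(ℝ, ℝ)} {μ : ℝ}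
    (hw : ∀ e, ∀ x ∈ Icc (0 : ℝ) 1, 0 < w e x)
    (h : ¬ ∀ z : G.Sob, mass G w z 1 = 0 → μ * mass G w z z ≤ energy G c z z)
    (hw' : ∀ e, ∀ x ∈ Icc (0 : ℝ) 1, 0 < w' e x) (hμ : 0 ≤ μ) :
    ∃ z : G.Sob, mass G w' z 1 = 0 ∧ mass G w' z z = 1 ∧
      energy G c z z < μ * mass G w z z := by
  push Not at h
  obtain ⟨z, hz1, hz⟩ := h
  obtain ⟨v, -⟩ := hG.nontrivial
  have h10 : (1 : G.Sob) ≠ 0 := one_ne_zero_of_edges ⟨(hG.incident v).choose⟩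
  have hm' := mass_pos hw' hG.incident h10
  have hm := mass_pos hw hG.incident h10
  set a := mass G w' z 1 / mass G w' 1 1 with ha
  set y := z - a • (1 : G.Sob) with hy
  have hy1 : mass G w' y 1 = 0 := by simp [hy, ha, hm'.ne']
  have hEy : energy G c y y = energy G c z z := by
    simp [hy, energy_one, energy_comm c 1]
  -- Because z has w-mean zero, subtracting a constant can only increase its w-mass, and it leaves
  -- the energy unchanged. The violated inequality thus survives the passage from w-mean zero to
  -- w'-mean zero.
  have hMy : mass G w z z ≤ mass G w y y := by
    simp only [hy, map_sub, map_smul, LinearMap.sub_apply, LinearMap.smul_apply, smul_eq_mul,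
      mass_comm w 1 z, hz1]
    nlinarith [mul_nonneg (mul_self_nonneg a) hm.le]
  have hlt : energy G c y y < μ * mass G w y y := by
    rw [hEy]; exact hz.trans_le (by gcongr)
  have hy0 : y ≠ 0 := by
    rintro h0
    rw [h0] at hlt
    simp at hlt
  have hpos := mass_pos hw' hG.incident hy0
  set r := (√(mass G w' y y))⁻¹ with hr
  have hr0 : 0 < r := by positivity
  refine ⟨r • y, by simp [hy1], ?_, ?_⟩
  · simp only [map_smul, LinearMap.smul_apply, smul_eq_mul, ← mul_assoc]
    rw [← pow_two, hr, inv_pow, Real.sq_sqrt hpos.le, inv_mul_cancel₀ hpos.ne']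
  · simp only [map_smul, LinearMap.smul_apply, smul_eq_mul]
    nlinarith [mul_pos hr0 hr0]

lemma eigenvalue_one_nonneg (hG : G.IsConn) (p : MetricDensityPair E) : 0 ≤ G.eigenvalue 1 p :=
  le_eigenvalue_one hG.incident p (exists_ne_zero_mass_one_eq_zero hG p.weight_pos) fun z _ => by
    rw [zero_mul]; exact energy_nonneg (fun e => (p.cond_pos e).le) z

/-- The first eigenvalue is attained. -/
lemma exists_eigenfunction (hG : G.IsConn) (p : MetricDensityPair E) :
    ∃ y ∈ eigenspace G p.cond p.weight (G.eigenvalue 1 p),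
      mass G p.weight y y = 1 ∧ mass G p.weight y 1 = 0 := by
  have hne := exists_ne_zero_mass_one_eq_zero hG p.weight_pos
  have hP := fun z (hz : mass G p.weight z 1 = 0) => eigenvalue_one_mul_mass_le hG.incident p hz
  have hseq (n : ℕ) : ∃ z : G.Sob, mass G p.weight z 1 = 0 ∧ mass G p.weight z z = 1 ∧
      energy G p.cond z z < (G.eigenvalue 1 p + 1 / ((n : ℝ) + 1)) * mass G p.weight z z := by
    refine exists_normalised hG p.weight_pos (fun h => ?_) p.weight_pos
      (add_nonneg (eigenvalue_one_nonneg hG p) (by positivity))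
    have := le_eigenvalue_one hG.incident p hne h
    have h0 : (0 : ℝ) < 1 / ((n : ℝ) + 1) := by positivity
    linarith
  choose z h1 hm hlt using hseq
  have hlim : Tendsto (fun n => energy G p.cond (z n) (z n)) atTop (𝓝 (G.eigenvalue 1 p)) := by
    refine tendsto_of_tendsto_of_tendsto_of_le_of_le tendsto_const_nhds
      (h := fun n : ℕ => G.eigenvalue 1 p + 1 / ((n : ℝ) + 1)) ?_ (fun n => ?_) (fun n => ?_)
    · simpa using tendsto_one_div_add_atTop_nhds_zero_nat.const_add (G.eigenvalue 1 p)
    · simpa [hm n] using hP (z n) (h1 n)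
    · simpa [hm n] using (hlt n).le
  obtain ⟨φ, -, y, -, hy, hy1, hy2⟩ :=
    exists_tendsto_eigenspace hG p.cond_pos p.weight_pos hP z h1 hm hlim
  exact ⟨y, hy, hy1, hy2⟩

/-- An eigenfunction for eigenvalue zero would have no energy, hence be constant by connectedness,
against mean zero and mass one. -/
lemma eigenvalue_one_pos (hG : G.IsConn) (p : MetricDensityPair E) : 0 < G.eigenvalue 1 p := by
  refine lt_of_le_of_ne (eigenvalue_one_nonneg hG p) fun h0 => ?_
  obtain ⟨y, hy, hy1, hy2⟩ := exists_eigenfunction hG p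
  have hE := mem_eigenspace.1 hy y
  rw [← h0, zero_mul, energy_apply, Finset.sum_eq_zero_iff_of_nonneg fun e _ =>
    mul_nonneg (p.cond_pos e).le real_inner_self_nonneg] at hE
  have hu (e : E) : y.1.2 e = 0 := by
    simpa [(p.cond_pos e).ne'] using hE e (Finset.mem_univ e)
  have hφ := hG.const y.1.1 fun e => by
    have := y.2 e
    rw [hu e, inner_zero_right] at this
    linarith
  obtain ⟨v, -⟩ := hG.nontrivial
  have hyc : y = y.1.1 v • (1 : G.Sob) := by
    refine Subtype.ext (Prod.ext (funext fun v' => ?_) (funext fun e => ?_))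
    · rw [hφ v' v]; simp [fst_one]
    · rw [hu e]; simp [snd_one]
  rw [hyc] at hy1 hy2
  simp only [map_smul, LinearMap.smul_apply, smul_eq_mul] at hy1 hy2
  rw [hy2] at hy1
  simp at hy1

end MultiGraph

/-! ### A separation theorem for spaces of bilinear forms -/

/-- The positive semidefinite matrices of trace one, as points of a Euclidean space. -/
def densityMatrices (ι : Type*) [Fintype ι] : Set (EuclideanSpace ℝ (ι × ι)) :=
  {p | (∀ i j, p (i, j) = p (j, i)) ∧ (∀ x : ι → ℝ, 0 ≤ ∑ i, ∑ j, x i * x j * p (i, j)) ∧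
    ∑ i, p (i, i) = 1}

section

variable {ι : Type*} [Fintype ι]

lemma convex_densityMatrices : Convex ℝ (densityMatrices ι) := by
  intro p hp q hq a b ha hb hab
  refine ⟨fun i j => ?_, fun x => ?_, ?_⟩
  · simp [hp.1 i j, hq.1 i j]
  · have h1 := mul_nonneg ha (hp.2.1 x)
    have h2 := mul_nonneg hb (hq.2.1 x)
    refine (add_nonneg h1 h2).trans_eq ?_
    simp only [Finset.mul_sum, ← Finset.sum_add_distrib]
    congr! 2 with i _ j
    simp; ring
  · simp [Finset.sum_add_distrib, ← Finset.mul_sum, hp.2.2, hq.2.2, hab]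

/-- Boundedness comes from testing on eᵢ ± eⱼ: this gives 2|p(i,j)| ≤ p(i,i) + p(j,j), and the
diagonal entries lie in [0, 1]. -/
lemma isCompact_densityMatrices : IsCompact (densityMatrices ι) := by
  classical
  refine Metric.isCompact_of_isClosed_isBounded ?_ ?_
  · have : densityMatrices ι = (⋂ i, ⋂ j, {p | p (i, j) = p (j, i)}) ∩
        ((⋂ x : ι → ℝ, {p | 0 ≤ ∑ i, ∑ j, x i * x j * p (i, j)}) ∩ {p | ∑ i, p (i, i) = 1}) := by
      ext p; simp [densityMatrices]
    rw [this]
    refine IsClosed.inter (isClosed_iInter fun i => isClosed_iInter fun j =>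
      isClosed_eq (by fun_prop) (by fun_prop)) (IsClosed.inter (isClosed_iInter fun x =>
        isClosed_le (by fun_prop) (by fun_prop)) (isClosed_eq (by fun_prop) (by fun_prop)))
  · refine (Metric.isBounded_iff_subset_closedBall 0).2
      ⟨√(∑ _ij : ι × ι, (1 : ℝ) ^ 2), fun p hp => ?_⟩
    rw [mem_closedBall_zero_iff, EuclideanSpace.norm_eq]
    refine Real.sqrt_le_sqrt (Finset.sum_le_sum fun ij _ => ?_)
    obtain ⟨i, j⟩ := ij
    have hd (i : ι) : 0 ≤ p (i, i) := by
      simpa [Pi.single_apply] using hp.2.1 (Pi.single i 1)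
    have hd1 (i : ι) : p (i, i) ≤ 1 := by
      rw [← hp.2.2]
      exact Finset.single_le_sum (f := fun i => p (i, i)) (fun i _ => hd i) (Finset.mem_univ i)
    have hq (s : ℝ) : 0 ≤ p (i, i) + 2 * s * p (i, j) + s ^ 2 * p (j, j) := by
      have := hp.2.1 (Pi.single i 1 + s • Pi.single j 1)
      simp [Pi.single_apply, add_mul, mul_add, Finset.sum_add_distrib] at this
      rw [hp.1 j i] at this
      linarith
    have h1 := hq 1
    have h2 := hq (-1)
    have h3 := hd1 i
    have h4 := hd1 j
    rw [Real.norm_eq_abs]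
    exact pow_le_pow_left₀ (abs_nonneg _) (abs_le.2 ⟨by linarith, by linarith⟩) 2

lemma exists_sum_of_mem_densityMatrices {p : EuclideanSpace ℝ (ι × ι)}
    (hp : p ∈ densityMatrices ι) :
    ∃ (n : ℕ) (v : Fin n → ι → ℝ), ∀ i j, p (i, j) = ∑ k, v k i * v k j := by
  have hpsd : (Matrix.of fun i j => p (i, j)).PosSemidef := by
    rw [Matrix.posSemidef_iff_dotProduct_mulVec]
    refine ⟨Matrix.IsHermitian.ext fun i j => by simpa using hp.1 j i, fun x => ?_⟩
    refine (hp.2.1 x).trans_eq ?_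
    simp only [dotProduct, Matrix.mulVec, Finset.mul_sum, star_trivial, Matrix.of_apply]
    congr! 2 with i _ j
    ring
  obtain ⟨n, v, hv⟩ := Matrix.posSemidef_iff_eq_sum_vecMulVec.1 hpsd
  refine ⟨n, v, fun i j => ?_⟩
  have := congrFun (congrFun hv i) j
  simpa [Matrix.sum_apply, Matrix.vecMulVec_apply] using this

end

/-- A subspace of bilinear forms contains a form with positive diagonal, or some nontrivial
finite sum of squares is annihilated by it. -/
theorem exists_pos_or_exists_sum_eq_zero {W : Type*} [AddCommGroup W] [Module ℝ W]
    [FiniteDimensional ℝ W] [Nontrivial W] (L : Submodule ℝ (LinearMap.BilinForm ℝ W)) :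
    (∃ B ∈ L, ∀ x : W, x ≠ 0 → 0 < B x x) ∨
    ∃ (n : ℕ) (f : Fin n → W), (∃ i, f i ≠ 0) ∧ ∀ B ∈ L, ∑ i, B (f i) (f i) = 0 := by
  let b := Module.finBasis ℝ W
  let ι := Fin (Module.finrank ℝ W)
  let T : LinearMap.BilinForm ℝ W →ₗ[ℝ] EuclideanSpace ℝ (ι × ι) :=
    { toFun := fun B => WithLp.toLp 2 fun ij => B (b ij.1) (b ij.2)
      map_add' := fun B B' => by ext; simp
      map_smul' := fun a B => by ext; simp }
  have hT (B : LinearMap.BilinForm ℝ W) (p : EuclideanSpace ℝ (ι × ι)) :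
      inner ℝ (T B) p = ∑ i, ∑ j, p (i, j) * B (b i) (b j) := by
    rw [PiLp.inner_apply, Fintype.sum_prod_type]
    rfl
  have hB (B : LinearMap.BilinForm ℝ W) (a : ι → ℝ) :
      B (∑ i, a i • b i) (∑ i, a i • b i) = ∑ i, ∑ j, a i * a j * B (b i) (b j) := by
    simp only [map_sum, map_smul, LinearMap.sum_apply, LinearMap.smul_apply, smul_eq_mul,
      Finset.mul_sum, mul_assoc]
    rw [Finset.sum_comm]
    congr! 2 with i _ j
    ring
  let M := L.map T
  -- Forms in L pair with a density matrix only through its projection to M, so the point of K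
  -- nearest to the origin decides. If it is zero, some density matrix is annihilated by L, and its
  -- decomposition into rank-one matrices gives the family.
  let K := M.starProjection '' densityMatrices ι
  have hKc : IsCompact K := isCompact_densityMatrices.image M.starProjection.continuous
  have hKconv : Convex ℝ K := convex_densityMatrices.linear_image M.starProjection.toLinearMap
  have hproj (B : LinearMap.BilinForm ℝ W) (hBL : B ∈ L) (p : EuclideanSpace ℝ (ι × ι)) :
      inner ℝ (T B) p = inner ℝ (T B) (M.starProjection p) := by
    have := M.starProjection_inner_eq_zero p (T B) (Submodule.mem_map_of_mem hBL)
    rw [inner_sub_left, sub_eq_zero] at this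
    rw [real_inner_comm, this, real_inner_comm]
  have hrank (x : W) (hx : x ≠ 0) : ∃ (q : EuclideanSpace ℝ (ι × ι)) (s : ℝ), 0 < s ∧
      q ∈ densityMatrices ι ∧ ∀ B : LinearMap.BilinForm ℝ W, B x x = s * inner ℝ (T B) q := by
    let a : ι → ℝ := fun i => b.repr x i
    have hxa : x = ∑ i, a i • b i := (b.sum_repr x).symm
    have hs : 0 < ∑ i, a i ^ 2 := by
      refine lt_of_le_of_ne (Finset.sum_nonneg fun i _ => sq_nonneg _) fun h => hx ?_
      rw [eq_comm, Finset.sum_eq_zero_iff_of_nonneg fun i _ => sq_nonneg _] at h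
      rw [hxa]
      exact Finset.sum_eq_zero fun i hi => by simp [pow_eq_zero_iff two_ne_zero |>.1 (h i hi)]
    refine ⟨WithLp.toLp 2 fun ij => (∑ i, a i ^ 2)⁻¹ * (a ij.1 * a ij.2), _, hs,
      ⟨fun i j => ?_, fun y => ?_, ?_⟩, fun B => ?_⟩
    · simp only [mul_comm (a i)]
    · have : ∑ i, ∑ j, y i * y j * ((∑ i, a i ^ 2)⁻¹ * (a i * a j)) =
          (∑ i, a i ^ 2)⁻¹ * (∑ i, y i * a i) ^ 2 := by
        rw [pow_two, Finset.sum_mul_sum, Finset.mul_sum]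
        refine Finset.sum_congr rfl fun i _ => ?_
        rw [Finset.mul_sum]
        exact Finset.sum_congr rfl fun j _ => by ring
      exact (mul_nonneg (inv_nonneg.2 hs.le) (sq_nonneg _)).trans_eq this.symm
    · simp only [← Finset.mul_sum, ← pow_two]
      exact inv_mul_cancel₀ hs.ne'
    · rw [hT, hxa, hB]
      simp only [mul_assoc, ← Finset.mul_sum]
      rw [mul_inv_cancel_left₀ hs.ne']
  obtain ⟨x₀, hx₀⟩ := exists_ne (0 : W)
  obtain ⟨q₀, -, -, hq₀, -⟩ := hrank x₀ hx₀
  have hKne : K.Nonempty := ⟨_, mem_image_of_mem _ hq₀⟩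
  obtain ⟨v, hvK, hv⟩ := exists_norm_eq_iInf_of_complete_convex hKne hKc.isComplete hKconv 0
  have hmin := (norm_eq_iInf_iff_real_inner_le_zero hKconv hvK).1 hv
  obtain ⟨p, hp, rfl⟩ := hvK
  by_cases hv0 : M.starProjection p = 0
  · right
    obtain ⟨n, c, hc⟩ := exists_sum_of_mem_densityMatrices hp
    refine ⟨n, fun k => ∑ i, c k i • b i, ?_, fun B hBL => ?_⟩
    · by_contra! h
      have hc0 (k : Fin n) (i : ι) : c k i = 0 :=
        Fintype.linearIndependent_iff.1 b.linearIndependent (c k) (h k) i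
      have := hp.2.2
      simp [hc, hc0] at this
    · have h0 : inner ℝ (T B) p = (0 : ℝ) := by rw [hproj B hBL, hv0, inner_zero_right]
      rw [hT] at h0
      rw [← h0]
      simp only [hB, hc, Finset.sum_mul]
      rw [Finset.sum_comm]
      refine Finset.sum_congr rfl fun i _ => ?_
      rw [Finset.sum_comm]
  · left
    -- The nearest point is the matrix of a form B in L. Minimality says that B pairs with every
    -- density matrix to at least the squared distance, and rank-one density matrices recover the
    -- diagonal values of B.
    obtain ⟨B, hBL, hBv⟩ := M.starProjection_apply_mem p
    refine ⟨B, hBL, fun x hx => ?_⟩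
    obtain ⟨q, s, hs, hq, hsB⟩ := hrank x hx
    rw [hsB, hproj B hBL, hBv]
    have := hmin _ (mem_image_of_mem _ hq)
    rw [zero_sub, inner_neg_left, inner_sub_right, real_inner_self_eq_norm_sq] at this
    have h2 : 0 < ‖M.starProjection p‖ ^ 2 := by positivity
    exact mul_pos hs (by linarith)

/-! ### Regularity of weak eigenfunctions and the Kirchhoff condition -/

namespace MultiGraph

variable {V E : Type*} [Fintype V] [Fintype E] {G : MultiGraph V E}

namespace Sob

lemma primVec_one_coe : primVec 1 =ᵐ[volume.restrict (Ioc (0 : ℝ) 1)] fun _ => 1 := by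
  filter_upwards [indicatorConstLp_coeFn (p := 2) (hs := (measurableSet_Ioc : MeasurableSet (Ioc (0 : ℝ) 1)))
    (hμs := measure_ne_top (volume.restrict (Ioc (0 : ℝ) 1)) _) (c := (1 : ℝ)),
    ae_restrict_mem measurableSet_Ioc] with x hx hx'
  rw [primVec, hx, indicator_of_mem hx']

/-- Weak eigenfunctions are continuously differentiable on the edges, and their derivatives
satisfy the eigenvalue equation. -/
lemma exists_deriv_of_mem_eigenspace {c : E → ℝ} {w : E → C(ℝ, ℝ)} {μ : ℝ} (hc : ∀ e, 0 < c e)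
    {z : G.Sob} (hz : z ∈ eigenspace G c w μ) (e : E) :
    ∃ v : ℝ → ℝ, (∀ x, HasDerivAt v (-(μ / c e) * (w e x * val z e x)) x) ∧
      (z.1.2 e =ᵐ[volume.restrict (Ioc (0 : ℝ) 1)] v) ∧
      ∀ x ∈ Icc (0 : ℝ) 1, HasDerivWithinAt (val z e) (v x) (Icc 0 1) x := by
  classical
  set m : ℝ → ℝ := fun x => w e x * val z e x with hm
  have hmc : Continuous m := by fun_prop
  set q : ℝ → ℝ := fun x => ∫ y in (0 : ℝ)..x, m y with hq
  have hqd (x : ℝ) : HasDerivAt q (m x) x :=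
    intervalIntegral.integral_hasDerivAt_right (hmc.intervalIntegrable _ _)
      (hmc.stronglyMeasurableAtFilter _ _) hmc.continuousAt
  have hqc : Continuous q := continuous_iff_continuousAt.2 fun x => (hqd x).continuousAt
  have hqL : MemLp q 2 (volume.restrict (Ioc (0 : ℝ) 1)) := by
    obtain ⟨C, hC⟩ := (isCompact_Icc (a := (0 : ℝ)) (b := 1)).exists_bound_of_continuousOn
      hqc.continuousOn
    refine MemLp.of_bound hqc.aestronglyMeasurable C ?_
    filter_upwards [ae_restrict_mem measurableSet_Ioc] with x hx
    exact hC x ⟨hx.1.le, hx.2⟩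
  have hqac : AbsolutelyContinuousOnInterval q 0 1 := by
    refine ContDiffOn.absolutelyContinuousOnInterval (ContDiff.contDiffOn ?_)
    rw [contDiff_one_iff_deriv]
    refine ⟨fun x => (hqd x).differentiableAt, ?_⟩
    rw [show deriv q = m from funext fun x => (hqd x).deriv]
    exact hmc
  set Q : EdgeL2 := hqL.toLp with hQ
  -- Du Bois-Reymond argument: the test function lives on one edge and vanishes at its ends, and
  -- integration by parts moves the mass term onto the primitive q.
  have key (ψ : EdgeL2) (hψ : inner ℝ (primVec 1) ψ = (0 : ℝ)) :
      inner ℝ (c e • z.1.2 e + μ • Q) ψ = (0 : ℝ) := by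
    let y : G.Sob := ⟨(0, Pi.single e ψ), fun e' => by
      rcases eq_or_ne e' e with rfl | h
      · simp [hψ]
      · simp [h]⟩
    have hy1 : y.1.2 e = ψ := by
      change (Pi.single e ψ : E → EdgeL2) e = ψ
      exact Pi.single_eq_same (M := fun _ => EdgeL2) e ψ
    have hy2 (e' : E) (h : e' ≠ e) : y.1.2 e' = 0 := by
      change (Pi.single e ψ : E → EdgeL2) e' = 0
      exact Pi.single_eq_of_ne (M := fun _ => EdgeL2) h ψ
    have hE : energy G c z y = c e * inner ℝ (z.1.2 e) ψ := by
      rw [energy_apply, Finset.sum_eq_single e (fun e' _ h => by rw [hy2 e' h]; simp) (by simp), hy1]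
    have hM : mass G w z y = ∫ x in (0 : ℝ)..1, m x * val y e x := by
      rw [mass_apply, Finset.sum_eq_single e (fun e' _ h => ?_) (by simp)]
      have : val y e' = 0 := by
        funext x
        rw [val, hy2 e' h, inner_zero_right]
        exact add_zero (0 : ℝ)
      simp [this]
    have hparts := (absolutelyContinuous_val y e).integral_mul_deriv_eq_deriv_mul hqac
    rw [val_zero, val_one] at hparts
    have h0 (v : V) : y.1.1 v = 0 := rfl
    have hL : ∫ x in (0 : ℝ)..1, val y e x * deriv q x = mass G w z y := by
      rw [hM]
      refine intervalIntegral.integral_congr fun x _ => ?_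
      simp only [(hqd x).deriv]
      ring
    have hR : ∫ x in (0 : ℝ)..1, deriv (val y e) x * q x = inner ℝ Q ψ := by
      rw [L2.inner_def, intervalIntegral.integral_of_le zero_le_one]
      refine MeasureTheory.integral_congr_ae ?_
      filter_upwards [deriv_val y e, hqL.coeFn_toLp] with x hx hx'
      rw [hx, hx', hy1]
      simp
    rw [hL, hR, h0, h0] at hparts
    have := mem_eigenspace.1 hz y
    rw [hE, hparts] at this
    rw [inner_add_left, real_inner_smul_left, real_inner_smul_left, this]
    ring
  set h : EdgeL2 := c e • z.1.2 e + μ • Q with hh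
  have h11 : inner ℝ (primVec 1) (primVec 1) = (1 : ℝ) := by rw [inner_primVec_primVec]; simp
  set k : ℝ := inner ℝ (primVec 1) h with hk
  have hperp : inner ℝ (primVec 1) (h - k • primVec 1) = (0 : ℝ) := by
    rw [inner_sub_right, real_inner_smul_right, h11, hk]; ring
  -- k is the mean of h, so h minus its mean is an admissible ψ and is orthogonal to itself.
  have hzero : h - k • primVec 1 = 0 := by
    rw [← inner_self_eq_zero (𝕜 := ℝ), inner_sub_left, key _ hperp, real_inner_smul_left, hperp]
    ring
  set v : ℝ → ℝ := fun x => (k - μ * q x) / c e with hv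
  have hvd (x : ℝ) : HasDerivAt v (-(μ / c e) * (w e x * val z e x)) x := by
    convert! (((hqd x).const_mul μ).const_sub k).div_const (c e) using 1
    rw [hm]; ring
  have hvc : Continuous v := continuous_iff_continuousAt.2 fun x => (hvd x).continuousAt
  have hae : z.1.2 e =ᵐ[volume.restrict (Ioc (0 : ℝ) 1)] v := by
    have h1 : (c e • z.1.2 e + μ • Q : EdgeL2) = k • primVec 1 := sub_eq_zero.1 hzero
    have h2 := Lp.coeFn_add (c e • z.1.2 e) (μ • Q)
    rw [h1] at h2
    filter_upwards [h2, Lp.coeFn_smul (c e) (z.1.2 e), Lp.coeFn_smul μ Q,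
      Lp.coeFn_smul k (primVec 1), primVec_one_coe, hqL.coeFn_toLp] with x a1 a2 a3 a4 a5 a6
    rw [a4, Pi.add_apply, a2, a3] at a1
    have a7 : Q x = q x := a6
    simp only [Pi.smul_apply, smul_eq_mul, a5, a7] at a1
    rw [hv, eq_div_iff (hc e).ne']
    linarith
  refine ⟨v, hvd, hae, fun x hx => ?_⟩
  have hF : HasDerivAt (fun x => z.1.1 (G.src e) + ∫ y in (0 : ℝ)..x, v y) (v x) x :=
    (intervalIntegral.integral_hasDerivAt_right (hvc.intervalIntegrable _ _)
      (hvc.stronglyMeasurableAtFilter _ _) hvc.continuousAt).const_add _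
  have heq (y : ℝ) (hy : y ∈ Icc (0 : ℝ) 1) :
      val z e y = z.1.1 (G.src e) + ∫ t in (0 : ℝ)..y, v t := by
    rw [val_eq_integral z e hy, intervalIntegral.integral_of_le hy.1,
      intervalIntegral.integral_of_le hy.1]
    congr 1
    exact integral_congr_ae
      (ae_restrict_of_ae_restrict_of_subset (Ioc_subset_Ioc_right hy.2) hae)
  exact hF.hasDerivWithinAt.congr heq (heq x hx)

/-- The Kirchhoff condition, tested against a function on the vertices. -/
lemma kirchhoff_of_mem_eigenspace {c : E → ℝ} {w : E → C(ℝ, ℝ)} {μ : ℝ} (hc : ∀ e, 0 < c e)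
    {z : G.Sob} (hz : z ∈ eigenspace G c w μ) {v : E → ℝ → ℝ}
    (hv : ∀ e x, HasDerivAt (v e) (-(μ / c e) * (w e x * val z e x)) x)
    (hae : ∀ e, z.1.2 e =ᵐ[volume.restrict (Ioc (0 : ℝ) 1)] v e) (φ : V → ℝ) :
    ∑ e, c e * (v e 1 * φ (G.tgt e) - v e 0 * φ (G.src e)) = 0 := by
  have hvc (e : E) : Continuous (v e) := continuous_iff_continuousAt.2 fun x =>
    (hv e x).continuousAt
  have hE := mem_eigenspace.1 hz (lin φ)
  rw [energy_apply, mass_apply, Finset.mul_sum, ← sub_eq_zero, ← Finset.sum_sub_distrib] at hE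
  refine Eq.trans (Finset.sum_congr rfl fun e _ => ?_) hE
  set d := φ (G.tgt e) - φ (G.src e) with hd
  have h1 : inner ℝ (z.1.2 e) ((lin φ : G.Sob).1.2 e) = d * ∫ x in (0 : ℝ)..1, v e x := by
    rw [lin_snd, inner_smul_right, real_inner_comm, inner_primVec _ (by simp)]
    congr 1
    rw [intervalIntegral.integral_of_le zero_le_one, intervalIntegral.integral_of_le zero_le_one]
    exact integral_congr_ae (hae e)
  -- Parts against the affine interpolation of φ: the weak equation removes the interior terms and
  -- leaves the boundary terms.
  have h2 := intervalIntegral.integral_mul_deriv_eq_deriv_mul (a := 0) (b := 1)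
    (u := fun x => φ (G.src e) + d * x) (u' := fun _ => d) (v := v e)
    (v' := fun x => -(μ / c e) * (w e x * val z e x))
    (fun x _ => by simpa using ((hasDerivAt_id x).const_mul d).const_add (φ (G.src e)))
    (fun x _ => hv e x) (by simp) (Continuous.intervalIntegrable (by fun_prop) _ _)
  have h3 : ∫ x in (0 : ℝ)..1, (φ (G.src e) + d * x) * (-(μ / c e) * (w e x * val z e x)) =
      -(μ / c e) * ∫ x in (0 : ℝ)..1, w e x * val z e x * val (lin φ : G.Sob) e x := by
    rw [← intervalIntegral.integral_const_mul]
    refine intervalIntegral.integral_congr fun x hx => ?_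
    rw [uIcc_of_le zero_le_one] at hx
    simp only [val_lin (G := G) φ e hx, ← hd]
    ring
  rw [h3, intervalIntegral.integral_const_mul] at h2
  rw [h1]
  have hce := (hc e).ne'
  have h4 : μ * ∫ x in (0 : ℝ)..1, w e x * val z e x * val (lin φ : G.Sob) e x =
      -c e * (-(μ / c e) * ∫ x in (0 : ℝ)..1, w e x * val z e x * val (lin φ : G.Sob) e x) := by
    field_simp
  rw [h4, h2, hd]
  ring

lemma norm_snd_sq {z : G.Sob} {e : E} {v : ℝ → ℝ}
    (hae : z.1.2 e =ᵐ[volume.restrict (Ioc (0 : ℝ) 1)] v) :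
    inner ℝ (z.1.2 e) (z.1.2 e) = ∫ x in (0 : ℝ)..1, v x ^ 2 := by
  rw [L2.inner_def, intervalIntegral.integral_of_le zero_le_one]
  refine integral_congr_ae ?_
  filter_upwards [hae] with x hx
  simp [hx, pow_two]

end Sob

end MultiGraph

/-! ### Exponential variations of a pair and of the normalising factors -/

namespace MetricDensityPair

variable {E : Type*}

/-- The family of pairs with `g_e(t) = g_e e^{t h_e}` whose weights are `w_e e^{t σ_e}`. -/
def vary (p : MetricDensityPair E) (h : E → ℝ) (σ : E → C(ℝ, ℝ)) (hσ : ∀ e, ContDiff ℝ ∞ (σ e))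
    (t : ℝ) : MetricDensityPair E where
  g e := p.g e * Real.exp (t * h e)
  -- The shift by h/2 cancels the growth of √g. Conductances then depend on h alone and weights on σ
  -- alone.
  ρ e x := p.ρ e x * Real.exp (t * (σ e x - h e / 2))
  g_pos e := mul_pos (p.g_pos e) (Real.exp_pos _)
  ρ_smooth e := (p.ρ_smooth e).mul
    (ContDiff.contDiffOn (by have := hσ e; fun_prop))
  ρ_pos e x hx := mul_pos (p.ρ_pos e x hx) (Real.exp_pos _)

variable (p : MetricDensityPair E) (h : E → ℝ) {σ : E → C(ℝ, ℝ)} (hσ : ∀ e, ContDiff ℝ ∞ (σ e))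

lemma vary_zero : p.vary h σ hσ 0 = p := by
  cases p
  simp [vary]

lemma isSmoothFamily_vary : IsSmoothFamily 1 (p.vary h σ hσ) := by
  intro e
  constructor
  · refine ContDiff.contDiffOn ?_
    change ContDiff ℝ ∞ fun t => p.g e * Real.exp (t * h e)
    fun_prop
  · change ContDiffOn ℝ ∞ (fun q : ℝ × ℝ => p.ρ e q.2 * Real.exp (q.1 * (σ e q.2 - h e / 2))) _
    refine ContDiffOn.mul ?_ (ContDiff.contDiffOn ?_)
    · exact (p.ρ_smooth e).comp contDiff_snd.contDiffOn fun q hq => hq.2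
    · have h1 : ContDiff ℝ ∞ fun q : ℝ × ℝ => σ e q.2 := (hσ e).comp contDiff_snd
      fun_prop

lemma sqrt_g_vary (t : ℝ) (e : E) :
    √((p.vary h σ hσ t).g e) = √(p.g e) * Real.exp (t * h e / 2) := by
  change √(p.g e * Real.exp (t * h e)) = _
  rw [Real.sqrt_mul (p.g_pos e).le, Real.exp_half]

lemma cond_vary (t : ℝ) (e : E) :
    (p.vary h σ hσ t).cond e = p.cond e * Real.exp (-(t * h e / 2)) := by
  rw [cond, sqrt_g_vary, mul_inv, Real.exp_neg, cond]

/-- The weight `w e^{t σ}`. -/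
def expWeight (w σ : C(ℝ, ℝ)) (t : ℝ) : C(ℝ, ℝ) := ⟨fun x => w x * Real.exp (t * σ x), by fun_prop⟩

lemma expWeight_apply (w σ : C(ℝ, ℝ)) (t x : ℝ) :
    expWeight w σ t x = w x * Real.exp (t * σ x) := rfl

lemma weight_vary (t : ℝ) (e : E) {x : ℝ} (hx : x ∈ Icc (0 : ℝ) 1) :
    (p.vary h σ hσ t).weight e x = expWeight (p.weight e) (σ e) t x := by
  rw [weight_apply _ _ hx, sqrt_g_vary, expWeight_apply, weight_apply _ _ hx]
  change √(p.g e) * Real.exp (t * h e / 2) * (p.ρ e x * Real.exp (t * (σ e x - h e / 2))) = _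
  rw [show t * σ e x = t * h e / 2 + t * (σ e x - h e / 2) by ring, Real.exp_add]
  ring

variable [Fintype E]

/-- The first normalising factor. -/
def lenSum (α : ℝ) (p : MetricDensityPair E) : ℝ := ∑ e, p.g e ^ (1 - α)

/-- The second normalising factor. -/
def massSum (α : ℝ) (p : MetricDensityPair E) : ℝ :=
  ∑ e, p.g e ^ (α - 1 / 2) * ∫ x in (0 : ℝ)..1, p.weight e x

/-- The weight already contains √g, which accounts for the exponent α − 1/2 in `massSum`. -/
lemma massSum_eq (α : ℝ) : massSum α p = ∑ e, p.g e ^ α * ∫ x in (0 : ℝ)..1, p.ρ e x := by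
  refine Finset.sum_congr rfl fun e _ => ?_
  have : ∫ x in (0 : ℝ)..1, p.weight e x = ∫ x in (0 : ℝ)..1, √(p.g e) * p.ρ e x :=
    intervalIntegral.integral_congr fun x hx => by
      rw [uIcc_of_le zero_le_one] at hx
      exact p.weight_apply e hx
  rw [this, intervalIntegral.integral_const_mul, ← mul_assoc, Real.sqrt_eq_rpow,
    ← Real.rpow_add (p.g_pos e)]
  congr 2
  ring

lemma integral_weight_pos (e : E) : 0 < ∫ x in (0 : ℝ)..1, p.weight e x :=
  intervalIntegral.intervalIntegral_pos_of_pos_on ((p.weight e).continuous.intervalIntegrable _ _)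
    (fun x hx => p.weight_pos e x ⟨hx.1.le, hx.2.le⟩) zero_lt_one

lemma lenSum_pos [Nonempty E] (α : ℝ) : 0 < lenSum α p :=
  Finset.sum_pos (fun e _ => Real.rpow_pos_of_pos (p.g_pos e) _) Finset.univ_nonempty

lemma massSum_pos [Nonempty E] (α : ℝ) : 0 < massSum α p :=
  Finset.sum_pos (fun e _ => mul_pos (Real.rpow_pos_of_pos (p.g_pos e) _)
    (p.integral_weight_pos e)) Finset.univ_nonempty

/-- The derivative of `lenSum` along `vary`. -/
def lenSum' (α : ℝ) (p : MetricDensityPair E) (h : E → ℝ) : ℝ :=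
  ∑ e, p.g e ^ (1 - α) * ((1 - α) * h e)

/-- The derivative of `massSum` along `vary`. -/
def massSum' (α : ℝ) (p : MetricDensityPair E) (h : E → ℝ) (σ : E → C(ℝ, ℝ)) : ℝ :=
  ∑ e, p.g e ^ (α - 1 / 2) * ((α - 1 / 2) * h e * (∫ x in (0 : ℝ)..1, p.weight e x) +
    ∫ x in (0 : ℝ)..1, p.weight e x * σ e x)

lemma g_vary_rpow (β t : ℝ) (e : E) :
    (p.vary h σ hσ t).g e ^ β = p.g e ^ β * Real.exp (t * (β * h e)) := by
  change (p.g e * Real.exp (t * h e)) ^ β = _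
  rw [Real.mul_rpow (p.g_pos e).le (Real.exp_pos _).le, ← Real.exp_mul]
  congr 2
  ring

lemma hasDerivAt_exp_mul_zero (a : ℝ) : HasDerivAt (fun t : ℝ => Real.exp (t * a)) a 0 := by
  simpa using ((hasDerivAt_id (0 : ℝ)).mul_const a).exp

lemma hasDerivAt_lenSum (α : ℝ) :
    HasDerivAt (fun t => lenSum α (p.vary h σ hσ t)) (lenSum' α p h) 0 := by
  simp only [lenSum, g_vary_rpow]
  exact HasDerivAt.fun_sum fun e _ => (hasDerivAt_exp_mul_zero _).const_mul _

lemma hasDerivAt_integral_mul_exp {m s : ℝ → ℝ} (hm : Continuous m) (hs : Continuous s) :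
    HasDerivAt (fun t => ∫ x in (0 : ℝ)..1, m x * Real.exp (t * s x))
      (∫ x in (0 : ℝ)..1, m x * s x) 0 := by
  obtain ⟨S, hS⟩ := (isCompact_Icc (a := (0 : ℝ)) (b := 1)).exists_bound_of_continuousOn
    hs.continuousOn
  obtain ⟨M, hM⟩ := (isCompact_Icc (a := (0 : ℝ)) (b := 1)).exists_bound_of_continuousOn
    (hm.mul hs).continuousOn
  have key := intervalIntegral.hasDerivAt_integral_of_dominated_loc_of_deriv_le
    (μ := volume) (a := 0) (b := 1) (F := fun t x => m x * Real.exp (t * s x))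
    (F' := fun t x => m x * (Real.exp (t * s x) * s x)) (x₀ := 0) (s := Metric.ball 0 1)
    (bound := fun _ => M * Real.exp S) (Metric.ball_mem_nhds _ one_pos)
    (Eventually.of_forall fun t => by
      have : Continuous fun x => m x * Real.exp (t * s x) := by fun_prop
      exact this.aestronglyMeasurable)
    (Continuous.intervalIntegrable (by fun_prop) _ _)
    (Continuous.aestronglyMeasurable (by fun_prop)) ?_ (by simp) ?_
  · simpa using key.2
  · refine Eventually.of_forall fun x hx t ht => ?_
    rw [uIoc_of_le zero_le_one] at hx
    have hx' : x ∈ Icc (0 : ℝ) 1 := ⟨hx.1.le, hx.2⟩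
    have h1 : ‖m x * s x‖ ≤ M := hM x hx'
    have h2 := hS x hx'
    rw [Real.norm_eq_abs] at h2
    rw [mem_ball_zero_iff, Real.norm_eq_abs] at ht
    have h3 : t * s x ≤ S := by
      calc t * s x ≤ |t * s x| := le_abs_self _
        _ = |t| * |s x| := abs_mul _ _
        _ ≤ 1 * |s x| := by gcongr
        _ ≤ S := by linarith
    rw [mul_left_comm, norm_mul, mul_comm, Real.norm_of_nonneg (Real.exp_pos _).le]
    exact mul_le_mul h1 (Real.exp_le_exp.2 h3) (Real.exp_pos _).le ((norm_nonneg _).trans h1)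
  · refine Eventually.of_forall fun x _ t _ => ?_
    have := ((hasDerivAt_id t).mul_const (s x)).exp.const_mul (m x)
    simpa using this

lemma integral_weight_vary (t : ℝ) (e : E) : ∫ x in (0 : ℝ)..1, (p.vary h σ hσ t).weight e x =
    ∫ x in (0 : ℝ)..1, p.weight e x * Real.exp (t * σ e x) :=
  intervalIntegral.integral_congr fun x hx => by
    rw [uIcc_of_le zero_le_one] at hx
    exact weight_vary p h hσ t e hx

lemma hasDerivAt_massSum (α : ℝ) :
    HasDerivAt (fun t => massSum α (p.vary h σ hσ t)) (massSum' α p h σ) 0 := by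
  simp only [massSum, g_vary_rpow, integral_weight_vary, mul_assoc]
  refine HasDerivAt.fun_sum fun e _ => HasDerivAt.const_mul _ ?_
  have := (hasDerivAt_exp_mul_zero ((α - 1 / 2) * h e)).mul
    (hasDerivAt_integral_mul_exp (p.weight e).continuous (σ e).continuous)
  convert! this using 1
  simp [mul_assoc]

end MetricDensityPair

/-! ### First-order behaviour of the energy and mass forms -/

namespace MultiGraph

variable {V E : Type*} [Fintype V] [Fintype E] {G : MultiGraph V E}

open Sob MetricDensityPair

lemma alphaNormalisedEigenvalue_eq (α : ℝ) (p : MetricDensityPair E) :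
    G.alphaNormalisedEigenvalue α 1 p = G.eigenvalue 1 p * (lenSum α p * massSum α p) := by
  rw [alphaNormalisedEigenvalue, massSum_eq, lenSum, mul_assoc]

/-- Lets the calculus for general α cover the natural normalisation as well. -/
lemma normalisedEigenvalue_eq (p : MetricDensityPair E) :
    G.normalisedEigenvalue 1 p = G.alphaNormalisedEigenvalue (1 / 2) 1 p := by
  simp only [normalisedEigenvalue, alphaNormalisedEigenvalue, Real.sqrt_eq_rpow]
  norm_num

variable (p : MetricDensityPair E) (h : E → ℝ) {σ : E → C(ℝ, ℝ)} (hσ : ∀ e, ContDiff ℝ ∞ (σ e))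

lemma mass_vary (t : ℝ) : mass G (p.vary h σ hσ t).weight =
    mass G fun e => expWeight (p.weight e) (σ e) t :=
  mass_congr fun e _ hx => weight_vary p h hσ t e hx

lemma hasDerivAt_mass_vary (z y : G.Sob) :
    HasDerivAt (fun t => mass G (p.vary h σ hσ t).weight z y)
      (mass G (fun e => p.weight e * σ e) z y) 0 := by
  simp only [mass_vary, mass_apply]
  refine HasDerivAt.fun_sum fun e _ => ?_
  have hm : Continuous fun x => p.weight e x * val z e x * val y e x := by fun_prop
  convert! hasDerivAt_integral_mul_exp hm (σ e).continuous using 1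
  · funext t
    refine intervalIntegral.integral_congr fun x _ => ?_
    simp only [expWeight_apply]
    ring
  · refine intervalIntegral.integral_congr fun x _ => ?_
    simp only [ContinuousMap.mul_apply]
    ring

lemma hasDerivAt_energy_vary (z y : G.Sob) :
    HasDerivAt (fun t => energy G (p.vary h σ hσ t).cond z y)
      (energy G (fun e => -(h e / 2) * p.cond e) z y) 0 := by
  simp only [energy_apply, cond_vary]
  refine HasDerivAt.fun_sum fun e _ => HasDerivAt.mul_const ?_ _
  have := (hasDerivAt_exp_mul_zero (-(h e / 2))).const_mul (p.cond e)
  convert! this using 1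
  · funext t; congr 2; ring
  · ring

/-- From exp s ≥ 1 + s edge by edge. The bound is uniform in z, as is needed when the
near-minimisers move with t. -/
lemma energy_vary_ge (t : ℝ) (z : G.Sob) :
    energy G p.cond z z + t * energy G (fun e => -(h e / 2) * p.cond e) z z ≤
      energy G (p.vary h σ hσ t).cond z z := by
  simp only [energy_apply, cond_vary, Finset.mul_sum, ← Finset.sum_add_distrib]
  refine Finset.sum_le_sum fun e _ => ?_
  have h1 := Real.add_one_le_exp (-(t * h e / 2))
  have h2 : 0 ≤ p.cond e * inner ℝ (z.1.2 e) (z.1.2 e) :=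
    mul_nonneg (p.cond_pos e).le real_inner_self_nonneg
  nlinarith

/-- From exp s ≤ 1 + s + s² for |s| ≤ 1; the quadratic error is controlled by the unperturbed mass,
again uniformly in z. -/
lemma mass_vary_le {S t : ℝ} (hS : ∀ e, ∀ x ∈ Icc (0 : ℝ) 1, |σ e x| ≤ S) (ht : 0 ≤ t)
    (htS : t * S ≤ 1) (z : G.Sob) :
    mass G (p.vary h σ hσ t).weight z z ≤ mass G p.weight z z +
      t * mass G (fun e => p.weight e * σ e) z z + t ^ 2 * S ^ 2 * mass G p.weight z z := by
  rw [mass_vary]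
  have hlin : mass G p.weight z z + t * mass G (fun e => p.weight e * σ e) z z +
      t ^ 2 * S ^ 2 * mass G p.weight z z =
      mass G (fun e => p.weight e + t • (p.weight e * σ e) + (t ^ 2 * S ^ 2) • p.weight e) z z := by
    simp only [mass_apply, Finset.mul_sum, ← Finset.sum_add_distrib]
    refine Finset.sum_congr rfl fun e _ => ?_
    rw [← intervalIntegral.integral_const_mul, ← intervalIntegral.integral_const_mul,
      ← intervalIntegral.integral_add, ← intervalIntegral.integral_add]
    · refine intervalIntegral.integral_congr fun x _ => ?_
      simp only [ContinuousMap.add_apply, ContinuousMap.smul_apply, ContinuousMap.mul_apply,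
        smul_eq_mul]
      ring
    all_goals exact Continuous.intervalIntegrable (by fun_prop) _ _
  rw [hlin]
  refine mass_mono (fun e x hx => ?_) z
  simp only [ContinuousMap.add_apply, ContinuousMap.smul_apply, ContinuousMap.mul_apply,
    smul_eq_mul, expWeight_apply]
  have h1 : |t * σ e x| ≤ t * S := by
    rw [abs_mul, abs_of_nonneg ht]
    exact mul_le_mul_of_nonneg_left (hS e x hx) ht
  have h2 := (abs_le.1 (Real.abs_exp_sub_one_sub_id_le (h1.trans htS))).2
  have h3 : (t * σ e x) ^ 2 ≤ (t * S) ^ 2 := by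
    rw [← sq_abs]; gcongr
  have h4 := (p.weight_pos e x hx).le
  nlinarith [mul_le_mul_of_nonneg_left h2 h4, mul_le_mul_of_nonneg_left h3 h4]

variable (G) in
/-- The derivative of the logarithm of the `α`-normalised eigenvalue, up to the factor `μ`, as a
quadratic form in the eigenfunction. -/
def variation (α μ : ℝ) (p : MetricDensityPair E) (h : E → ℝ) (σ : E → C(ℝ, ℝ)) :
    LinearMap.BilinForm ℝ G.Sob :=
  energy G (fun e => -(h e / 2) * p.cond e) - μ • mass G (fun e => p.weight e * σ e) +
    (μ * (lenSum' α p h / lenSum α p + massSum' α p h σ / massSum α p)) • mass G p.weight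

lemma variation_apply (α μ : ℝ) (z y : G.Sob) : variation G α μ p h σ z y =
    energy G (fun e => -(h e / 2) * p.cond e) z y - μ * mass G (fun e => p.weight e * σ e) z y +
    (μ * (lenSum' α p h / lenSum α p + massSum' α p h σ / massSum α p)) * mass G p.weight z y := rfl

end MultiGraph

/-! ### One-sided derivatives of the eigenvalue, and extremality -/

namespace MultiGraph

variable {V E : Type*} [Fintype V] [Fintype E] {G : MultiGraph V E}

open Sob MetricDensityPair

lemma IsConn.nonempty_edges (hG : G.IsConn) : Nonempty E := by
  obtain ⟨v, -⟩ := hG.nontrivial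
  exact ⟨(hG.incident v).choose⟩

variable {p : MetricDensityPair E} {h : E → ℝ} {σ : E → C(ℝ, ℝ)} (hσ : ∀ e, ContDiff ℝ ∞ (σ e))

/-- Testing with an eigenfunction: a differentiable upper bound along a variation. -/
lemma exists_upper_bound (hG : G.IsConn) (α : ℝ) {f : G.Sob}
    (hf : f ∈ eigenspace G p.cond p.weight (G.eigenvalue 1 p)) (hf1 : mass G p.weight f f = 1) :
    ∃ U : ℝ → ℝ, U 0 = G.alphaNormalisedEigenvalue α 1 p ∧
      HasDerivAt U (lenSum α p * massSum α p *
        variation G α (G.eigenvalue 1 p) p h σ f f) 0 ∧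
      ∀ᶠ t in 𝓝 0, G.alphaNormalisedEigenvalue α 1 (p.vary h σ hσ t) ≤ U t := by
  have hE : Nonempty E := hG.nonempty_edges
  have h10 : (1 : G.Sob) ≠ 0 := one_ne_zero_of_edges hE
  have hA := lenSum_pos p α
  have hB := massSum_pos p α
  have hf0 := mass_one_eq_zero (eigenvalue_one_pos hG p).ne' hf
  have hfE : energy G p.cond f f = G.eigenvalue 1 p := by
    rw [mem_eigenspace.1 hf f, hf1, mul_one]
  have hm1 := mass_pos p.weight_pos hG.incident h10
  -- The mass of f after subtracting its mean for the weight at time t. That mean vanishes at t = 0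
  -- and enters squared, so it does not affect the first derivative.
  set Va : ℝ → ℝ := fun t => mass G (p.vary h σ hσ t).weight f f -
    mass G (p.vary h σ hσ t).weight f 1 ^ 2 / mass G (p.vary h σ hσ t).weight 1 1 with hVa
  have hV0 : Va 0 = 1 := by simp [hVa, vary_zero, hf0, hf1]
  have hVd : HasDerivAt Va (mass G (fun e => p.weight e * σ e) f f) 0 := by
    have := (hasDerivAt_mass_vary p h hσ f f).sub
      (((hasDerivAt_mass_vary p h hσ f 1).pow 2).div (hasDerivAt_mass_vary p h hσ 1 1)
        (by rw [vary_zero]; exact hm1.ne'))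
    convert! this using 1
    simp [vary_zero, hf0]
  set U : ℝ → ℝ := fun t => lenSum α (p.vary h σ hσ t) * massSum α (p.vary h σ hσ t) *
    energy G (p.vary h σ hσ t).cond f f / Va t with hU
  refine ⟨U, ?_, ?_, ?_⟩
  · rw [alphaNormalisedEigenvalue_eq]
    simp only [hU, hV0, vary_zero, hfE]
    ring
  · have := ((((hasDerivAt_lenSum p h hσ α).mul (hasDerivAt_massSum p h hσ α)).mul
      (hasDerivAt_energy_vary p h hσ f f)).div hVd (by rw [hV0]; exact one_ne_zero))
    convert! this using 1
    simp only [hV0, vary_zero, variation_apply, hf1, hfE, Pi.mul_apply]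
    field_simp
    ring
  · have hpos : ∀ᶠ t in 𝓝 (0 : ℝ), 0 < Va t :=
      hVd.continuousAt.eventually_const_lt (by rw [hV0]; exact one_pos)
    filter_upwards [hpos] with t ht
    have hA' := lenSum_pos (p.vary h σ hσ t) α
    have hB' := massSum_pos (p.vary h σ hσ t) α
    rw [alphaNormalisedEigenvalue_eq, hU, le_div_iff₀ ht]
    have hmt := mass_pos (p.vary h σ hσ t).weight_pos hG.incident h10
    set w := (p.vary h σ hσ t).weight with hw
    have hP := eigenvalue_one_mul_mass_le hG.incident (p.vary h σ hσ t)
      (z := f - (mass G w f 1 / mass G w 1 1) • (1 : G.Sob)) (by simp [← hw, hmt.ne'])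
    have e1 : energy G (p.vary h σ hσ t).cond (f - (mass G w f 1 / mass G w 1 1) • (1 : G.Sob))
        (f - (mass G w f 1 / mass G w 1 1) • (1 : G.Sob)) =
        energy G (p.vary h σ hσ t).cond f f := by
      simp [energy_one, energy_comm _ 1]
    have e2 : mass G w (f - (mass G w f 1 / mass G w 1 1) • (1 : G.Sob))
        (f - (mass G w f 1 / mass G w 1 1) • (1 : G.Sob)) = Va t := by
      change _ = mass G w f f - mass G w f 1 ^ 2 / mass G w 1 1
      simp only [map_sub, map_smul, LinearMap.sub_apply, LinearMap.smul_apply, smul_eq_mul,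
        mass_comm w 1 f]
      field_simp
      ring
    rw [e1, ← hw, e2] at hP
    calc _ = lenSum α (p.vary h σ hσ t) * massSum α (p.vary h σ hσ t) *
        (G.eigenvalue 1 (p.vary h σ hσ t) * Va t) := by ring
      _ ≤ _ := by gcongr

/-- If the variation is positive on all eigenfunctions, then the functional has a positive lower
right derivative. -/
lemma not_eventually_le_of_variation_pos (hG : G.IsConn) (α : ℝ)
    (hpos : ∀ f ∈ eigenspace G p.cond p.weight (G.eigenvalue 1 p), f ≠ 0 →
      0 < variation G α (G.eigenvalue 1 p) p h σ f f)
    {r : ℝ → ℝ} (hr : r =o[𝓝 0] fun t => t) :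
    ¬ ∀ᶠ t in 𝓝 0, G.alphaNormalisedEigenvalue α 1 (p.vary h σ hσ t) ≤
      G.alphaNormalisedEigenvalue α 1 p + r t := by
  intro hle
  have hE : Nonempty E := hG.nonempty_edges
  have hA := lenSum_pos p α
  have hB := massSum_pos p α
  set lam := G.eigenvalue 1 p with hlam
  have hlam0 : 0 < lam := eigenvalue_one_pos hG p
  have hP := fun z (hz : mass G p.weight z 1 = 0) => eigenvalue_one_mul_mass_le hG.incident p hz
  rw [← hlam] at hP
  obtain ⟨S, hS0, hS⟩ := exists_abs_le σ
  set H := ∑ e, |h e| with hH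
  have hH0 : 0 ≤ H := Finset.sum_nonneg fun e _ => abs_nonneg _
  -- The extra t² makes the assumed bound on the eigenvalue strict for t > 0 without changing the
  -- derivative at 0.
  set M : ℝ → ℝ := fun t => (G.alphaNormalisedEigenvalue α 1 p + r t + t ^ 2) /
    (lenSum α (p.vary h σ hσ t) * massSum α (p.vary h σ hσ t)) with hM
  have hr0 : r 0 = 0 := by
    have := hr.def (c := 1) one_pos
    simpa using this.self_of_nhds
  have hM0 : M 0 = lam := by
    simp only [hM, hr0, vary_zero, alphaNormalisedEigenvalue_eq]
    field_simp
    ring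
  have hMd : HasDerivAt M (-(lam * (lenSum' α p h / lenSum α p +
      massSum' α p h σ / massSum α p))) 0 := by
    have hrd : HasDerivAt r 0 0 := by
      rw [hasDerivAt_iff_isLittleO]
      simpa [hr0] using hr
    have hsq : HasDerivAt (fun t : ℝ => t ^ 2) 0 0 := by
      simpa using hasDerivAt_pow 2 (0 : ℝ)
    have := (((hrd.const_add (G.alphaNormalisedEigenvalue α 1 p)).add hsq).div
      ((hasDerivAt_lenSum p h hσ α).mul (hasDerivAt_massSum p h hσ α)) (by
        simp only [vary_zero, Pi.mul_apply]; positivity))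
    convert! this using 1
    simp only [vary_zero, Pi.mul_apply, Pi.add_apply, hr0, alphaNormalisedEigenvalue_eq, ← hlam]
    field_simp
    ring
  obtain ⟨δ, hδ, hball⟩ := Metric.eventually_nhds_iff.1 hle
  set d := min δ (min (1 / (S + 1)) (1 / (H + 1))) with hd
  have hd0 : 0 < d := by positivity
  set t : ℕ → ℝ := fun n => d / (n + 2) with ht
  have ht0 (n : ℕ) : 0 < t n := by positivity
  have htd (n : ℕ) : t n < d := by
    rw [ht, div_lt_iff₀ (by positivity)]
    nlinarith [(Nat.cast_nonneg n : (0 : ℝ) ≤ n)]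
  have htlim : Tendsto t atTop (𝓝 0) := by
    have : Tendsto (fun n : ℕ => (n : ℝ) + 2) atTop atTop :=
      tendsto_atTop_add_const_right _ _ tendsto_natCast_atTop_atTop
    exact this.const_div_atTop d
  have htS (n : ℕ) : t n * S ≤ 1 := by
    have h1 : t n ≤ 1 / (S + 1) :=
      (htd n).le.trans ((min_le_right _ _).trans (min_le_left _ _))
    rw [le_div_iff₀ (by positivity)] at h1
    linarith [ht0 n]
  have htH (n : ℕ) : t n * H ≤ 1 := by
    have h1 : t n ≤ 1 / (H + 1) :=
      (htd n).le.trans ((min_le_right _ _).trans (min_le_right _ _))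
    rw [le_div_iff₀ (by positivity)] at h1
    linarith [ht0 n]
  have hMt : Tendsto (fun n => M (t n)) atTop (𝓝 lam) := by
    rw [← hM0]
    exact hMd.continuousAt.tendsto.comp htlim
  have hlt (n : ℕ) : G.eigenvalue 1 (p.vary h σ hσ (t n)) < M (t n) := by
    have hA' := lenSum_pos (p.vary h σ hσ (t n)) α
    have hB' := massSum_pos (p.vary h σ hσ (t n)) α
    rw [hM, lt_div_iff₀ (by positivity), ← alphaNormalisedEigenvalue_eq]
    have := hball (y := t n) (by
      rw [Real.dist_eq, sub_zero, abs_of_pos (ht0 n)]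
      exact (htd n).trans_le (min_le_left _ _))
    have h2 : 0 < t n ^ 2 := pow_pos (ht0 n) 2
    linarith
  -- M exceeds the eigenvalue at time tₙ, so the Poincaré inequality with constant M fails there.
  -- The offending functions are normalised for the unperturbed weight, so that compactness applies
  -- to them.
  have hex (n : ℕ) := exists_normalised hG (c := (p.vary h σ hσ (t n)).cond) (μ := M (t n))
    (p.vary h σ hσ (t n)).weight_pos (fun hcon => absurd (le_eigenvalue_one hG.incident _
      (exists_ne_zero_mass_one_eq_zero hG (p.vary h σ hσ (t n)).weight_pos) hcon)
        (not_le.2 (hlt n))) p.weight_pos ((eigenvalue_one_nonneg hG _).trans (hlt n).le)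
  choose z hz1 hzm hz using hex
  have hMpos (n : ℕ) : 0 ≤ M (t n) := (eigenvalue_one_nonneg hG _).trans (hlt n).le
  have hE0 (n : ℕ) : lam ≤ energy G p.cond (z n) (z n) := by
    simpa [hzm n] using hP (z n) (hz1 n)
  have hmain (n : ℕ) : energy G p.cond (z n) (z n) +
      t n * energy G (fun e => -(h e / 2) * p.cond e) (z n) (z n) ≤
      M (t n) * (1 + t n * mass G (fun e => p.weight e * σ e) (z n) (z n) + t n ^ 2 * S ^ 2) := by
    refine (energy_vary_ge p h hσ (t n) (z n)).trans ((hz n).le.trans ?_)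
    have := mass_vary_le p h hσ hS (ht0 n).le (htS n) (z n)
    rw [hzm n, mul_one] at this
    exact mul_le_mul_of_nonneg_left this (hMpos n)
  have hE' (y : G.Sob) : -(H / 2) * energy G p.cond y y ≤
      energy G (fun e => -(h e / 2) * p.cond e) y y := by
    simp only [energy_apply, Finset.mul_sum]
    refine Finset.sum_le_sum fun e _ => ?_
    have h1 : h e ≤ H := (le_abs_self _).trans
      (Finset.single_le_sum (f := fun e => |h e|) (fun e _ => abs_nonneg _) (Finset.mem_univ e))
    have h2 : 0 ≤ p.cond e * inner ℝ (y.1.2 e) (y.1.2 e) :=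
      mul_nonneg (p.cond_pos e).le real_inner_self_nonneg
    nlinarith
  have hN' (n : ℕ) : mass G (fun e => p.weight e * σ e) (z n) (z n) ≤ S := by
    have : mass G (fun e => p.weight e * σ e) (z n) (z n) ≤
        mass G (fun e => p.weight e * ContinuousMap.const ℝ S) (z n) (z n) := by
      refine mass_mono (fun e x hx => ?_) _
      simp only [ContinuousMap.mul_apply, ContinuousMap.const_apply]
      exact mul_le_mul_of_nonneg_left ((le_abs_self _).trans (hS e x hx)) (p.weight_pos e x hx).le
    refine this.trans_eq ?_
    have h2 : mass G (fun e => p.weight e * ContinuousMap.const ℝ S) (z n) (z n) =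
        S * mass G p.weight (z n) (z n) := by
      simp only [mass_apply, Finset.mul_sum, ← intervalIntegral.integral_const_mul]
      refine Finset.sum_congr rfl fun e _ => intervalIntegral.integral_congr fun x _ => ?_
      simp only [ContinuousMap.mul_apply, ContinuousMap.const_apply]
      ring
    rw [h2, hzm n, mul_one]
  -- The perturbation of the energy is absorbed through the factor 1 − tH/2, so zₙ is a minimising
  -- sequence of the unperturbed problem.
  have hElim : Tendsto (fun n => energy G p.cond (z n) (z n)) atTop (𝓝 lam) := by
    refine tendsto_of_tendsto_of_tendsto_of_le_of_le tendsto_const_nhds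
      (h := fun n => M (t n) * (1 + t n * S + t n ^ 2 * S ^ 2) / (1 - t n * H / 2)) ?_ hE0
      fun n => ?_
    · have h1 : Tendsto (fun n => M (t n) * (1 + t n * S + t n ^ 2 * S ^ 2) / (1 - t n * H / 2))
          atTop (𝓝 (lam * (1 + 0 * S + 0 ^ 2 * S ^ 2) / (1 - 0 * H / 2))) :=
        (hMt.mul ((tendsto_const_nhds.add (htlim.mul_const S)).add
          ((htlim.pow 2).mul_const _))).div
          (tendsto_const_nhds.sub ((htlim.mul_const H).div_const 2)) (by norm_num)
      simpa using h1
    · have h1 := hmain n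
      have h2 := hE' (z n)
      have h3 := hN' n
      have h4 := htH n
      change _ ≤ M (t n) * (1 + t n * S + t n ^ 2 * S ^ 2) / (1 - t n * H / 2)
      rw [le_div_iff₀ (by linarith)]
      have h5 := mul_le_mul_of_nonneg_left h2 (ht0 n).le
      have h6 := mul_le_mul_of_nonneg_left (mul_le_mul_of_nonneg_left h3 (ht0 n).le) (hMpos n)
      linarith
  obtain ⟨φ, hφ, y, hy, hyW, hym, -⟩ :=
    exists_tendsto_eigenspace hG p.cond_pos p.weight_pos hP z hz1 hzm hElim
  have hy0 : y ≠ 0 := by rintro rfl; simp at hym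
  have hQ := hpos y hyW hy0
  rw [variation_apply, hym, mul_one] at hQ
  have hslope : Tendsto (fun n => (M (t n) - lam) / t n) atTop (𝓝 (-(lam *
      (lenSum' α p h / lenSum α p + massSum' α p h σ / massSum α p)))) := by
    have h1 := (hasDerivAt_iff_tendsto_slope_zero.1 hMd)
    have h2 : Tendsto t atTop (𝓝[≠] 0) :=
      tendsto_nhdsWithin_iff.2 ⟨htlim, Eventually.of_forall fun n => (ht0 n).ne'⟩
    refine (h1.comp h2).congr fun n => ?_
    simp only [Function.comp_apply, zero_add, hM0, smul_eq_mul]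
    rw [div_eq_inv_mul]
  have hφt := hφ.tendsto_atTop
  have hlimN := ((continuous_mass_self (G := G) (fun e => p.weight e * σ e)).tendsto y).comp hy
  have hlimE := ((continuous_energy_self (G := G)
    (fun e => -(h e / 2) * p.cond e)).tendsto y).comp hy
  -- The inequality `hmain`, with λ ≤ E(zₙ), divided by tₙ and passed to the limit: the variation at
  -- the limit eigenfunction is not positive.
  have hfin := le_of_tendsto_of_tendsto hlimE
    (((hslope.comp hφt).add ((hMt.comp hφt).mul hlimN)).add
      (((hMt.comp hφt).mul (htlim.comp hφt)).mul_const (S ^ 2))) (Eventually.of_forall fun k => ?_)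
  · simp only [mul_zero, zero_mul, add_zero] at hfin
    linarith
  · simp only [Function.comp_apply]
    have h1 := hmain (φ k)
    have h2 := hE0 (φ k)
    have h3 := ht0 (φ k)
    refine le_of_mul_le_mul_left ?_ h3
    have h4 : t (φ k) * ((M (t (φ k)) - lam) / t (φ k)) = M (t (φ k)) - lam :=
      mul_div_cancel₀ _ h3.ne'
    rw [mul_add, mul_add, h4]
    linarith

/-- The set of variations, as forms on the eigenspace. -/
def variations (G : MultiGraph V E) (α μ : ℝ) (p : MetricDensityPair E) (W : Submodule ℝ G.Sob) :
    Submodule ℝ (LinearMap.BilinForm ℝ W) where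
  carrier := {B | ∃ (h : E → ℝ) (σ : E → C(ℝ, ℝ)), (∀ e, ContDiff ℝ ∞ (σ e)) ∧
    ∀ x y : W, B x y = variation G α μ p h σ x y}
  zero_mem' := ⟨0, 0, fun _ => contDiff_const, fun x y => by
    simp [variation_apply, energy_apply, mass_apply, lenSum', massSum']⟩
  add_mem' := by
    rintro B B' ⟨h, σ, hσ, hB⟩ ⟨h', σ', hσ', hB'⟩
    refine ⟨h + h', σ + σ', fun e => (hσ e).add (hσ' e), fun x y => ?_⟩
    rw [LinearMap.add_apply, LinearMap.add_apply, hB, hB']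
    simp only [variation_apply]
    have e1 : energy G (fun e => -((h + h') e / 2) * p.cond e) x.1 y.1 =
        energy G (fun e => -(h e / 2) * p.cond e) x.1 y.1 +
        energy G (fun e => -(h' e / 2) * p.cond e) x.1 y.1 := by
      simp only [energy_apply, ← Finset.sum_add_distrib, Pi.add_apply]
      exact Finset.sum_congr rfl fun e _ => by ring
    have e2 : mass G (fun e => p.weight e * (σ + σ') e) x.1 y.1 =
        mass G (fun e => p.weight e * σ e) x.1 y.1 +
        mass G (fun e => p.weight e * σ' e) x.1 y.1 := by
      simp only [mass_apply, ← Finset.sum_add_distrib]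
      refine Finset.sum_congr rfl fun e _ => ?_
      rw [← intervalIntegral.integral_add (intervalIntegrable_mul_val_mul_val ..)
        (intervalIntegrable_mul_val_mul_val ..)]
      refine intervalIntegral.integral_congr fun t _ => ?_
      simp only [ContinuousMap.mul_apply, Pi.add_apply, ContinuousMap.add_apply]
      ring
    have e3 : lenSum' α p (h + h') = lenSum' α p h + lenSum' α p h' := by
      simp only [lenSum', ← Finset.sum_add_distrib, Pi.add_apply]
      exact Finset.sum_congr rfl fun e _ => by ring
    have e4 : massSum' α p (h + h') (σ + σ') = massSum' α p h σ + massSum' α p h' σ' := by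
      simp only [massSum', ← Finset.sum_add_distrib, Pi.add_apply]
      refine Finset.sum_congr rfl fun e _ => ?_
      have : ∫ x in (0 : ℝ)..1, p.weight e x * (σ e + σ' e) x =
          (∫ x in (0 : ℝ)..1, p.weight e x * σ e x) +
            ∫ x in (0 : ℝ)..1, p.weight e x * σ' e x := by
        rw [← intervalIntegral.integral_add (Continuous.intervalIntegrable (by fun_prop) _ _)
          (Continuous.intervalIntegrable (by fun_prop) _ _)]
        refine intervalIntegral.integral_congr fun t _ => ?_
        simp only [ContinuousMap.add_apply]
        ring
      rw [this]
      ring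
    rw [e1, e2, e3, e4]
    ring
  smul_mem' := by
    rintro a B ⟨h, σ, hσ, hB⟩
    refine ⟨a • h, a • σ, fun e => contDiff_const.mul (hσ e), fun x y => ?_⟩
    rw [LinearMap.smul_apply, LinearMap.smul_apply, hB]
    simp only [variation_apply, smul_eq_mul]
    have e1 : energy G (fun e => -((a • h) e / 2) * p.cond e) x.1 y.1 =
        a * energy G (fun e => -(h e / 2) * p.cond e) x.1 y.1 := by
      simp only [energy_apply, Finset.mul_sum, Pi.smul_apply, smul_eq_mul]
      exact Finset.sum_congr rfl fun e _ => by ring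
    have e2 : mass G (fun e => p.weight e * (a • σ) e) x.1 y.1 =
        a * mass G (fun e => p.weight e * σ e) x.1 y.1 := by
      simp only [mass_apply, Finset.mul_sum, ← intervalIntegral.integral_const_mul]
      refine Finset.sum_congr rfl fun e _ => intervalIntegral.integral_congr fun t _ => ?_
      simp only [ContinuousMap.mul_apply, Pi.smul_apply, ContinuousMap.smul_apply, smul_eq_mul]
      ring
    have e3 : lenSum' α p (a • h) = a * lenSum' α p h := by
      simp only [lenSum', Finset.mul_sum, Pi.smul_apply, smul_eq_mul]
      exact Finset.sum_congr rfl fun e _ => by ring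
    have e4 : massSum' α p (a • h) (a • σ) = a * massSum' α p h σ := by
      simp only [massSum', Finset.mul_sum, Pi.smul_apply, smul_eq_mul]
      refine Finset.sum_congr rfl fun e _ => ?_
      have : ∫ x in (0 : ℝ)..1, p.weight e x * (a • σ e) x =
          a * ∫ x in (0 : ℝ)..1, p.weight e x * σ e x := by
        rw [← intervalIntegral.integral_const_mul]
        refine intervalIntegral.integral_congr fun t _ => ?_
        simp only [ContinuousMap.smul_apply, smul_eq_mul]
        ring
      rw [this]
      ring
    rw [e1, e2, e3, e4]
    ring

/-- At an extremal pair, some family of eigenfunctions has vanishing total variation. -/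
theorem exists_family_of_isExtremal (hG : G.IsConn) {α : ℝ}
    (hp : IsExtremal (G.alphaNormalisedEigenvalue α 1) p) :
    ∃ (n : ℕ) (f : Fin n → G.Sob),
      (∀ i, f i ∈ eigenspace G p.cond p.weight (G.eigenvalue 1 p)) ∧ (∃ i, f i ≠ 0) ∧
      ∀ (h : E → ℝ) (σ : E → C(ℝ, ℝ)), (∀ e, ContDiff ℝ ∞ (σ e)) →
        ∑ i, variation G α (G.eigenvalue 1 p) p h σ (f i) (f i) = 0 := by
  have hP := fun z (hz : mass G p.weight z 1 = 0) => eigenvalue_one_mul_mass_le hG.incident p hz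
  have hfin := finiteDimensional_eigenspace hG p.cond_pos (eigenvalue_one_pos hG p).ne' hP
  obtain ⟨y, hy, hym, -⟩ := exists_eigenfunction hG p
  have hy0 : y ≠ 0 := by rintro rfl; simp at hym
  have hnt : Nontrivial (eigenspace G p.cond p.weight (G.eigenvalue 1 p)) :=
    ⟨⟨⟨y, hy⟩, 0, fun h => hy0 (congrArg Subtype.val h)⟩⟩
  rcases exists_pos_or_exists_sum_eq_zero (variations G α (G.eigenvalue 1 p) p
    (eigenspace G p.cond p.weight (G.eigenvalue 1 p))) with ⟨B, ⟨h, σ, hσ, hB⟩, hpos⟩ | hsum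
  · exfalso
    have hpos' : ∀ f ∈ eigenspace G p.cond p.weight (G.eigenvalue 1 p), f ≠ 0 →
        0 < variation G α (G.eigenvalue 1 p) p h σ f f := fun f hf hf0 => by
      have := hpos ⟨f, hf⟩ fun h => hf0 (congrArg Subtype.val h)
      rwa [hB] at this
    -- A form positive on the whole eigenspace defeats both alternatives: the first fails for t > 0,
    -- and the second for t < 0, where U has positive slope and bounds the functional above.
    rcases hp 1 (p.vary h σ hσ) one_pos (isSmoothFamily_vary p h hσ) (vary_zero p h hσ) with
      ⟨r, hr, hle⟩ | ⟨r, hr, hle⟩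
    · exact not_eventually_le_of_variation_pos hσ hG α hpos' hr hle
    · obtain ⟨U, hU0, hUd, hU⟩ := exists_upper_bound (h := h) hσ hG α hy hym
      have hE : Nonempty E := hG.nonempty_edges
      have hd : 0 < lenSum α p * massSum α p * variation G α (G.eigenvalue 1 p) p h σ y y :=
        mul_pos (mul_pos (lenSum_pos p α) (massSum_pos p α)) (hpos' y hy hy0)
      have hr0 : r 0 = 0 := by
        have := hr.def (c := 1) one_pos
        simpa using this.self_of_nhds
      have hrd : HasDerivAt r 0 0 := by
        rw [hasDerivAt_iff_isLittleO]
        simpa [hr0] using hr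
      have hUr := hUd.sub hrd
      have hmin : IsLocalMin (U - r) 0 := by
        filter_upwards [hle, hU] with t h1 h2
        simp only [Pi.sub_apply, hU0, hr0, sub_zero]
        linarith
      have := hmin.hasDerivAt_eq_zero hUr
      linarith
  · obtain ⟨n, f, ⟨i, hi⟩, hf⟩ := hsum
    refine ⟨n, fun i => f i, fun i => (f i).2, ⟨i, fun h => hi (Subtype.ext h)⟩,
      fun h σ hσ => ?_⟩
    refine hf ((variation G α (G.eigenvalue 1 p) p h σ).restrict _) ⟨h, σ, hσ, fun x y => rfl⟩

/-- At a minimiser, the variation of every eigenfunction vanishes. -/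
theorem variation_eq_zero_of_isMinimiser (hσ : ∀ e, ContDiff ℝ ∞ (σ e)) (hG : G.IsConn) {α : ℝ}
    (hp : IsMinimiser (G.alphaNormalisedEigenvalue α 1) p) {f : G.Sob}
    (hf : f ∈ eigenspace G p.cond p.weight (G.eigenvalue 1 p)) (hf1 : mass G p.weight f f = 1) :
    variation G α (G.eigenvalue 1 p) p h σ f f = 0 := by
  have hE : Nonempty E := hG.nonempty_edges
  obtain ⟨U, hU0, hUd, hU⟩ := exists_upper_bound (h := h) hσ hG α hf hf1
  -- U lies above the functional and touches it at the minimiser. Since any eigenfunction may define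
  -- U, no simplicity of the eigenvalue is needed.
  have hmin : IsLocalMin U 0 := by
    filter_upwards [hU] with t ht
    rw [hU0]
    exact (hp _).trans ht
  have := hmin.hasDerivAt_eq_zero hUd
  have hA := lenSum_pos p α
  have hB := massSum_pos p α
  simpa [hA.ne', hB.ne'] using this

end MultiGraph

/-! ### Euler–Lagrange equations; no minimiser for the natural normalisation -/

/-- A continuous function orthogonal to all smooth functions on an interval vanishes on it. -/
lemma eq_zero_of_forall_integral_mul_smooth {m : ℝ → ℝ} (hm : Continuous m)
    (h : ∀ s : C(ℝ, ℝ), ContDiff ℝ ∞ s → ∫ x in (0 : ℝ)..1, m x * s x = 0) {x : ℝ}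
    (hx : x ∈ Icc (0 : ℝ) 1) : m x = 0 := by
  have hae : ∀ᵐ x ∂volume, x ∈ Ioo (0 : ℝ) 1 → m x = 0 := by
    refine isOpen_Ioo.ae_eq_zero_of_integral_contDiff_smul_eq_zero
      (hm.locallyIntegrable.locallyIntegrableOn _) fun s hs _ hsupp => ?_
    rw [← h ⟨s, hs.continuous⟩ hs, intervalIntegral.integral_of_le zero_le_one,
      integral_Ioc_eq_integral_Ioo, ← integral_indicator measurableSet_Ioo]
    refine integral_congr_ae (Eventually.of_forall fun y => ?_)
    by_cases hy : y ∈ Ioo (0 : ℝ) 1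
    · simp [indicator_of_mem hy, mul_comm]
    · have : s y = 0 := image_eq_zero_of_notMem_tsupport fun hy' => hy (hsupp hy')
      simp [indicator_of_notMem hy, this]
  have heq : EqOn m (fun _ => 0) (Ioo 0 1) :=
    Measure.eqOn_open_of_ae_eq ((ae_restrict_iff' measurableSet_Ioo).2 hae) isOpen_Ioo
      hm.continuousOn continuousOn_const
  have := heq.closure hm continuous_const
  rw [closure_Ioo zero_ne_one] at this
  exact this hx

namespace MultiGraph

variable {V E : Type*} [Fintype V] [Fintype E] {G : MultiGraph V E}

open Sob MetricDensityPair

variable {p : MetricDensityPair E} {ι : Type*} [Fintype ι]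

/-- Vanishing variation of the density: the sum of the squares is constant on the edges. -/
lemma sum_val_sq_eq (hG : G.IsConn) {α : ℝ} {f : ι → G.Sob}
    (hvar : ∀ (h : E → ℝ) (σ : E → C(ℝ, ℝ)), (∀ e, ContDiff ℝ ∞ (σ e)) →
      ∑ i, variation G α (G.eigenvalue 1 p) p h σ (f i) (f i) = 0)
    (e : E) {x : ℝ} (hx : x ∈ Icc (0 : ℝ) 1) :
    ∑ i, val (f i) e x ^ 2 =
      (∑ i, mass G p.weight (f i) (f i)) * p.g e ^ (α - 1 / 2) / massSum α p := by
  classical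
  have hlam := eigenvalue_one_pos hG p
  set κ := ∑ i, mass G p.weight (f i) (f i) with hκ
  set K := κ * p.g e ^ (α - 1 / 2) / massSum α p with hK
  have key := eq_zero_of_forall_integral_mul_smooth
    (m := fun x => p.weight e x * (∑ i, val (f i) e x ^ 2 - K)) (by fun_prop) (fun s hs => ?_) hx
  · have := (p.weight_pos e x hx).ne'
    have h2 := (mul_eq_zero.1 key).resolve_left this
    linarith
  · have hσ (e' : E) : ContDiff ℝ ∞ ((Pi.single e s : E → C(ℝ, ℝ)) e') := by
      rcases eq_or_ne e' e with rfl | h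
      · simpa using hs
      · rw [Pi.single_eq_of_ne h]; exact contDiff_const
    have h1 := hvar 0 (Pi.single e s) hσ
    have hmass (i : ι) : mass G (fun e' => p.weight e' * (Pi.single e s : E → C(ℝ, ℝ)) e')
        (f i) (f i) = ∫ x in (0 : ℝ)..1, p.weight e x * s x * val (f i) e x ^ 2 := by
      rw [mass_apply, Finset.sum_eq_single e (fun e' _ h => by rw [Pi.single_eq_of_ne h]; simp)
        (by simp)]
      refine intervalIntegral.integral_congr fun x _ => ?_
      simp only [Pi.single_eq_same, ContinuousMap.mul_apply]
      ring
    have hB : massSum' α p 0 (Pi.single e s) =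
        p.g e ^ (α - 1 / 2) * ∫ x in (0 : ℝ)..1, p.weight e x * s x := by
      rw [massSum', Finset.sum_eq_single e (fun e' _ h => by rw [Pi.single_eq_of_ne h]; simp)
        (by simp)]
      simp
    simp only [variation_apply, hmass, hB] at h1
    have hA : lenSum' α p (0 : E → ℝ) = 0 := by simp [lenSum']
    have hE (i : ι) : energy G (fun e => -((0 : E → ℝ) e / 2) * p.cond e) (f i) (f i) = 0 := by
      simp [energy_apply]
    simp only [hA, hE, zero_div, zero_add, zero_sub, Finset.sum_add_distrib,
      Finset.sum_neg_distrib, ← Finset.mul_sum, ← hκ] at h1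
    have hsum : ∫ x in (0 : ℝ)..1, p.weight e x * (∑ i, val (f i) e x ^ 2 - K) * s x =
        (∑ i, ∫ x in (0 : ℝ)..1, p.weight e x * s x * val (f i) e x ^ 2) -
          K * ∫ x in (0 : ℝ)..1, p.weight e x * s x := by
      rw [← intervalIntegral.integral_finsetSum fun i _ =>
        Continuous.intervalIntegrable (by fun_prop) _ _, ← intervalIntegral.integral_const_mul,
        ← intervalIntegral.integral_sub (Continuous.intervalIntegrable (by fun_prop) _ _)
          (Continuous.intervalIntegrable (by fun_prop) _ _)]
      refine intervalIntegral.integral_congr fun x _ => ?_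
      simp only [← Finset.mul_sum]
      ring
    have h2 : G.eigenvalue 1 p *
        ((∑ i, ∫ x in (0 : ℝ)..1, p.weight e x * s x * val (f i) e x ^ 2) -
          K * ∫ x in (0 : ℝ)..1, p.weight e x * s x) = 0 := by
      rw [hK]
      linear_combination -h1
    rw [hsum]
    exact (mul_eq_zero.1 h2).resolve_left hlam.ne'

/-- Consequences of the eigenvalue equation when the sum of the squares is constant. -/
lemma sum_deriv_sq_eq {c lam k : ℝ} {w : ℝ → ℝ} {F v : ι → ℝ → ℝ}
    (hF : ∀ i, ∀ x ∈ Icc (0 : ℝ) 1, HasDerivWithinAt (F i) (v i x) (Icc 0 1) x)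
    (hv : ∀ i x, HasDerivAt (v i) (-(lam / c) * (w x * F i x)) x)
    (hk : ∀ x ∈ Icc (0 : ℝ) 1, ∑ i, F i x ^ 2 = k) {x : ℝ} (hx : x ∈ Icc (0 : ℝ) 1) :
    ∑ i, F i x * v i x = 0 ∧ ∑ i, v i x ^ 2 = lam / c * (w x * k) := by
  have hu := uniqueDiffOn_Icc (zero_lt_one (α := ℝ))
  have h1 (x : ℝ) (hx : x ∈ Icc (0 : ℝ) 1) : ∑ i, F i x * v i x = 0 := by
    have hd : HasDerivWithinAt (fun x => ∑ i, F i x ^ 2) (∑ i, 2 * (F i x * v i x)) (Icc 0 1) x :=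
      HasDerivWithinAt.fun_sum fun i _ => by
        have := (hF i x hx).pow 2
        convert! this using 1
        simp; ring
    have hc : HasDerivWithinAt (fun x => ∑ i, F i x ^ 2) 0 (Icc 0 1) x :=
      (hasDerivWithinAt_const x _ k).congr hk (hk x hx)
    have := (hu x hx).eq_deriv _ hd hc
    rw [← Finset.mul_sum] at this
    linarith
  refine ⟨h1 x hx, ?_⟩
  have hd : HasDerivWithinAt (fun x => ∑ i, F i x * v i x)
      (∑ i, (v i x * v i x + F i x * (-(lam / c) * (w x * F i x)))) (Icc 0 1) x :=
    HasDerivWithinAt.fun_sum fun i _ => (hF i x hx).mul (hv i x).hasDerivWithinAt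
  have hc : HasDerivWithinAt (fun x => ∑ i, F i x * v i x) 0 (Icc 0 1) x :=
    (hasDerivWithinAt_const x _ 0).congr h1 (h1 x hx)
  have h2 := (hu x hx).eq_deriv _ hd hc
  have h3 : ∑ i, (v i x * v i x + F i x * (-(lam / c) * (w x * F i x))) =
      ∑ i, v i x ^ 2 - lam / c * (w x * ∑ i, F i x ^ 2) := by
    rw [Finset.mul_sum, Finset.mul_sum, ← Finset.sum_sub_distrib]
    exact Finset.sum_congr rfl fun i _ => by ring
  rw [h3, hk x hx] at h2
  linarith

/-- ∑ v² is constant because its derivative is a multiple of ∑ F v = 0; but it also equals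
(λ/c)·w·k. -/
lemma weight_eq_const {c lam k : ℝ} (hlam : lam ≠ 0) (hc : c ≠ 0) (hk0 : k ≠ 0) {w : ℝ → ℝ}
    {F v : ι → ℝ → ℝ}
    (hF : ∀ i, ∀ x ∈ Icc (0 : ℝ) 1, HasDerivWithinAt (F i) (v i x) (Icc 0 1) x)
    (hv : ∀ i x, HasDerivAt (v i) (-(lam / c) * (w x * F i x)) x)
    (hk : ∀ x ∈ Icc (0 : ℝ) 1, ∑ i, F i x ^ 2 = k) {x : ℝ} (hx : x ∈ Icc (0 : ℝ) 1) :
    w x = w 0 := by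
  have hd (x : ℝ) : HasDerivAt (fun x => ∑ i, v i x ^ 2)
      (∑ i, 2 * v i x * (-(lam / c) * (w x * F i x))) x :=
    HasDerivAt.fun_sum fun i _ => by
      have := (hv i x).pow 2
      convert! this using 1
      simp
  have hconst := constant_of_has_deriv_right_zero (f := fun x => ∑ i, v i x ^ 2) (a := 0) (b := 1)
    (fun x _ => (hd x).continuousAt.continuousWithinAt) (fun x hx => by
      have h0 : ∑ i, 2 * v i x * (-(lam / c) * (w x * F i x)) = 0 := by
        have := (sum_deriv_sq_eq hF hv hk ⟨hx.1, hx.2.le⟩).1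
        calc _ = -(2 * (lam / c) * w x) * ∑ i, F i x * v i x := by
              rw [Finset.mul_sum]
              exact Finset.sum_congr rfl fun i _ => by ring
          _ = 0 := by rw [this, mul_zero]
      have := (hd x).hasDerivWithinAt (s := Ici x)
      rwa [h0] at this) x hx
  simp only [(sum_deriv_sq_eq hF hv hk hx).2,
    (sum_deriv_sq_eq hF hv hk (left_mem_Icc.2 zero_le_one)).2] at hconst
  have h1 := mul_left_cancel₀ (div_ne_zero hlam hc) hconst
  exact mul_right_cancel₀ hk0 h1

/-- Vanishing variation of the metric. -/
lemma cond_mul_sum_energy_eq {α : ℝ} {f : ι → G.Sob} {lam : ℝ}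
    (hvar : ∀ (h : E → ℝ) (σ : E → C(ℝ, ℝ)), (∀ e, ContDiff ℝ ∞ (σ e)) →
      ∑ i, variation G α lam p h σ (f i) (f i) = 0) (e : E) :
    1 / 2 * p.cond e * ∑ i, inner ℝ ((f i).1.2 e) ((f i).1.2 e) =
      lam * ((1 - α) * p.g e ^ (1 - α) / lenSum α p + (α - 1 / 2) * p.g e ^ (α - 1 / 2) *
        (∫ x in (0 : ℝ)..1, p.weight e x) / massSum α p) *
          ∑ i, mass G p.weight (f i) (f i) := by
  classical
  -- With σ = 0 the weights are frozen; only the conductance of e and the powers of its g vary.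
  have h1 := hvar (Pi.single e 1) 0 fun _ => contDiff_const
  have hE (i : ι) : energy G (fun e' => -((Pi.single e 1 : E → ℝ) e' / 2) * p.cond e')
      (f i) (f i) = -(1 / 2) * p.cond e * inner ℝ ((f i).1.2 e) ((f i).1.2 e) := by
    rw [energy_apply, Finset.sum_eq_single e (fun e' _ h => by rw [Pi.single_eq_of_ne h]; simp)
      (by simp)]
    simp
  have hM (i : ι) : mass G (fun e' => p.weight e' * (0 : E → C(ℝ, ℝ)) e') (f i) (f i) = 0 := by
    simp [mass_apply]
  have hA : lenSum' α p (Pi.single e 1) = p.g e ^ (1 - α) * (1 - α) := by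
    rw [lenSum', Finset.sum_eq_single e (fun e' _ h => by rw [Pi.single_eq_of_ne h]; simp)
      (by simp)]
    simp
  have hB : massSum' α p (Pi.single e 1) 0 = p.g e ^ (α - 1 / 2) *
      ((α - 1 / 2) * ∫ x in (0 : ℝ)..1, p.weight e x) := by
    rw [massSum', Finset.sum_eq_single e (fun e' _ h => by rw [Pi.single_eq_of_ne h]; simp)
      (by simp)]
    simp
  simp only [variation_apply, hE, hM, hA, hB, mul_zero, sub_zero, Finset.sum_add_distrib,
    ← Finset.mul_sum] at h1
  linear_combination -h1

/-- There is no minimiser of the natural normalisation. -/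
theorem not_isMinimiser_normalisedEigenvalue (hG : G.IsConn) (p : MetricDensityPair E) :
    ¬ IsMinimiser (G.normalisedEigenvalue 1) p := by
  intro hp
  have hp' : IsMinimiser (G.alphaNormalisedEigenvalue (1 / 2) 1) p := fun q => by
    rw [← normalisedEigenvalue_eq, ← normalisedEigenvalue_eq]; exact hp q
  obtain ⟨f, hf, hf1, -⟩ := exists_eigenfunction hG p
  obtain ⟨e⟩ := hG.nonempty_edges
  have hE : Nonempty E := ⟨e⟩
  have hk (x : ℝ) (hx : x ∈ Icc (0 : ℝ) 1) := sum_val_sq_eq (ι := Unit) (α := 1 / 2)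
    (f := fun _ => f) hG (fun h σ hσ => by
      rw [Finset.univ_unique, Finset.sum_singleton]
      exact variation_eq_zero_of_isMinimiser hσ hG hp' hf hf1) e hx
  obtain ⟨v, hv, -, hF⟩ := exists_deriv_of_mem_eigenspace p.cond_pos hf e
  have h0 : (0 : ℝ) ∈ Icc (0 : ℝ) 1 := by simp
  have hpos : 0 < (∑ _i : Unit, mass G p.weight f f) * p.g e ^ ((1 : ℝ) / 2 - 1 / 2) /
      massSum (1 / 2) p := by
    have := massSum_pos p (1 / 2)
    have := Real.rpow_pos_of_pos (p.g_pos e) (1 / 2 - 1 / 2)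
    simp only [hf1, Finset.univ_unique, Finset.sum_singleton]
    positivity
  obtain ⟨h1, h2⟩ := sum_deriv_sq_eq (ι := Unit) (fun _ => hF) (fun _ => hv) hk h0
  have h3 := hk 0 h0
  simp only [Finset.univ_unique, Finset.sum_singleton] at h1 h2 h3
  have hw := p.weight_pos e 0 h0
  have hc := p.cond_pos e
  have hlam := eigenvalue_one_pos hG p
  -- The product f f′ vanishes, while f² and f′² are both positive constants times positive data.
  rcases mul_eq_zero.1 h1 with h | h
  · rw [h] at h3
    simp only [Finset.univ_unique, Finset.sum_singleton] at hpos
    rw [← h3] at hpos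
    simp at hpos
  · rw [h] at h2
    have : 0 < G.eigenvalue 1 p / p.cond e * (p.weight e 0 *
        ((∑ _i : Unit, mass G p.weight f f) * p.g e ^ ((1 : ℝ) / 2 - 1 / 2) /
          massSum (1 / 2) p)) := by positivity
    simp only [Finset.univ_unique, Finset.sum_singleton] at this
    rw [← h2] at this
    simp at this

end MultiGraph

/-! ### Oscillations on end beads, and hat functions -/

/-- Solutions of the harmonic oscillator equation have a conserved quantity. -/
lemma oscillator_conserved {X : Type*} [NormedAddCommGroup X] [NormedSpace ℝ X] {θ : ℝ}
    {F v : ℝ → X}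
    (hF : ∀ x ∈ Icc (0 : ℝ) 1, HasDerivWithinAt F (v x) (Icc 0 1) x)
    (hv : ∀ x ∈ Icc (0 : ℝ) 1, HasDerivWithinAt v (-(θ ^ 2 • F x)) (Icc 0 1) x) (a : ℝ) :
    (θ * Real.cos (θ * (a - 1))) • F 1 + Real.sin (θ * (a - 1)) • v 1 =
      (θ * Real.cos (θ * a)) • F 0 + Real.sin (θ * a) • v 0 := by
  -- For a solution this expression is θF(a), written through the position and velocity at x.
  have hd (x : ℝ) (hx : x ∈ Icc (0 : ℝ) 1) : HasDerivWithinAt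
      (fun x => (θ * Real.cos (θ * (a - x))) • F x + Real.sin (θ * (a - x)) • v x) 0
      (Icc 0 1) x := by
    have h0 : HasDerivAt (fun x : ℝ => θ * (a - x)) (-θ) x := by
      simpa using ((hasDerivAt_id x).const_sub a).const_mul θ
    have h1 := (((h0.cos).const_mul θ).hasDerivWithinAt (s := Icc 0 1)).smul (hF x hx)
    have h2 := (h0.sin.hasDerivWithinAt (s := Icc 0 1)).smul (hv x hx)
    refine (h1.add h2).congr_deriv ?_
    module
  have := constant_of_derivWithin_zero (fun x hx => (hd x hx).differentiableWithinAt)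
    (fun x hx => (hd x ⟨hx.1, hx.2.le⟩).derivWithin (uniqueDiffOn_Icc zero_lt_one x
      ⟨hx.1, hx.2.le⟩)) 1 (right_mem_Icc.2 zero_le_one)
  simpa using this

lemma integral_quadratic (a b c : ℝ) :
    ∫ x in (0 : ℝ)..1, (a + b * x + c * x ^ 2) = a + b / 2 + c / 3 := by
  have h (x : ℝ) : HasDerivAt (fun x => a * x + b / 2 * x ^ 2 + c / 3 * x ^ 3)
      (a + b * x + c * x ^ 2) x := by
    have := (((hasDerivAt_id x).const_mul a).add ((hasDerivAt_pow 2 x).const_mul (b / 2))).add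
      ((hasDerivAt_pow 3 x).const_mul (c / 3))
    refine this.congr_deriv ?_
    norm_num
    ring
  rw [intervalIntegral.integral_eq_sub_of_hasDerivAt (fun x _ => h x)
    (Continuous.intervalIntegrable (by fun_prop) _ _)]
  ring

namespace MultiGraph

variable {V E : Type*} {G : MultiGraph V E}

/-- Two parallel edges `e₁`, `e₂` join `a` and `b`, and there is no other edge at `a`. -/
structure IsEndBead (G : MultiGraph V E) (a b : V) (e₁ e₂ : E) : Prop where
  ne : a ≠ b
  edge_ne : e₁ ≠ e₂
  joins_left : G.Joins e₁ a b
  joins_right : G.Joins e₂ a b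
  eq_or_eq : ∀ e, G.src e = a ∨ G.tgt e = a → e = e₁ ∨ e = e₂

variable [Fintype E]

open Classical in
/-- If the frequency is not a multiple of `π`, a balanced net of oscillations is at rest at the end
of an end bead. -/
lemma IsEndBead.exists_eq_zero {a b : V} {e₁ e₂ : E} (hb : G.IsEndBead a b e₁ e₂) {X : Type*}
    [NormedAddCommGroup X] [NormedSpace ℝ X] {θ κ : ℝ} (hθ : Real.sin θ ≠ 0) (hκ : κ ≠ 0)
    {F v : E → ℝ → X} {ψ : V → X} {c : E → ℝ}
    (h0 : ∀ e, F e 0 = ψ (G.src e)) (h1 : ∀ e, F e 1 = ψ (G.tgt e))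
    (hF : ∀ e, ∀ x ∈ Icc (0 : ℝ) 1, HasDerivWithinAt (F e) (v e x) (Icc 0 1) x)
    (hv : ∀ e, e = e₁ ∨ e = e₂ → ∀ x ∈ Icc (0 : ℝ) 1,
      HasDerivWithinAt (v e) (-(θ ^ 2 • F e x)) (Icc 0 1) x)
    (hc : ∀ e, e = e₁ ∨ e = e₂ → c e = κ)
    (hbal : ∑ e with G.src e = a, c e • v e 0 - ∑ e with G.tgt e = a, c e • v e 1 = 0) :
    ∃ x ∈ Icc (0 : ℝ) 1, v e₁ x = 0 := by
  set d : E → X := fun e => (if G.src e = a then v e 0 else 0) - (if G.tgt e = a then v e 1 else 0)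
    with hd
  -- d is the outward velocity at a, whichever way the edge is parametrised. When sin θ ≠ 0 the end
  -- values determine it, so the two parallel edges share it.
  have hend (e : E) (he : e = e₁ ∨ e = e₂) (hj : G.Joins e a b) :
      θ • ψ b = (θ * Real.cos θ) • ψ a + Real.sin θ • d e := by
    rcases hj with ⟨hs, ht⟩ | ⟨hs, ht⟩
    · have := oscillator_conserved (hF e) (hv e he) 1
      rw [h0, h1, hs, ht] at this
      simpa [hd, hs, ht, hb.ne.symm] using this
    · have := oscillator_conserved (hF e) (hv e he) 0
      rw [h0, h1, hs, ht] at this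
      simp only [hd, hs, ht, hb.ne.symm, if_false, if_true]
      simp only [zero_sub, mul_neg, mul_one, Real.cos_neg, Real.sin_neg, mul_zero, Real.cos_zero,
        Real.sin_zero, zero_smul, add_zero] at this
      rw [← this]
      module
  have hdd : d e₁ = d e₂ := by
    have := (hend e₁ (.inl rfl) hb.joins_left).symm.trans (hend e₂ (.inr rfl) hb.joins_right)
    exact smul_right_injective X hθ (add_left_cancel this)
  have hsum : ∑ e, c e • d e = 0 := by
    rw [← hbal, Finset.sum_filter, Finset.sum_filter, ← Finset.sum_sub_distrib]
    refine Finset.sum_congr rfl fun e _ => ?_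
    simp only [hd, smul_sub, smul_ite, smul_zero]
  have hpair : ∑ e, c e • d e = κ • d e₁ + κ • d e₂ := by
    rw [← hc e₁ (.inl rfl)]
    nth_rewrite 2 [hc e₁ (.inl rfl)]
    rw [← hc e₂ (.inr rfl), ← Finset.sum_pair (f := fun e => c e • d e) hb.edge_ne]
    refine (Finset.sum_subset (Finset.subset_univ _) fun e _ he => ?_).symm
    have h1 : ¬ (G.src e = a ∨ G.tgt e = a) := fun h => he (by simpa using hb.eq_or_eq e h)
    push Not at h1
    simp [hd, h1.1, h1.2]
  have hz : d e₁ = 0 := by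
    rw [hsum, ← hdd, ← add_smul] at hpair
    exact (smul_eq_zero.1 hpair.symm).resolve_left (by simpa using hκ)
  rcases hb.joins_left with ⟨hs, ht⟩ | ⟨hs, ht⟩
  · exact ⟨0, by simp, by simpa [hd, hs, ht, hb.ne.symm] using hz⟩
  · exact ⟨1, by simp, by simpa [hd, hs, ht, hb.ne.symm] using hz⟩

variable [Fintype V]

open Sob MetricDensityPair

/-- Piecewise linear test functions: if the product of the end values vanishes on every edge, the
density cannot be large on the support. -/
lemma false_of_three_mul_cond_lt (hG : G.IsConn) {p : MetricDensityPair E} {φ : V → ℝ}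
    (hφ : φ ≠ 0) (hmean : mass G p.weight (lin φ) 1 = 0)
    (hprod : ∀ e, φ (G.src e) * φ (G.tgt e) = 0) {w : E → ℝ}
    (hw : ∀ e, φ (G.src e) ≠ 0 ∨ φ (G.tgt e) ≠ 0 →
      (∀ x ∈ Icc (0 : ℝ) 1, p.weight e x = w e) ∧ 3 * p.cond e < G.eigenvalue 1 p * w e) :
    False := by
  have hle := eigenvalue_one_mul_mass_le hG.incident p hmean
  refine hle.not_gt ?_
  -- An affine function with end values s, t has mass w(s² + st + t²)/3 and energy c(t − s)²; st = 0
  -- removes the cross terms.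
  have hterm (e : E) : G.eigenvalue 1 p * ∫ x in (0 : ℝ)..1, p.weight e x *
      val (lin φ : G.Sob) e x * val (lin φ : G.Sob) e x =
        G.eigenvalue 1 p * w e / 3 * (φ (G.src e) ^ 2 + φ (G.tgt e) ^ 2) := by
    by_cases h : φ (G.src e) ≠ 0 ∨ φ (G.tgt e) ≠ 0
    · have : ∫ x in (0 : ℝ)..1, p.weight e x *
          val (lin φ : G.Sob) e x * val (lin φ : G.Sob) e x =
          ∫ x in (0 : ℝ)..1, (w e * φ (G.src e) ^ 2 + (2 * w e * φ (G.src e) *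
            (φ (G.tgt e) - φ (G.src e))) * x + w e * (φ (G.tgt e) - φ (G.src e)) ^ 2 * x ^ 2) :=
        intervalIntegral.integral_congr fun x hx => by
          rw [uIcc_of_le zero_le_one] at hx
          rw [(hw e h).1 x hx, val_lin φ e hx]
          ring
      rw [this, integral_quadratic]
      linear_combination G.eigenvalue 1 p * w e / 3 * hprod e
    · push Not at h
      rw [h.1, h.2]
      have : ∫ x in (0 : ℝ)..1, p.weight e x *
          val (lin φ : G.Sob) e x * val (lin φ : G.Sob) e x = ∫ x in (0 : ℝ)..1, 0 :=
        intervalIntegral.integral_congr fun x hx => by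
          rw [uIcc_of_le zero_le_one] at hx
          rw [val_lin φ e hx, h.1, h.2]
          ring
      rw [this]
      simp
  have hen (e : E) : p.cond e * inner ℝ ((lin φ : G.Sob).1.2 e) ((lin φ : G.Sob).1.2 e) =
      p.cond e * (φ (G.src e) ^ 2 + φ (G.tgt e) ^ 2) := by
    rw [lin_snd, inner_smul_left, inner_smul_right, inner_primVec_primVec]
    simp only [min_self, max_eq_left zero_le_one, conj_trivial, mul_one]
    linear_combination -2 * p.cond e * hprod e
  have hlt (e : E) (he : φ (G.src e) ≠ 0 ∨ φ (G.tgt e) ≠ 0) :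
      p.cond e * (φ (G.src e) ^ 2 + φ (G.tgt e) ^ 2) <
        G.eigenvalue 1 p * w e / 3 * (φ (G.src e) ^ 2 + φ (G.tgt e) ^ 2) := by
    have hp : 0 < φ (G.src e) ^ 2 + φ (G.tgt e) ^ 2 := by
      rcases he with h | h <;> positivity
    have := (hw e he).2
    exact mul_lt_mul_of_pos_right (by linarith) hp
  rw [energy_apply, mass_apply, Finset.mul_sum]
  simp only [hterm, hen]
  obtain ⟨u, hu⟩ := Function.ne_iff.1 hφ
  obtain ⟨e, he⟩ := hG.incident u
  refine Finset.sum_lt_sum (fun e _ => ?_) ⟨e, Finset.mem_univ _, hlt e ?_⟩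
  · by_cases h : φ (G.src e) ≠ 0 ∨ φ (G.tgt e) ≠ 0
    · exact (hlt e h).le
    · push Not at h
      rw [h.1, h.2]
      simp
  · rcases he with rfl | rfl
    · exact .inl hu
    · exact .inr hu

/-- A graph with two end beads carries no balanced net of oscillations with nowhere vanishing
velocity whose frequencies come from the first eigenvalue. -/
theorem false_of_balanced_net (hG : G.IsConn) {a b a' b' : V} {e₁ e₂ e₁' e₂' : E}
    (hb : G.IsEndBead a b e₁ e₂) (hb' : G.IsEndBead a' b' e₁' e₂') (haa : a ≠ a') (hba : b ≠ a')
    {p : MetricDensityPair E} {w : E → ℝ} (hw : ∀ e, ∀ x ∈ Icc (0 : ℝ) 1, p.weight e x = w e)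
    (hsym : ∀ u u' e e', G.Joins e u u' → G.Joins e' u u' → p.cond e = p.cond e' ∧ w e = w e')
    {X : Type*} [NormedAddCommGroup X] [NormedSpace ℝ X] {F v : E → ℝ → X} {ψ : V → X}
    (h0 : ∀ e, F e 0 = ψ (G.src e)) (h1 : ∀ e, F e 1 = ψ (G.tgt e))
    (hF : ∀ e, ∀ x ∈ Icc (0 : ℝ) 1, HasDerivWithinAt (F e) (v e x) (Icc 0 1) x)
    (hv : ∀ e, ∀ x ∈ Icc (0 : ℝ) 1, HasDerivWithinAt (v e)
      (-((G.eigenvalue 1 p * w e / p.cond e) • F e x)) (Icc 0 1) x)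
    (hne : ∀ e, ∀ x ∈ Icc (0 : ℝ) 1, v e x ≠ 0)
    (hbal : ∀ u, open Classical in
      ∑ e with G.src e = u, p.cond e • v e 0 - ∑ e with G.tgt e = u, p.cond e • v e 1 = 0) :
    False := by
  classical
  have hlam := eigenvalue_one_pos hG p
  have hwpos (e : E) : 0 < w e := by
    rw [← hw e 0 (by simp)]; exact p.weight_pos e 0 (by simp)
  have hbead {u u' : V} {e e' : E} (hB : G.IsEndBead u u' e e') :
      ∀ d, G.src d = u ∨ G.tgt d = u → 3 * p.cond d < G.eigenvalue 1 p * w d := by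
    intro d hd
    obtain ⟨hc', hw'⟩ := hsym u u' e e' hB.joins_left hB.joins_right
    have hcd : p.cond d = p.cond e ∧ w d = w e := by
      rcases hB.eq_or_eq d hd with rfl | rfl
      · exact ⟨rfl, rfl⟩
      · exact ⟨hc'.symm, hw'.symm⟩
    rw [hcd.1, hcd.2]
    have hc := p.cond_pos e
    have hwe := hwpos e
    have hq : 0 < G.eigenvalue 1 p * w e / p.cond e := by positivity
    set θ := √(G.eigenvalue 1 p * w e / p.cond e) with hθ
    have hθ0 : 0 < θ := Real.sqrt_pos.2 hq
    have hθ2 : θ ^ 2 = G.eigenvalue 1 p * w e / p.cond e := Real.sq_sqrt hq.le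
    have hsin : Real.sin θ = 0 := by
      by_contra hs
      obtain ⟨x, hx, hx0⟩ := hB.exists_eq_zero (κ := p.cond e) (c := p.cond) hs hc.ne' h0 h1 hF
        (fun d hd x hx => by
          have h2 := hv d x hx
          rcases hd with rfl | rfl
          · rwa [hθ2]
          · rwa [hθ2, hc', hw'])
        (fun d hd => by rcases hd with rfl | rfl; exacts [rfl, hc'.symm])
        (by convert hbal u)
      exact hne e x hx hx0
    -- A positive zero of the sine is at least π, so θ² > 9, far above the threshold 3.
    have hπ : Real.pi ≤ θ := by
      by_contra! h
      exact (Real.sin_pos_of_pos_of_lt_pi hθ0 h).ne' hsin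
    have h3 : 3 < G.eigenvalue 1 p * w e / p.cond e := by
      rw [← hθ2]
      nlinarith [Real.pi_gt_three]
    rwa [lt_div_iff₀ hc] at h3
  -- Two hat functions suffice to satisfy the single linear condition of mean zero.
  obtain ⟨x, y, hxy, hm⟩ : ∃ x y : ℝ, (x ≠ 0 ∨ y ≠ 0) ∧
      x * mass G p.weight (lin (Pi.single a 1)) 1 +
        y * mass G p.weight (lin (Pi.single a' 1)) 1 = 0 := by
    by_cases h : mass G p.weight (lin (Pi.single a' 1)) 1 = 0
    · exact ⟨0, 1, by simp, by simp [h]⟩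
    · exact ⟨_, -mass G p.weight (lin (Pi.single a 1)) 1, .inl h, by ring⟩
  set φ : V → ℝ := x • Pi.single a 1 + y • Pi.single a' 1 with hφ
  have hlin : (lin φ : G.Sob) = x • lin (Pi.single a 1) + y • lin (Pi.single a' 1) := by
    refine Subtype.ext (Prod.ext rfl (funext fun e => ?_))
    change (lin φ : G.Sob).1.2 e = x • (lin (Pi.single a 1) : G.Sob).1.2 e +
      y • (lin (Pi.single a' 1) : G.Sob).1.2 e
    simp only [lin_snd, hφ, Pi.add_apply, Pi.smul_apply, smul_eq_mul]
    module
  have hφa : φ a = x := by simp [hφ, haa]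
  have hφa' : φ a' = y := by simp [hφ, haa.symm]
  have hφo {u : V} (hu : u ≠ a) (hu' : u ≠ a') : φ u = 0 := by simp [hφ, hu, hu']
  have htouch {u : V} (hu : φ u ≠ 0) : u = a ∨ u = a' := by
    by_contra! h
    exact hu (hφo h.1 h.2)
  have hjoin {u u' : V} {e e' : E} (hB : G.IsEndBead u u' e e') (hz : φ u' = 0) (d : E)
      (hd : G.src d = u ∨ G.tgt d = u) : φ (G.src d) * φ (G.tgt d) = 0 := by
    have hJ : G.Joins d u u' := by
      rcases hB.eq_or_eq d hd with rfl | rfl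
      exacts [hB.joins_left, hB.joins_right]
    rcases hJ with h | h <;> simp [h.1, h.2, hz]
  refine false_of_three_mul_cond_lt hG (p := p) (φ := φ) (w := w) (fun h => ?_) ?_ (fun e => ?_)
    fun e he => ⟨hw e, ?_⟩
  · rcases hxy with hx | hy
    · exact hx (by rw [← hφa, h]; rfl)
    · exact hy (by rw [← hφa', h]; rfl)
  · rw [hlin]
    simpa using hm
  -- No edge has both ends in the support: the only neighbour of a is b, which differs from a', and
  -- a' carries no loop.
  · by_contra hne0
    obtain ⟨hs, ht⟩ := mul_ne_zero_iff.1 hne0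
    by_cases hea : G.src e = a ∨ G.tgt e = a
    · exact hne0 (hjoin hb (hφo hb.ne.symm hba) e hea)
    · push Not at hea
      have hs' := (htouch hs).resolve_left hea.1
      have ht' := (htouch ht).resolve_left hea.2
      have hJ : G.Joins e a' b' := by
        rcases hb'.eq_or_eq e (.inl hs') with rfl | rfl
        exacts [hb'.joins_left, hb'.joins_right]
      rcases hJ with h | h
      · exact hb'.ne (ht'.symm.trans h.2)
      · exact hb'.ne (hs'.symm.trans h.1)
  · rcases he with h | h
    · rcases htouch h with h | h
      exacts [hbead hb e (.inl h), hbead hb' e (.inl h)]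
    · rcases htouch h with h | h
      exacts [hbead hb e (.inr h), hbead hb' e (.inr h)]

end MultiGraph

/-! ### Combinatorics of necklace graphs -/

namespace MultiGraph

variable {V E : Type*} [Fintype V] [Fintype E] {G : MultiGraph V E}

lemma Joins.eq_or_eq {e : E} {a b c d : V} (h : G.Joins e a b) (h' : G.Joins e c d) :
    (a = c ∧ b = d) ∨ (a = d ∧ b = c) := by
  rcases h with ⟨rfl, rfl⟩ | ⟨rfl, rfl⟩ <;> rcases h' with ⟨rfl, rfl⟩ | ⟨rfl, rfl⟩ <;> simp

/-- In a necklace graph every edge joins two consecutive vertices. -/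
lemma exists_joins_of_card {n : ℕ} (v : Fin (n + 1) ≃ V) (hE : Nat.card E = 2 * n)
    (h2 : ∀ j : Fin n, {e : E | G.Joins e (v j.castSucc) (v j.succ)}.ncard = 2) (e : E) :
    ∃ j : Fin n, G.Joins e (v j.castSucc) (v j.succ) := by
  classical
  have hdisj : ((Finset.univ : Finset (Fin n)) : Set (Fin n)).PairwiseDisjoint
      fun j => Finset.univ.filter fun e : E => G.Joins e (v j.castSucc) (v j.succ) := by
    intro i _ j _ hij
    refine Finset.disjoint_left.2 fun e hi hj => hij ?_
    rw [Finset.mem_filter] at hi hj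
    rcases hi.2.eq_or_eq hj.2 with h | h
    · exact Fin.castSucc_injective _ (v.injective h.1)
    · have h1 := congrArg Fin.val (v.injective h.1)
      have h2 := congrArg Fin.val (v.injective h.2)
      simp at h1 h2
      omega
  have hcard := Finset.card_biUnion hdisj
  have hj (j : Fin n) :
      (Finset.univ.filter fun e : E => G.Joins e (v j.castSucc) (v j.succ)).card = 2 := by
    rw [← h2 j, ← Set.ncard_coe_finset]
    simp
  simp only [hj, Finset.sum_const, Finset.card_univ, Fintype.card_fin, smul_eq_mul] at hcard
  -- The n disjoint pairs already account for all 2n edges, so nothing else is left.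
  have huniv := Finset.eq_univ_of_card _ (hcard.trans (by
    rw [← Nat.card_eq_fintype_card, hE, mul_comm]))
  have he := Finset.mem_univ e
  rw [← huniv, Finset.mem_biUnion] at he
  obtain ⟨j, -, hj⟩ := he
  exact ⟨j, (Finset.mem_filter.1 hj).2⟩

/-- A necklace graph with at least three vertices is connected and has two end beads. -/
theorem IsNecklace.exists_isEndBead (hG : G.IsNecklace) (hV : 3 ≤ Fintype.card V) :
    G.IsConn ∧ ∃ (a b a' b' : V) (e₁ e₂ e₁' e₂' : E), G.IsEndBead a b e₁ e₂ ∧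
      G.IsEndBead a' b' e₁' e₂' ∧ a ≠ a' ∧ b ≠ a' := by
  obtain ⟨n, v, hE, h2⟩ := hG
  have hn : 3 ≤ n + 1 := by rwa [← Fintype.card_congr v, Fintype.card_fin] at hV
  -- At least two beads: this separates the inner vertex of the first bead from the outer vertex of
  -- the last.
  obtain ⟨m, rfl⟩ : ∃ m, n = m + 2 := ⟨n - 2, by omega⟩
  have hcov := exists_joins_of_card v hE h2
  have hpair (j : Fin (m + 2)) := Set.ncard_eq_two.1 (h2 j)
  have hex (j : Fin (m + 2)) : ∃ e, G.Joins e (v j.castSucc) (v j.succ) := by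
    obtain ⟨e, e', -, h⟩ := hpair j
    have : e ∈ {e : E | G.Joins e (v j.castSucc) (v j.succ)} := by rw [h]; simp
    exact ⟨e, this⟩
  have hinj {i i' : Fin (m + 3)} (h : v i = v i') : i.val = i'.val :=
    congrArg Fin.val (v.injective h)
  refine ⟨⟨fun u => ?_, fun φ hφ => ?_, ⟨v 0, v 1, fun h => ?_⟩⟩, ?_⟩
  · obtain ⟨i, rfl⟩ := v.surjective u
    induction i using Fin.cases with
    | zero =>
      obtain ⟨e, he⟩ := hex 0
      exact ⟨e, he.elim (fun h => .inl h.1) fun h => .inr h.2⟩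
    | succ j =>
      obtain ⟨e, he⟩ := hex j
      exact ⟨e, he.elim (fun h => .inr h.2) fun h => .inl h.1⟩
  · have hall (i : Fin (m + 3)) : φ (v i) = φ (v 0) := by
      induction i using Fin.induction with
      | zero => rfl
      | succ j ih =>
        obtain ⟨e, he⟩ := hex j
        have := hφ e
        rcases he with ⟨hs, ht⟩ | ⟨hs, ht⟩ <;> rw [hs, ht] at this
        · rw [← this, ih]
        · rw [this, ih]
    intro u u'
    obtain ⟨i, rfl⟩ := v.surjective u
    obtain ⟨i', rfl⟩ := v.surjective u'
    rw [hall i, hall i']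
  · simpa using hinj h
  · obtain ⟨e₁, e₂, hne, h⟩ := hpair 0
    obtain ⟨e₁', e₂', hne', h'⟩ := hpair (Fin.last (m + 1))
    have hj (e : E) : G.Joins e (v 0) (v 1) ↔ e = e₁ ∨ e = e₂ := by
      have := Set.ext_iff.1 h e
      simpa using this
    -- The last bead is read backwards, so that its outer vertex comes first as in `IsEndBead`.
    have hj' (e : E) : G.Joins e (v (Fin.last (m + 2))) (v (Fin.last (m + 1)).castSucc) ↔
        e = e₁' ∨ e = e₂' := by
      have := Set.ext_iff.1 h' e
      rw [Joins]
      simp only [mem_ofPred_eq, Joins, Fin.succ_last, mem_insert_iff, mem_singleton_iff] at this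
      tauto
    refine ⟨v 0, v 1, v (Fin.last _), v (Fin.last (m + 1)).castSucc, e₁, e₂, e₁', e₂',
      ⟨fun h => ?_, hne, (hj _).2 (.inl rfl), (hj _).2 (.inr rfl), fun e he => ?_⟩,
      ⟨fun h => ?_, hne', (hj' _).2 (.inl rfl), (hj' _).2 (.inr rfl), fun e he => ?_⟩,
      fun h => ?_, fun h => ?_⟩
    · simpa using hinj h
    · obtain ⟨j, hJ⟩ := hcov e
      have h0 : v j.castSucc = v 0 ∨ v j.succ = v 0 := by
        rcases hJ with h | h <;> rw [h.1, h.2] at he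
        · exact he
        · exact he.symm
      have hj0 : j = 0 := by
        rcases h0 with h0 | h0
        · exact Fin.ext (by simpa using hinj h0)
        · have := hinj h0
          simp at this
      subst hj0
      exact (hj e).1 hJ
    · have := hinj h
      simp at this
    · obtain ⟨j, hJ⟩ := hcov e
      have h0 : v j.castSucc = v (Fin.last _) ∨ v j.succ = v (Fin.last _) := by
        rcases hJ with h | h <;> rw [h.1, h.2] at he
        · exact he
        · exact he.symm
      have hjl : j = Fin.last (m + 1) := by
        rcases h0 with h0 | h0
        · have h3 := hinj h0
          have := j.isLt
          simp only [Fin.val_castSucc, Fin.val_last] at h3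
          omega
        · refine Fin.ext ?_
          have := hinj h0
          simp at this ⊢
          omega
      subst hjl
      rw [Fin.succ_last] at hJ
      exact (hj' e).1 (Or.symm hJ)
    · simpa using hinj h
    · have := hinj h
      simp at this

end MultiGraph

/-! ### Exclusion of extremal pairs and of minimal immersions -/

namespace MultiGraph

variable {V E : Type*} [Fintype V] [Fintype E] {G : MultiGraph V E}

open Sob MetricDensityPair

/-- For `α ≠ 1/2, 1` an extremal pair has edges of equal length and constant density; the
eigenfunctions provided by extremality have constant sum of squares. -/
lemma exists_const_of_isExtremal (hG : G.IsConn) {α : ℝ} (hα : α ≠ 1 / 2) (hα1 : α ≠ 1)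
    {p : MetricDensityPair E} (hp : IsExtremal (G.alphaNormalisedEigenvalue α 1) p) :
    ∃ (n : ℕ) (f : Fin n → G.Sob) (c w k : ℝ), 0 < k ∧
      (∀ i, f i ∈ eigenspace G p.cond p.weight (G.eigenvalue 1 p)) ∧
      (∀ e, p.cond e = c) ∧ (∀ e, ∀ x ∈ Icc (0 : ℝ) 1, p.weight e x = w) ∧
      ∀ e, ∀ x ∈ Icc (0 : ℝ) 1, ∑ i, val (f i) e x ^ 2 = k := by
  obtain ⟨n, f, hf, ⟨i₀, hi₀⟩, hvar⟩ := exists_family_of_isExtremal hG hp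
  have hE := hG.nonempty_edges
  obtain ⟨e₀⟩ := hE
  have hE : Nonempty E := ⟨e₀⟩
  have hA := lenSum_pos p α
  have hB := massSum_pos p α
  have hlam := eigenvalue_one_pos hG p
  have hen (e : E) := cond_mul_sum_energy_eq hvar e
  set κ := ∑ i, mass G p.weight (f i) (f i) with hκ
  have hκ0 : 0 < κ := Finset.sum_pos' (fun i _ => mass_nonneg
    (fun e x hx => (p.weight_pos e x hx).le) _) ⟨i₀, Finset.mem_univ _,
      mass_pos p.weight_pos hG.incident hi₀⟩
  set k : E → ℝ := fun e => κ * p.g e ^ (α - 1 / 2) / massSum α p with hk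
  have hsq (e : E) (x : ℝ) (hx : x ∈ Icc (0 : ℝ) 1) : ∑ i, val (f i) e x ^ 2 = k e :=
    sum_val_sq_eq hG hvar e hx
  have hkpos (e : E) : 0 < k e := by
    have := Real.rpow_pos_of_pos (p.g_pos e) (α - 1 / 2)
    simp only [hk]
    positivity
  have h0 : (0 : ℝ) ∈ Icc (0 : ℝ) 1 := by simp
  have h1 : (1 : ℝ) ∈ Icc (0 : ℝ) 1 := by simp
  have hsrc (e : E) : ∑ i, (f i).1.1 (G.src e) ^ 2 = k e := by
    rw [← hsq e 0 h0]; simp only [val_zero]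
  have htgt (e : E) : ∑ i, (f i).1.1 (G.tgt e) ^ 2 = k e := by
    rw [← hsq e 1 h1]; simp only [val_one]
  -- The sum of squares at the vertices agrees along every edge, so connectedness makes it one
  -- constant.
  have hkeq (e e' : E) : k e = k e' := by
    rw [← hsrc e, ← hsrc e']
    exact hG.const (fun u => ∑ i, (f i).1.1 u ^ 2) (fun e => (hsrc e).trans (htgt e).symm) _ _
  -- α ≠ 1/2 makes the power with exponent α − 1/2 injective.
  have hgeq (e e' : E) : p.g e = p.g e' := by
    have h := hkeq e e'
    simp only [hk] at h
    rw [div_left_inj' hB.ne'] at h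
    exact (Real.rpow_left_inj (p.g_pos e).le (p.g_pos e').le (sub_ne_zero.2 hα)).1
      (mul_left_cancel₀ hκ0.ne' h)
  have hceq (e e' : E) : p.cond e = p.cond e' := by simp only [MetricDensityPair.cond, hgeq e e']
  choose v hv hae hF using fun (i : Fin n) (e : E) =>
    exists_deriv_of_mem_eigenspace p.cond_pos (hf i) e
  have hwc (e : E) (x : ℝ) (hx : x ∈ Icc (0 : ℝ) 1) : p.weight e x = p.weight e 0 :=
    weight_eq_const hlam.ne' (p.cond_pos e).ne' (hkpos e).ne' (fun i => hF i e)
      (fun i => hv i e) (hsq e) hx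
  have hint (e : E) : ∫ x in (0 : ℝ)..1, p.weight e x = p.weight e 0 := by
    rw [intervalIntegral.integral_congr (g := fun _ => p.weight e 0) fun x hx => by
      rw [uIcc_of_le zero_le_one] at hx; exact hwc e x hx]
    simp
  have hinn (e : E) : ∑ i, inner ℝ ((f i).1.2 e) ((f i).1.2 e) =
      G.eigenvalue 1 p / p.cond e * (p.weight e 0 * k e) := by
    have hcont (i : Fin n) : Continuous (v i e) :=
      continuous_iff_continuousAt.2 fun x => (hv i e x).continuousAt
    simp only [fun i => norm_snd_sq (hae i e)]
    rw [← intervalIntegral.integral_finsetSum fun i _ =>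
      Continuous.intervalIntegrable (u := fun x => v i e x ^ 2) ((hcont i).pow 2) _ _,
      intervalIntegral.integral_congr
        (g := fun _ => G.eigenvalue 1 p / p.cond e * (p.weight e 0 * k e)) fun x hx => ?_]
    · simp
    · rw [uIcc_of_le zero_le_one] at hx
      simp only
      rw [(sum_deriv_sq_eq (fun i => hF i e) (fun i => hv i e) (hsq e) hx).2, hwc e x hx]
  -- In the metric equation the `massSum` term equals (α − 1/2)·w·k. Moving it to the left leaves a
  -- common factor 1 − α, which cancels.
  have hw0 (e : E) : p.weight e 0 * k e = κ * p.g e ^ (1 - α) / lenSum α p := by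
    have h2 := hen e
    rw [hinn, hint] at h2
    have h3 : 1 / 2 * p.cond e * (G.eigenvalue 1 p / p.cond e * (p.weight e 0 * k e)) =
        G.eigenvalue 1 p * (1 / 2 * (p.weight e 0 * k e)) := by
      have := (p.cond_pos e).ne'
      field_simp
    have h4 : p.weight e 0 * k e * massSum α p = p.weight e 0 * (κ * p.g e ^ (α - 1 / 2)) := by
      simp only [hk]
      field_simp
    have h5 : (α - 1 / 2) * p.g e ^ (α - 1 / 2) * p.weight e 0 / massSum α p * κ =
        (α - 1 / 2) * (p.weight e 0 * k e) := by
      simp only [hk]; ring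
    rw [h3, mul_assoc] at h2
    have h6 := mul_left_cancel₀ hlam.ne' h2
    rw [add_mul, h5] at h6
    have h7 : (1 - α) * (p.weight e 0 * k e - κ * p.g e ^ (1 - α) / lenSum α p) = 0 := by
      linear_combination h6
    have := (mul_eq_zero.1 h7).resolve_left (sub_ne_zero.2 hα1.symm)
    linarith
  refine ⟨n, f, p.cond e₀, p.weight e₀ 0, k e₀, hkpos e₀, hf, fun e => hceq e e₀,
    fun e x hx => ?_, fun e x hx => by rw [hkeq e₀ e]; exact hsq e x hx⟩
  rw [hwc e x hx]
  have h2 := hw0 e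
  rw [hgeq e e₀, ← hw0 e₀, hkeq e e₀] at h2
  exact mul_right_cancel₀ (hkpos e₀).ne' h2

/-- Extremal pairs do not exist in the presence of two end beads. -/
theorem not_isExtremal_alphaNormalisedEigenvalue (hG : G.IsConn) {a b a' b' : V}
    {e₁ e₂ e₁' e₂' : E} (hb : G.IsEndBead a b e₁ e₂) (hb' : G.IsEndBead a' b' e₁' e₂')
    (haa : a ≠ a') (hba : b ≠ a') {α : ℝ} (hα : α ≠ 1 / 2) (hα1 : α ≠ 1)
    (p : MetricDensityPair E) : ¬ IsExtremal (G.alphaNormalisedEigenvalue α 1) p := by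
  intro hp
  obtain ⟨n, f, c, w, k, hk, hf, hc, hw, hsq⟩ := exists_const_of_isExtremal hG hα hα1 hp
  have hlam := eigenvalue_one_pos hG p
  choose v hv hae hF using fun (i : Fin n) (e : E) =>
    exists_deriv_of_mem_eigenspace p.cond_pos (hf i) e
  refine false_of_balanced_net hG hb hb' haa hba (w := fun _ => w) hw
    (fun u u' e e' _ _ => ⟨(hc e).trans (hc e').symm, rfl⟩)
    (F := fun e x i => val (f i) e x) (v := fun e x i => v i e x) (ψ := fun u i => (f i).1.1 u)
    (fun e => funext fun i => val_zero _ _) (fun e => funext fun i => val_one _ _)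
    (fun e x hx => hasDerivWithinAt_pi.2 fun i => hF i e x hx)
    (fun e x hx => hasDerivWithinAt_pi.2 fun i => ?_) (fun e x hx h => ?_) fun u => ?_
  · refine (hv i e x).hasDerivWithinAt.congr_deriv ?_
    rw [hw e x hx]
    simp only [Pi.neg_apply, Pi.smul_apply, smul_eq_mul]
    ring
  · have h2 := (sum_deriv_sq_eq (fun i => hF i e) (fun i => hv i e) (hsq e) hx).2
    have h3 : ∑ i, v i e x ^ 2 = 0 := Finset.sum_eq_zero fun i _ => by
      rw [show v i e x = 0 from congrFun h i]; simp
    have h4 := p.weight_pos e x hx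
    have h5 := p.cond_pos e
    have : 0 < G.eigenvalue 1 p / p.cond e * (p.weight e x * k) := by positivity
    rw [← h2, h3] at this
    exact this.false
  · classical
    funext i
    -- The indicator of u as test function isolates the balance at u, with the opposite sign.
    have h2 := kirchhoff_of_mem_eigenspace p.cond_pos (hf i) (hv i) (hae i) (Pi.single u 1)
    simp only [Pi.sub_apply, Finset.sum_apply, Finset.sum_filter, Pi.zero_apply]
    rw [← Finset.sum_sub_distrib, ← neg_eq_zero, ← Finset.sum_neg_distrib]
    refine (Finset.sum_congr rfl fun e _ => ?_).trans h2
    by_cases hs : G.src e = u <;> by_cases ht : G.tgt e = u <;>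
      simp only [hs, ht, Pi.single_apply, if_true, if_false, Pi.smul_apply, Pi.zero_apply,
        smul_eq_mul] <;> ring

/-- The first eigenvalue of a graph carrying an isometric minimal immersion into a sphere of radius
`R` by first eigenfunctions. -/
lemma eigenvalue_eq_of_isIsometricMinimalImmersion [Nonempty E] {g : E → ℝ} (hg : ∀ e, 0 < g e)
    {m : ℕ} {R μ : ℝ} (hR : 0 < R) {F : G.Point → EuclideanSpace ℝ (Fin m)}
    (hF : G.IsIsometricMinimalImmersion g R F)
    (hμ : ∀ i : Fin m, G.MemEigenspace (ofMetric g hg) μ fun q => F q i) : μ = (R ^ 2)⁻¹ := by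
  obtain ⟨e⟩ := ‹Nonempty E›
  have h0 : (0 : ℝ) ∈ Icc (0 : ℝ) 1 := by simp
  have hu := uniqueDiffOn_Icc (zero_lt_one (α := ℝ))
  have hne : G.onEdge F e 0 ≠ 0 := by
    have := hF.mem_sphere (G.edgePoint e (Set.projIcc 0 1 zero_le_one 0))
    rw [mem_sphere_zero_iff_norm] at this
    rw [← norm_ne_zero_iff]
    exact (this.trans_ne hR.ne')
  -- The sphere avoids the origin, so some coordinate is nonzero; there the geodesic and eigenvalue
  -- equations together determine μ.
  obtain ⟨i, hi⟩ : ∃ i, G.onEdge F e 0 i ≠ 0 := by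
    by_contra! h
    exact hne (PiLp.ext h)
  have hcoord : G.onEdge (fun q => F q i) e =
      (EuclideanSpace.proj i : EuclideanSpace ℝ (Fin m) →L[ℝ] ℝ) ∘ G.onEdge F e := rfl
  have hit : iteratedDerivWithin 2 (G.onEdge (fun q => F q i) e) (Icc 0 1) 0 =
      iteratedDerivWithin 2 (G.onEdge F e) (Icc 0 1) 0 i := by
    rw [hcoord, iteratedDerivWithin_eq_iteratedFDerivWithin,
      ContinuousLinearMap.iteratedFDerivWithin_comp_left _ (hF.contDiffOn e 0 h0) hu h0 le_rfl,
      iteratedDerivWithin_eq_iteratedFDerivWithin]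
    rfl
  have h2 := (hμ i).1 e |>.2 0 h0
  have h3 := congrArg (fun q : EuclideanSpace ℝ (Fin m) => q i) (hF.geodesic e 0 h0)
  rw [hit] at h2
  simp only [PiLp.smul_apply, PiLp.neg_apply, smul_eq_mul, ofMetric, mul_one] at h2 h3
  have h4 : G.onEdge (fun q => F q i) e 0 = G.onEdge F e 0 i := rfl
  rw [h4] at h2
  refine mul_right_cancel₀ hi ?_
  rw [← h2]
  linear_combination -h3

/-- Minimal immersions by first eigenfunctions do not exist in the presence of two end beads. -/
theorem not_isIsometricMinimalImmersion (hG : G.IsConn) {a b a' b' : V}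
    {e₁ e₂ e₁' e₂' : E} (hb : G.IsEndBead a b e₁ e₂) (hb' : G.IsEndBead a' b' e₁' e₂')
    (haa : a ≠ a') (hba : b ≠ a') {g : E → ℝ} (hg : ∀ e, 0 < g e) (hsym : G.IsSymmetricMetric g)
    {m : ℕ} {R : ℝ} (hR : 0 < R) {F : G.Point → EuclideanSpace ℝ (Fin m)}
    (hF : G.IsIsometricMinimalImmersion g R F)
    (hlam : ∀ i : Fin m, G.MemEigenspace (ofMetric g hg) (G.eigenvalue 1 (ofMetric g hg))
      fun q => F q i) : False := by
  have hE := hG.nonempty_edges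
  have hμ := eigenvalue_eq_of_isIsometricMinimalImmersion hg hR hF hlam
  have hu := uniqueDiffOn_Icc (zero_lt_one (α := ℝ))
  have hcond (e : E) : (ofMetric g hg).cond e = (√(g e))⁻¹ := rfl
  have hd (e : E) : DifferentiableOn ℝ (derivWithin (G.onEdge F e) (Icc 0 1)) (Icc 0 1) :=
    ((contDiffOn_succ_iff_derivWithin (n := 1) hu).1 (hF.contDiffOn e)).2.2.differentiableOn
      one_ne_zero
  refine false_of_balanced_net hG hb hb' haa hba (p := ofMetric g hg) (w := fun e => √(g e))
    (fun e x hx => by rw [weight_apply _ _ hx]; simp [ofMetric])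
    (fun u u' e e' h h' => by
      have := hsym u u' e e' h h'
      simp only [hcond, this, and_self])
    (F := G.onEdge F) (v := fun e => derivWithin (G.onEdge F e) (Icc 0 1))
    (ψ := fun u => F (G.vertex u)) (fun e => ?_) (fun e => ?_)
    (fun e x hx => ((hF.contDiffOn e).differentiableOn two_ne_zero x hx).hasDerivWithinAt)
    (fun e x hx => ?_) (fun e x hx h => ?_) fun u => hF.balanced u
  · have : G.edgePoint e 0 = G.vertex (G.src e) := Quot.sound (.src e)
    rw [← this]
    exact congrArg (fun y => F (G.edgePoint e y)) (Set.projIcc_left (h := zero_le_one (α := ℝ)))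
  · have : G.edgePoint e 1 = G.vertex (G.tgt e) := Quot.sound (.tgt e)
    rw [← this]
    exact congrArg (fun y => F (G.edgePoint e y)) (Set.projIcc_right (h := zero_le_one (α := ℝ)))
  · refine (hd e x hx).hasDerivWithinAt.congr_deriv ?_
    have h2 := hF.geodesic e x hx
    rw [iteratedDerivWithin_succ, iteratedDerivWithin_one] at h2
    have h3 := congrArg (fun q => g e • q) h2
    simp only [smul_inv_smul₀ (hg e).ne'] at h3
    -- With weight √g and conductance 1/√g, the squared frequency λw/c is g/R², which is the
    -- geodesic equation in the parameter of the edge.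
    rw [h3, hμ, hcond, smul_neg, smul_smul, div_inv_eq_mul, mul_assoc,
      Real.mul_self_sqrt (hg e).le, mul_comm]
  · have h2 := hF.isometric e x hx
    rw [h, norm_zero] at h2
    exact (Real.sqrt_pos.2 (hg e)).ne h2

end MultiGraph

namespace MetricDensityPair

lemma IsMaximiser.isExtremal {E : Type*} {Φ : MetricDensityPair E → ℝ} {p : MetricDensityPair E}
    (h : IsMaximiser Φ p) : IsExtremal Φ p := fun _ γ _ _ _ =>
  .inl ⟨fun _ => 0, Asymptotics.isLittleO_zero _ _, .of_forall fun t => by simpa using h (γ t)⟩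

lemma IsMinimiser.isExtremal {E : Type*} {Φ : MetricDensityPair E → ℝ} {p : MetricDensityPair E}
    (h : IsMinimiser Φ p) : IsExtremal Φ p := fun _ γ _ _ _ =>
  .inr ⟨fun _ => 0, Asymptotics.isLittleO_zero _ _, .of_forall fun t => by simpa using h (γ t)⟩

end MetricDensityPair

end

theorem mainTheorem12 {V E : Type*} [Fintype V] [Fintype E] (G : MultiGraph V E)
    (hG : G.IsNecklace) (hV : 3 ≤ Fintype.card V) :
    (¬ ∃ p : MetricDensityPair E,
      MetricDensityPair.IsMinimiser (G.normalisedEigenvalue 1) p) ∧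
    (∀ α : ℝ, α ≠ 1 / 2 → α ≠ 1 →
      (¬ ∃ p : MetricDensityPair E,
        MetricDensityPair.IsExtremal (G.alphaNormalisedEigenvalue α 1) p) ∧
      (¬ ∃ p : MetricDensityPair E,
        MetricDensityPair.IsMaximiser (G.alphaNormalisedEigenvalue α 1) p) ∧
      (¬ ∃ p : MetricDensityPair E,
        MetricDensityPair.IsMinimiser (G.alphaNormalisedEigenvalue α 1) p)) ∧
    (∀ (g : E → ℝ) (hg : ∀ e, 0 < g e), G.IsSymmetricMetric g →
      ∀ (m : ℕ) (R : ℝ), 0 < R →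
        ¬ ∃ F : G.Point → EuclideanSpace ℝ (Fin m),
          G.IsIsometricMinimalImmersion g R F ∧
          ∀ i : Fin m, G.MemEigenspace (MetricDensityPair.ofMetric g hg)
            (G.eigenvalue 1 (MetricDensityPair.ofMetric g hg)) (fun q => F q i)) := by
  obtain ⟨hC, a, b, a', b', e₁, e₂, e₁', e₂', hb, hb', haa, hba⟩ := hG.exists_isEndBead hV
  have hex {α : ℝ} (hα : α ≠ 1 / 2) (hα1 : α ≠ 1) (p : MetricDensityPair E) :=
    MultiGraph.not_isExtremal_alphaNormalisedEigenvalue hC hb hb' haa hba hα hα1 p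
  refine ⟨fun ⟨p, hp⟩ => MultiGraph.not_isMinimiser_normalisedEigenvalue hC p hp,
    fun α hα hα1 => ⟨fun ⟨p, hp⟩ => hex hα hα1 p hp, fun ⟨p, hp⟩ => hex hα hα1 p hp.isExtremal,
      fun ⟨p, hp⟩ => hex hα hα1 p hp.isExtremal⟩,
    fun g hg hsym m R hR ⟨F, hF, hlam⟩ =>
      MultiGraph.not_isIsometricMinimalImmersion hC hb hb' haa hba hg hsym hR hF hlam⟩
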